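/- Let $n\ge 1$ and let $\theta$ be a non-negative, non-decreasing function on $(0,\infty)$ with $\int_0^1\frac{\theta(t)}{t}\,dt<\infty$. A measurable function $K$ on $\{(x,y)\in\mathbb R^n\times\mathbb R^n: x\ne y\}$ is a $\theta$-type kernel if for some $C>0$: (i) $|K(x,y)|\le C|x-y|^{-n}$ for $x\neq y$; (ii) $|K(x,y)-K(z,y)|+|K(y,x)-K(y,z)|\le C|x-y|^{-n}\,\theta\big(\frac{|x-z|}{|x-y|}\big)$ whenever $0<|x-z|<|x-y|/2$. A linear operator $T_\theta:\mathscr S(\mathbb R^n)\to\mathscr S'(\mathbb R^n)$ is a $\theta$-type Calderón–Zygmund operator if it extends to a bounded linear operator on $L^2(\mathbb R^n)$ and there is a $\theta$-type kernel $K$ such that, for every $f\in C_0^\infty(\mathbb R^n)$, $T_\theta f(x)=\int_{\mathbb R^n}K(x,y)f(y)\,dy$ for almost every $x\notin\operatorname{supp} f$. A weight is a non-negative locally integrable function $w$ on $\mathbb R^n$, positive almost everywhere; $w(A)=\int_A w\,dx$, and $w\in A_1$ if for some $C>0$ one has $\frac1{|B|}\int_B w\,dx\le C\,\operatorname{ess\,inf}_B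 w$ for every ball $B$. A positive non-decreasing function $\psi$ on $(0,\infty)$ satisfies $\mathcal D_\kappa$ if for some $C>0$ one has $\frac{\psi(\xi)}{\xi^\kappa}\le C\,\frac{\psi(\xi')}{(\xi')^\kappa}$ for all $0<\xi'<\xi$. With suprema over all balls $B\subset\mathbb R^n$, let $\mathcal M^{1,\psi}(w)$ be the space of locally integrable $f$ with $$\|f\|_{\mathcal M^{1,\psi}(w)}=\sup_B\frac1{\psi(w(B))}\int_B|f|\,w\,dx<\infty,$$ and $W\mathcal M^{1,\psi}(w)$ the space of measurable $g$ with $$\|g\|_{W\mathcal M^{1,\psi}(w)}=\sup_B\sup_{\sigma>0}\frac{\sigma}{\psi(w(B))}\,w(\{x\in B:|g(x)|>\sigma\})<\infty .$$ For $f\in\mathcal M^{1,\psi}(w)$, $T_\theta f$ denotes the measurable function such that for every ball $B$, writing $2B$ for the concentric ball of twice the radius, $$T_\theta f(x)=T_\theta(f\chi_{2B})(x)+\int_{(2B)^c}K(x,y)f(y)\,dy\qquad\text{for a.e. }x\in B,$$ the integral converging absolutely. Here, for $u\in L^1_w(\mathbb R^n)$, $T_\theta u$ is the value at $u$ of the continuous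 extension of $T_\theta$ from $L^2\cap L^1_w$ to $L^1_w$: $T_\theta\varphi_k\to T_\theta u$ in $w$-measure whenever $\varphi_k\in L^2(\mathbb R^n)$ and $\varphi_k\to u$ in $L^1_w(\mathbb R^n)$. **Theorem 2.2.** Let $T_\theta$ be a $\theta$-type Calderón–Zygmund operator, let $w\in A_1$, and let $\psi$ satisfy $\mathcal D_\kappa$ with $0\le\kappa<1$. Then $T_\theta f$ is well defined for every $f\in\mathcal M^{1,\psi}(w)$ (it exists and is unique up to null sets), it agrees with the $L^2$ extension for $f\in L^2(\mathbb R^n)\cap\mathcal M^{1,\psi}(w)$, and $T_\theta$ is bounded from $\mathcal M^{1,\psi}(w)$ into $W\mathcal M^{1,\psi}(w)$: there is a constant $C>0$, independent of $f$, such that $$\|T_\theta f\|_{W\mathcal M^{1,\psi}(w)}\le C\,\|f\|_{\mathcal M^{1,\psi}(w)}\qquad\text{for all } f\in\mathcal M^{1,\psi}(w).$$ -/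

import Mathlib

open MeasureTheory Filter Topology Set
open scoped ENNReal SchwartzMap

noncomputable section

namespace ThetaMorrey

/-- The Euclidean space `ℝⁿ`. -/
abbrev E (n : ℕ) : Type := EuclideanSpace ℝ (Fin n)

/-- A non-negative, non-decreasing function `θ` on `(0, ∞)` with `∫₀¹ θ(t)/t dt < ∞`. -/
structure IsDiniModulus (θ : ℝ → ℝ) : Prop where
  nonneg : ∀ t, 0 < t → 0 ≤ θ t
  mono : MonotoneOn θ (Ioi 0)
  dini : IntegrableOn (fun t => θ t / t) (Ioc 0 1) volume

/-- `θ`-type kernels. The values of `K` on the diagonal are irrelevant. In the smoothness condition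
the case `x = z`, where the left-hand side vanishes and `θ` would be evaluated at `0`,
is left out. -/
structure IsThetaKernel {n : ℕ} (θ : ℝ → ℝ) (K : E n → E n → ℂ) : Prop where
  measurable : AEStronglyMeasurable (fun p : E n × E n => K p.1 p.2)
    (volume.restrict {p : E n × E n | p.1 ≠ p.2})
  bounds : ∃ C : ℝ, 0 < C ∧
    (∀ x y, x ≠ y → ‖K x y‖ ≤ C / ‖x - y‖ ^ n) ∧
    (∀ x y z, x ≠ z → ‖x - z‖ < ‖x - y‖ / 2 →
      ‖K x y - K z y‖ + ‖K y x - K y z‖ ≤ C / ‖x - y‖ ^ n * θ (‖x - z‖ / ‖x - y‖))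

/-- A `θ`-type Calderón–Zygmund operator on `ℝⁿ`: a linear operator from the Schwartz space to the
tempered distributions, with its bounded linear extension to `L²` and its `θ`-type kernel, which
represents the operator on compactly supported smooth functions `φ` off the support of `φ`. -/
structure ThetaCZO (n : ℕ) (θ : ℝ → ℝ) where
  /-- the operator from `𝓢(ℝⁿ)` to `𝓢'(ℝⁿ)` -/
  toDistribution : 𝓢(E n, ℂ) →ₗ[ℂ] 𝓢'(E n, ℂ)
  /-- the bounded extension to `L²(ℝⁿ)` -/
  toL2 : Lp ℂ 2 (volume : Measure (E n)) →L[ℂ] Lp ℂ 2 (volume : Measure (E n))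
  extends_toL2 : ∀ φ : 𝓢(E n, ℂ),
    toDistribution φ = Lp.toTemperedDistribution (toL2 (φ.toLp 2 volume))
  /-- the kernel -/
  kernel : E n → E n → ℂ
  isThetaKernel : IsThetaKernel θ kernel
  representation : ∀ φ : 𝓢(E n, ℂ), HasCompactSupport φ →
    ∀ᵐ x ∂(volume : Measure (E n)), x ∉ tsupport φ →
      toL2 (φ.toLp 2 volume) x = ∫ y, kernel x y * φ y

/-- A weight: a non-negative locally integrable function, positive almost everywhere. -/
structure IsWeight {n : ℕ} (w : E n → ℝ) : Prop where
  nonneg : ∀ x, 0 ≤ w x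
  locallyIntegrable : LocallyIntegrable w volume
  pos : ∀ᵐ x ∂(volume : Measure (E n)), 0 < w x

/-- The measure `w(x) dx`, so that `wMeasure w A = w(A)`. -/
def wMeasure {n : ℕ} (w : E n → ℝ) : Measure (E n) :=
  volume.withDensity fun x => ENNReal.ofReal (w x)

/-- The Muckenhoupt class `A₁`:
`|B|⁻¹ ∫_B w ≤ C · ess inf_B w` for every ball `B`. -/
structure IsA1 {n : ℕ} (w : E n → ℝ) : Prop where
  isWeight : IsWeight w
  bound : ∃ C : ℝ, 0 < C ∧ ∀ (c : E n) (r : ℝ), 0 < r →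
    (∫⁻ x in Metric.ball c r, ENNReal.ofReal (w x)) / volume (Metric.ball c r) ≤
      ENNReal.ofReal C *
        essInf (fun x => ENNReal.ofReal (w x)) (volume.restrict (Metric.ball c r))

/-- `ψ` is a positive increasing (that is, non-decreasing) function on `(0, ∞)` satisfying the
condition `𝒟_κ`. -/
structure SatisfiesD (κ : ℝ) (ψ : ℝ → ℝ) : Prop where
  pos : ∀ t, 0 < t → 0 < ψ t
  mono : MonotoneOn ψ (Ioi 0)
  bound : ∃ C : ℝ, 0 < C ∧ ∀ ξ' ξ : ℝ, 0 < ξ' → ξ' < ξ →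
    ψ ξ / ξ ^ κ ≤ C * (ψ ξ' / ξ' ^ κ)

/-- The norm of `ℳ^{1,ψ}(w)`, with values in `[0, ∞]`. -/
def morreyNorm {n : ℕ} (ψ : ℝ → ℝ) (w : E n → ℝ) (f : E n → ℂ) : ℝ≥0∞ :=
  ⨆ (c : E n) (r : ℝ) (_ : 0 < r),
    (∫⁻ x in Metric.ball c r, ‖f x‖ₑ ∂(wMeasure w)) /
      ENNReal.ofReal (ψ (wMeasure w (Metric.ball c r)).toReal)

/-- Membership in the generalized weighted Morrey space `ℳ^{1,ψ}(w)`. -/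
def MemMorrey {n : ℕ} (ψ : ℝ → ℝ) (w : E n → ℝ) (f : E n → ℂ) : Prop :=
  LocallyIntegrable f volume ∧ morreyNorm ψ w f < ∞

/-- The (quasi-)norm of `Wℳ^{1,ψ}(w)`, with values in `[0, ∞]`. -/
def weakMorreyNorm {n : ℕ} (ψ : ℝ → ℝ) (w : E n → ℝ) (g : E n → ℂ) : ℝ≥0∞ :=
  ⨆ (c : E n) (r : ℝ) (_ : 0 < r) (σ : ℝ) (_ : 0 < σ),
    ENNReal.ofReal σ * wMeasure w {x | x ∈ Metric.ball c r ∧ σ < ‖g x‖} /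
      ENNReal.ofReal (ψ (wMeasure w (Metric.ball c r)).toReal)

/-- Membership in the generalized weighted weak Morrey space `Wℳ^{1,ψ}(w)`. -/
def MemWeakMorrey {n : ℕ} (ψ : ℝ → ℝ) (w : E n → ℝ) (g : E n → ℂ) : Prop :=
  AEStronglyMeasurable g volume ∧ weakMorreyNorm ψ w g < ∞

/-- `h` is the value at `u ∈ L¹_w` of the extension by continuity of the operator from `L² ∩ L¹_w`
to `L¹_w`: whenever `φ k ∈ L²` tends to `u` in `L¹_w`, the functions `T (φ k)` tend to `h`
in `w`-measure. -/
def ThetaCZO.IsL1Value {n : ℕ} {θ : ℝ → ℝ} (T : ThetaCZO n θ) (w : E n → ℝ)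
    (u h : E n → ℂ) : Prop :=
  Integrable u (wMeasure w) ∧ AEStronglyMeasurable h volume ∧
    ∀ φ : ℕ → Lp ℂ 2 (volume : Measure (E n)),
      Tendsto (fun k => ∫⁻ x, ‖φ k x - u x‖ₑ ∂(wMeasure w)) atTop (𝓝 0) →
        TendstoInMeasure (wMeasure w) (fun k => (T.toL2 (φ k) : E n → ℂ)) atTop h

/-- `g` is the image of `f` under the operator, for `f` that need not be globally integrable:
on every ball `B`, `g` is almost everywhere the value of the operator at `f χ_{2B} ∈ L¹_w` plus the
absolutely convergent integral of `K(x, ·) f` over the complement of `2B`. -/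
def ThetaCZO.IsImage {n : ℕ} {θ : ℝ → ℝ} (T : ThetaCZO n θ) (w : E n → ℝ)
    (f g : E n → ℂ) : Prop :=
  AEStronglyMeasurable g volume ∧
    ∀ (c : E n) (r : ℝ), 0 < r →
      ∃ h : E n → ℂ, T.IsL1Value w ((Metric.ball c (2 * r)).indicator f) h ∧
        ∀ᵐ x ∂(volume.restrict (Metric.ball c r)),
          IntegrableOn (fun y => T.kernel x y * f y) (Metric.ball c (2 * r))ᶜ volume ∧
          g x = h x + ∫ y in (Metric.ball c (2 * r))ᶜ, T.kernel x y * f y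

end ThetaMorrey

end

/-!
The theorem rests on one inequality: `T` is of weak type `(1, 1)` with respect to `w dx`,
`t · w {|T f| > t} ≤ A ∫ |f| w` for `f ∈ L²` (`ThetaCZO.exists_weak_type`).

For `w = 1` this is the classical Calderón–Zygmund argument (`exists_weak_type_volume`). It is run
with Whitney balls of the set where the maximal function exceeds `t` in place of dyadic cubes. The
Dini condition on `θ` enters as a tail estimate (`IsDiniModulus.exists_tail_bound`), which yields
Hörmander's condition.

The passage to an `A₁` weight is a good-`λ` argument. The level sets of `T f` are replaced by the
open sets `medianSet (T f) t` of points that lie in some ball on more than half of which `|T f| > t`.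
If a ball contains a point where the maximal function of `f` is at most `γ t`, and its double is not
contained in the median set at level `t`, then the median set at level `(1 + 4 ε) t` covers at most
half of the ball (`exists_medianSet_ball_bound`): the local part of `T f` is small by the unweighted
inequality and the rest hardly oscillates. An `A₁` measure turns "at most half" for Lebesgue measure
into a fixed proportion for `w`, so that `w` of the median sets decreases by a definite factor from
one level to the next (`exists_goodLambda`). Raising the level by a factor close enough to `1`,
the quantity `t · w (medianSet (T f) t)` contracts up to the maximal function, which is itself of
weak type `(1, 1)`. For `f` of bounded support the quantity stays bounded as `t → 0`
(`exists_apriori_bound`), so the recursion can be summed.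

The weak type inequality extends `T` to `L¹_w`: images of a rapidly converging sequence converge
almost everywhere (`exists_weakApprox`), and off the support of the function the extension is still
given by the kernel (`IsL1Value.eq_integral`).

For a function `f` in the Morrey space and a ball `B`, the integral of `|K(x, ·) f|` over the
complement of `2B` is summed over dyadic annuli. The `A₁` condition bounds the sum by
`∑ⱼ ψ(w(2ʲB)) / w(2ʲB)` times the norm of `f`. Since `w` satisfies a reverse doubling condition,
`𝒟_κ` with `κ < 1` makes this series geometric, with sum comparable to `ψ(w(B)) / w(B)`
(`A1Measure.exists_growth_decay`, `ThetaCZO.exists_lintegral_kernel_le`). Hence the local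
descriptions of `T f` make sense. They agree on overlaps, by additivity of the extension and the
kernel representation (`IsL1Value.ae_add_integral_eq`), and so define `T f`. On `B` the part of `f`
in `2B` obeys the weak type inequality, and the rest contributes at most a constant of the size
`ψ(w(B)) / w(B)`, whose weak norm on `B` is `ψ(w(B))` (`exists_weakMorreyNorm_le`).
-/

noncomputable section

namespace ThetaMorrey

open Metric

/-! ### Volumes of balls and Vitali coverings -/

lemma volume_ball_mul {n : ℕ} (c c' : E n) {k r : ℝ} (hk : 0 < k) (hr : 0 < r) :
    volume (ball c (k * r)) = ENNReal.ofReal k ^ n * volume (ball c' r) := by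
  rw [Measure.addHaar_ball_of_pos volume c (mul_pos hk hr),
    Measure.addHaar_ball_of_pos volume c' hr, mul_pow, ENNReal.ofReal_mul (by positivity),
    mul_assoc, finrank_euclideanSpace_fin, ENNReal.ofReal_pow hk.le]

lemma volume_ball_ne_zero {n : ℕ} (c : E n) {r : ℝ} (hr : 0 < r) : volume (ball c r) ≠ 0 :=
  (measure_ball_pos volume c hr).ne'

lemma volume_ball_ne_top {n : ℕ} (c : E n) (r : ℝ) : volume (ball c r) ≠ ∞ :=
  measure_ball_lt_top.ne

lemma pos_of_mem_ball {n : ℕ} {c x : E n} {r : ℝ} (hx : x ∈ ball c r) : 0 < r :=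
  dist_nonneg.trans_lt hx

/-- Vitali's covering lemma for families of open balls of bounded radius. -/
lemma exists_disjoint_balls {n : ℕ} (t : Set (E n × ℝ)) (R : ℝ)
    (ht : ∀ b ∈ t, 0 < b.2 ∧ b.2 ≤ R) :
    ∃ u ⊆ t, u.Countable ∧ u.PairwiseDisjoint (fun b => ball b.1 b.2) ∧
      ∀ a ∈ t, ∃ b ∈ u, ball a.1 a.2 ⊆ ball b.1 (6 * b.2) := by
  obtain ⟨u, hut, hdis, hcov⟩ := Vitali.exists_disjoint_subfamily_covering_enlargement_closedBall
    t (fun b : E n × ℝ => b.1) (fun b => b.2) R (fun a ha => (ht a ha).2) 5 (by norm_num)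
  have hdis' : u.PairwiseDisjoint (fun b => ball b.1 b.2) :=
    fun a ha b hb hab => (hdis ha hb hab).mono ball_subset_closedBall ball_subset_closedBall
  refine ⟨u, hut, ?_, hdis', fun a ha => ?_⟩
  · exact hdis'.countable_of_isOpen (fun b _ => isOpen_ball)
      (fun b hb => nonempty_ball.2 (ht b (hut hb)).1)
  · obtain ⟨b, hb, hab⟩ := hcov a ha
    refine ⟨b, hb, ball_subset_closedBall.trans (hab.trans (closedBall_subset_ball ?_))⟩
    linarith [(ht b (hut hb)).1]

/-- Balls of bounded volume have bounded radius; this fails for `n = 0`. -/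
lemma exists_radius_bound {n : ℕ} (hn : 0 < n) {m : ℝ≥0∞} (hm : m ≠ ∞) :
    ∃ R : ℝ, ∀ (c : E n) (r : ℝ), volume (ball c r) ≤ m → r ≤ R := by
  have hv := volume_ball_ne_zero (0 : E n) one_pos
  have hfin : m / volume (ball (0 : E n) 1) ≠ ∞ := ENNReal.div_ne_top hm hv
  refine ⟨max 1 (m / volume (ball (0 : E n) 1)).toReal, fun c r h => ?_⟩
  by_contra! hlt
  have h1 : 1 < r := (le_max_left _ _).trans_lt hlt
  have h2 : (m / volume (ball (0 : E n) 1)).toReal < r := (le_max_right _ _).trans_lt hlt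
  have h3 := volume_ball_mul c (0 : E n) (zero_lt_one.trans h1) one_pos
  rw [mul_one] at h3
  have h4 : ENNReal.ofReal r ≤ ENNReal.ofReal r ^ n :=
    le_self_pow₀ (by simpa using h1.le) hn.ne'
  have h5 : ENNReal.ofReal r * volume (ball (0 : E n) 1) ≤ m :=
    (mul_le_mul_left h4 _).trans (h3 ▸ h)
  have h6 : ENNReal.ofReal r ≤ m / volume (ball (0 : E n) 1) :=
    (ENNReal.le_div_iff_mul_le (Or.inl hv) (Or.inl (volume_ball_ne_top _ _))).2 h5
  have h7 := ENNReal.toReal_mono hfin h6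
  rw [ENNReal.toReal_ofReal (by linarith)] at h7
  linarith

/-! ### The uncentred Hardy–Littlewood maximal function -/

/-- The uncentred Hardy–Littlewood maximal function with respect to Lebesgue measure,
`M F(x) = sup_{B ∋ x} |B|⁻¹ ∫_B F`, for functions with values in `[0, ∞]`. -/
def maximalFn {n : ℕ} (F : E n → ℝ≥0∞) (x : E n) : ℝ≥0∞ :=
  ⨆ (c : E n) (r : ℝ) (_ : x ∈ ball c r), (∫⁻ y in ball c r, F y) / volume (ball c r)

lemma lintegral_ball_le_maximalFn {n : ℕ} (F : E n → ℝ≥0∞) {x c : E n} {r : ℝ}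
    (hx : x ∈ ball c r) : ∫⁻ y in ball c r, F y ≤ maximalFn F x * volume (ball c r) := by
  rw [← ENNReal.div_le_iff (volume_ball_ne_zero c (pos_of_mem_ball hx)) (volume_ball_ne_top c r)]
  exact le_iSup₂_of_le c r (le_iSup_of_le hx le_rfl)

lemma lt_maximalFn_iff {n : ℕ} {F : E n → ℝ≥0∞} {x : E n} {t : ℝ≥0∞} :
    t < maximalFn F x ↔
      ∃ c r, x ∈ ball c r ∧ t * volume (ball c r) < ∫⁻ y in ball c r, F y := by
  simp only [maximalFn, lt_iSup_iff]
  constructor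
  · rintro ⟨c, r, hx, h⟩
    refine ⟨c, r, hx, ?_⟩
    rwa [ENNReal.lt_div_iff_mul_lt (Or.inl (volume_ball_ne_zero c (pos_of_mem_ball hx)))
      (Or.inl (volume_ball_ne_top c r))] at h
  · rintro ⟨c, r, hx, h⟩
    refine ⟨c, r, hx, ?_⟩
    rwa [ENNReal.lt_div_iff_mul_lt (Or.inl (volume_ball_ne_zero c (pos_of_mem_ball hx)))
      (Or.inl (volume_ball_ne_top c r))]

lemma isOpen_lt_maximalFn {n : ℕ} (F : E n → ℝ≥0∞) (t : ℝ≥0∞) :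
    IsOpen {x | t < maximalFn F x} := by
  rw [isOpen_iff_mem_nhds]
  intro x hx
  obtain ⟨c, r, hxc, h⟩ := lt_maximalFn_iff.1 hx
  filter_upwards [isOpen_ball.mem_nhds hxc] with y hy
  exact lt_maximalFn_iff.2 ⟨c, r, hy, h⟩

lemma maximalFn_mono {n : ℕ} {F G : E n → ℝ≥0∞} (h : ∀ x, F x ≤ G x) (x : E n) :
    maximalFn F x ≤ maximalFn G x :=
  iSup₂_mono fun _ _ => iSup_mono fun _ => ENNReal.div_le_div_right (lintegral_mono h) _

/-- Lebesgue differentiation along centred balls. -/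
lemma ae_le_maximalFn {n : ℕ} {F : E n → ℝ≥0∞} (hF : AEMeasurable F volume)
    (hfin : ∫⁻ y, F y ≠ ∞) : ∀ᵐ x ∂(volume : Measure (E n)), F x ≤ maximalFn F x := by
  filter_upwards [(Besicovitch.vitaliFamily (volume : Measure (E n))).ae_tendsto_lintegral_div
    hF hfin] with x hx
  have h := hx.comp (Besicovitch.tendsto_filterAt volume x)
  refine le_of_tendsto h ?_
  filter_upwards [self_mem_nhdsWithin] with r hr
  have hr : 0 < r := hr
  have hae : (closedBall x r : Set (E n)) =ᵐ[volume] ball x r :=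
    (ae_eq_of_subset_of_measure_ge ball_subset_closedBall
      (by rw [Measure.addHaar_closedBall volume x hr.le, Measure.addHaar_ball_of_pos volume x hr])
      measurableSet_ball.nullMeasurableSet
      measure_closedBall_lt_top.ne).symm
  simp only [Function.comp]
  rw [setLIntegral_congr hae, measure_congr hae]
  exact le_iSup₂_of_le x r (le_iSup_of_le (mem_ball_self hr) le_rfl)

/-! ### Measures with the `A₁` property -/

/-- The `A₁` property of a measure `μ` on `ℝⁿ`, with constant `C`: it is locally finite, mutually
absolutely continuous with Lebesgue measure, and its averages over balls are controlled by
`μ(B) / |B| · ∫_B F dx ≤ C ∫_B F dμ` for all `F ≥ 0`. For `μ = w dx` the last condition is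
equivalent to `|B|⁻¹ ∫_B w ≤ C ess inf_B w`; the integrated form is the one that is used. -/
structure A1Measure {n : ℕ} (μ : Measure (E n)) (C : ℝ≥0∞) : Prop where
  ne_top : C ≠ ∞
  ball_ne_top : ∀ (c : E n) (r : ℝ), μ (ball c r) ≠ ∞
  le : ∀ (c : E n) (r : ℝ) (F : E n → ℝ≥0∞), AEMeasurable F volume →
    μ (ball c r) * ∫⁻ y in ball c r, F y ≤ C * volume (ball c r) * ∫⁻ y in ball c r, F y ∂μ
  ac : μ ≪ volume
  ac' : volume ≪ μ

lemma A1Measure.volume {n : ℕ} : A1Measure (volume : Measure (E n)) 1 where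
  ne_top := by simp
  ball_ne_top := volume_ball_ne_top
  le c r F _ := by rw [one_mul]
  ac := Measure.AbsolutelyContinuous.rfl
  ac' := Measure.AbsolutelyContinuous.rfl

namespace A1Measure

variable {n : ℕ} {μ : Measure (E n)} {C : ℝ≥0∞}

lemma ball_ne_zero (h : A1Measure μ C) (c : E n) {r : ℝ} (hr : 0 < r) : μ (ball c r) ≠ 0 :=
  fun h0 => volume_ball_ne_zero c hr (h.ac' h0)

lemma measure_mul_le (h : A1Measure μ C) (c : E n) (r : ℝ) {A : Set (E n)}
    (hA : MeasurableSet A) (hAB : A ⊆ ball c r) :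
    μ (ball c r) * MeasureTheory.volume A ≤ C * MeasureTheory.volume (ball c r) * μ A := by
  have := h.le c r (A.indicator 1) (aemeasurable_one.indicator hA)
  simpa only [lintegral_indicator_one hA, Measure.restrict_apply hA,
    inter_eq_self_of_subset_left hAB] using this

lemma doubling (h : A1Measure μ C) (c c' : E n) {k r : ℝ} (hk : 0 < k) (hr : 0 < r)
    (hsub : ball c' r ⊆ ball c (k * r)) :
    μ (ball c (k * r)) ≤ C * ENNReal.ofReal k ^ n * μ (ball c' r) := by
  have h1 := h.measure_mul_le c (k * r) measurableSet_ball hsub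
  rw [volume_ball_mul c c' hk hr] at h1
  have hv0 := volume_ball_ne_zero c' hr
  have hvt := volume_ball_ne_top c' r
  rw [← ENNReal.mul_le_mul_iff_left hv0 hvt]
  calc _ ≤ _ := h1
    _ = _ := by ring

lemma doubling_self (h : A1Measure μ C) (c : E n) {k r : ℝ} (hk : 1 ≤ k) (hr : 0 < r) :
    μ (ball c (k * r)) ≤ C * ENNReal.ofReal k ^ n * μ (ball c r) :=
  h.doubling c c (by linarith) hr (ball_subset_ball (by nlinarith))

lemma mul_measure_ball_le (h : A1Measure μ C) {F : E n → ℝ≥0∞}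
    (hF : AEMeasurable F MeasureTheory.volume) {c : E n} {r : ℝ} (hr : 0 < r) {t : ℝ≥0∞}
    (ht : t * MeasureTheory.volume (ball c r) ≤ ∫⁻ y in ball c r, F y) :
    t * μ (ball c r) ≤ C * ∫⁻ y in ball c r, F y ∂μ := by
  rw [← ENNReal.mul_le_mul_iff_left (volume_ball_ne_zero c hr) (volume_ball_ne_top c r)]
  calc t * μ (ball c r) * MeasureTheory.volume (ball c r)
      = μ (ball c r) * (t * MeasureTheory.volume (ball c r)) := by ring
    _ ≤ μ (ball c r) * ∫⁻ y in ball c r, F y := mul_le_mul_right ht _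
    _ ≤ C * MeasureTheory.volume (ball c r) * ∫⁻ y in ball c r, F y ∂μ := h.le c r F hF
    _ = _ := by ring

/-- The weak type `(1, 1)` inequality for the maximal function, with an `A₁` measure on both
sides. -/
theorem weak_maximalFn (h : A1Measure μ C) (hn : 0 < n) {F : E n → ℝ≥0∞}
    (hF : AEMeasurable F MeasureTheory.volume) (hfin : ∫⁻ y, F y ≠ ∞) (t : ℝ≥0∞) :
    t * μ {x | t < maximalFn F x} ≤ C * 6 ^ n * C * ∫⁻ y, F y ∂μ := by
  rcases eq_or_ne t 0 with rfl | ht0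
  · simp
  rcases eq_or_ne t ∞ with rfl | htt
  · simp
  set S : Set (E n × ℝ) :=
    {b | 0 < b.2 ∧ t * MeasureTheory.volume (ball b.1 b.2) < ∫⁻ y in ball b.1 b.2, F y} with hS
  obtain ⟨R, hR⟩ := exists_radius_bound (n := n) hn (ENNReal.div_ne_top hfin ht0)
  have hSR : ∀ b ∈ S, 0 < b.2 ∧ b.2 ≤ R := by
    refine fun b hb => ⟨hb.1, hR b.1 b.2 ?_⟩
    rw [ENNReal.le_div_iff_mul_le (Or.inl ht0) (Or.inl htt), mul_comm]
    exact hb.2.le.trans (setLIntegral_le_lintegral _ _)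
  obtain ⟨u, huS, huc, hdis, hcov⟩ := exists_disjoint_balls S R hSR
  have hsub : {x | t < maximalFn F x} ⊆ ⋃ b ∈ u, ball b.1 (6 * b.2) := by
    intro x hx
    obtain ⟨c, r, hxc, hlt⟩ := lt_maximalFn_iff.1 hx
    obtain ⟨b, hb, hsub⟩ := hcov (c, r) ⟨pos_of_mem_ball hxc, hlt⟩
    exact mem_biUnion hb (hsub hxc)
  have := huc.to_subtype
  have hball : ∀ b ∈ u, t * μ (ball b.1 b.2) ≤ C * ∫⁻ y in ball b.1 b.2, F y ∂μ :=
    fun b hb => h.mul_measure_ball_le hF (huS hb).1 (huS hb).2.le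
  have h1 : μ {x | t < maximalFn F x} ≤ ∑' b : u, μ (ball b.1.1 (6 * b.1.2)) :=
    (measure_mono hsub).trans (measure_biUnion_le μ huc _)
  have h2 : ∑' b : u, μ (ball b.1.1 (6 * b.1.2)) ≤
      C * 6 ^ n * ∑' b : u, μ (ball b.1.1 b.1.2) := by
    rw [← ENNReal.tsum_mul_left]
    refine ENNReal.tsum_le_tsum fun b => ?_
    simpa using h.doubling_self b.1.1 (k := 6) (by norm_num) (huS b.2).1
  have h3 : t * ∑' b : u, μ (ball b.1.1 b.1.2) ≤ C * ∫⁻ y, F y ∂μ := by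
    calc t * ∑' b : u, μ (ball b.1.1 b.1.2)
        ≤ ∑' b : u, C * ∫⁻ y in ball b.1.1 b.1.2, F y ∂μ := by
          rw [← ENNReal.tsum_mul_left]
          exact ENNReal.tsum_le_tsum fun b => hball b.1 b.2
      _ = C * ∫⁻ y in ⋃ b ∈ u, ball b.1 b.2, F y ∂μ := by
          rw [ENNReal.tsum_mul_left, lintegral_biUnion huc (fun _ _ => measurableSet_ball) hdis]
      _ ≤ _ := mul_le_mul_right (setLIntegral_le_lintegral _ _) _
  calc t * μ {x | t < maximalFn F x}
      ≤ t * (C * 6 ^ n * ∑' b : u, μ (ball b.1.1 b.1.2)) := mul_le_mul_right (h1.trans h2) _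
    _ = C * 6 ^ n * (t * ∑' b : u, μ (ball b.1.1 b.1.2)) := mul_left_comm _ _ _
    _ ≤ C * 6 ^ n * (C * ∫⁻ y, F y ∂μ) := mul_le_mul_right h3 _
    _ = _ := (mul_assoc _ _ _).symm

end A1Measure

/-! ### Dyadic annuli and the Dini condition -/

/-- Integration over dyadic annuli: an integral outside a ball, against a radially decreasing
function, is dominated by a sum over concentric balls of radii `2ʲ ρ`. -/
lemma lintegral_compl_ball_le_tsum {n : ℕ} {G : ℝ → ℝ≥0∞} {ρ : ℝ} (hρ : 0 < ρ)
    (hG : ∀ s t, ρ ≤ s → s ≤ t → G t ≤ G s) (μ : Measure (E n)) (F : E n → ℝ≥0∞) (c : E n) :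
    ∫⁻ y in (ball c ρ)ᶜ, G ‖y - c‖ * F y ∂μ ≤
      ∑' j : ℕ, ∫⁻ y in ball c (2 ^ (j + 1) * ρ), G (2 ^ j * ρ) * F y ∂μ := by
  have hsub : (ball c ρ)ᶜ ⊆ ⋃ j : ℕ, ball c (2 ^ (j + 1) * ρ) \ ball c (2 ^ j * ρ) := by
    intro y hy
    have hy : ρ ≤ dist y c := by simpa using hy
    obtain ⟨j, hj1, hj2⟩ := exists_nat_pow_near (x := dist y c / ρ) (y := 2)
      ((one_le_div hρ).2 hy) (by norm_num)
    refine mem_iUnion.2 ⟨j, ?_, ?_⟩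
    · exact (div_lt_iff₀ hρ).1 hj2
    · simpa using (le_div_iff₀ hρ).1 hj1
  calc _ ≤ ∫⁻ y in ⋃ j : ℕ, ball c (2 ^ (j + 1) * ρ) \ ball c (2 ^ j * ρ), G ‖y - c‖ * F y ∂μ :=
        lintegral_mono_set hsub
    _ ≤ ∑' j : ℕ, ∫⁻ y in ball c (2 ^ (j + 1) * ρ) \ ball c (2 ^ j * ρ), G ‖y - c‖ * F y ∂μ :=
        lintegral_iUnion_le _ _
    _ ≤ _ := by
        refine ENNReal.tsum_le_tsum fun j => ?_
        refine (setLIntegral_mono' (measurableSet_ball.diff measurableSet_ball)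
          (g := fun y => G (2 ^ j * ρ) * F y) fun y hy => ?_).trans
          (lintegral_mono_set sdiff_subset)
        gcongr
        refine hG _ _ ?_ ?_
        · exact le_mul_of_one_le_left hρ.le (one_le_pow₀ (by norm_num))
        · simpa [dist_eq_norm] using hy.2

/-- The dyadic form of the Dini condition, by monotonicity of `θ` on the intervals
`(2⁻ʲ⁻¹, 2⁻ʲ]`. -/
lemma IsDiniModulus.tsum_ne_top {θ : ℝ → ℝ} (hθ : IsDiniModulus θ) :
    ∑' j : ℕ, ENNReal.ofReal (θ ((1 / 2) ^ (j + 1))) ≠ ∞ := by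
  have hanti : Antitone fun j : ℕ => ((1 / 2 : ℝ)) ^ j :=
    fun i j hij => pow_le_pow_of_le_one (by norm_num) (by norm_num) hij
  have hI : ∫⁻ t in Ioc (0 : ℝ) 1, ENNReal.ofReal (θ t / t) ≠ ∞ := by
    have := hθ.dini.2
    rw [hasFiniteIntegral_iff_enorm] at this
    refine (lt_of_le_of_lt (lintegral_mono fun t => ?_) this).ne
    exact Real.ofReal_le_enorm _
  have hterm : ∀ j : ℕ, ENNReal.ofReal (θ ((1 / 2) ^ (j + 1))) ≤
      2 * ∫⁻ t in Ioc ((1 / 2 : ℝ) ^ (j + 1)) ((1 / 2) ^ j), ENNReal.ofReal (θ t / t) := by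
    intro j
    have hp : (0 : ℝ) < (1 / 2) ^ j := by positivity
    have hp' : (0 : ℝ) < (1 / 2) ^ (j + 1) := by positivity
    have h1 : ∫⁻ _t in Ioc ((1 / 2 : ℝ) ^ (j + 1)) ((1 / 2) ^ j),
        ENNReal.ofReal (θ ((1 / 2) ^ (j + 1)) / (1 / 2) ^ j) ≤
        ∫⁻ t in Ioc ((1 / 2 : ℝ) ^ (j + 1)) ((1 / 2) ^ j), ENNReal.ofReal (θ t / t) := by
      refine setLIntegral_mono' measurableSet_Ioc fun t ht => ENNReal.ofReal_le_ofReal ?_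
      have ht0 : 0 < t := hp'.trans ht.1
      exact div_le_div₀ (hθ.nonneg t ht0) (hθ.mono hp' ht0 ht.1.le) ht0 ht.2
    rw [setLIntegral_const, Real.volume_Ioc, ← ENNReal.ofReal_mul (div_nonneg (hθ.nonneg _ hp') hp.le)]
      at h1
    refine le_trans (le_of_eq ?_) (mul_le_mul_right h1 2)
    rw [show (2 : ℝ≥0∞) = ENNReal.ofReal 2 by simp, ← ENNReal.ofReal_mul (by norm_num)]
    congr 1
    rw [pow_succ]
    field_simp
    ring
  have hsum : ∑' j : ℕ, ENNReal.ofReal (θ ((1 / 2) ^ (j + 1))) ≤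
      2 * ∫⁻ t in Ioc (0 : ℝ) 1, ENNReal.ofReal (θ t / t) := by
    calc _ ≤ ∑' j : ℕ, 2 * ∫⁻ t in Ioc ((1 / 2 : ℝ) ^ (j + 1)) ((1 / 2) ^ j),
          ENNReal.ofReal (θ t / t) := ENNReal.tsum_le_tsum hterm
      _ = 2 * ∫⁻ t in ⋃ j : ℕ, Ioc ((1 / 2 : ℝ) ^ (j + 1)) ((1 / 2) ^ j),
          ENNReal.ofReal (θ t / t) := by
          rw [ENNReal.tsum_mul_left, lintegral_iUnion (fun _ => measurableSet_Ioc)]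
          exact hanti.pairwise_disjoint_on_Ioc_succ
      _ ≤ _ := by
          gcongr
          refine iUnion_subset fun j => Ioc_subset_Ioc (by positivity) ?_
          exact pow_le_one₀ (by norm_num) (by norm_num)
  exact ne_top_of_le_ne_top (ENNReal.mul_ne_top (by simp) hI) hsum

/-- The tail estimate in which the Dini condition enters: averages of `F` over balls around `c`
bounded by `m` give `∫_{|y - c| ≥ 2r} θ(r / |y - c|) |y - c|⁻ⁿ F(y) dy ≤ A m`. -/
lemma IsDiniModulus.exists_tail_bound {θ : ℝ → ℝ} (hθ : IsDiniModulus θ) (n : ℕ) :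
    ∃ A : ℝ≥0∞, A ≠ ∞ ∧ ∀ (c : E n) (r : ℝ) (F : E n → ℝ≥0∞) (m : ℝ≥0∞), 0 < r →
      (∀ R, r ≤ R → ∫⁻ y in ball c R, F y ≤ m * volume (ball c R)) →
      ∫⁻ y in (ball c (2 * r))ᶜ, ENNReal.ofReal (θ (r / ‖y - c‖) / ‖y - c‖ ^ n) * F y ≤ A * m := by
  refine ⟨(∑' j : ℕ, ENNReal.ofReal (θ ((1 / 2) ^ (j + 1)))) *
    (2 ^ n * volume (ball (0 : E n) 1)), ?_, fun c r F m hr hF => ?_⟩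
  · exact ENNReal.mul_ne_top hθ.tsum_ne_top
      (ENNReal.mul_ne_top (by simp) (volume_ball_ne_top _ _))
  have hG : ∀ s t, 2 * r ≤ s → s ≤ t →
      ENNReal.ofReal (θ (r / t) / t ^ n) ≤ ENNReal.ofReal (θ (r / s) / s ^ n) := by
    intro s t hs hst
    have hs0 : 0 < s := by linarith
    have ht0 : 0 < t := by linarith
    refine ENNReal.ofReal_le_ofReal (div_le_div₀ (hθ.nonneg _ (by positivity)) ?_ (by positivity) ?_)
    · exact hθ.mono (div_pos hr ht0) (div_pos hr hs0) (div_le_div_of_nonneg_left hr.le hs0 hst)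
    · exact pow_le_pow_left₀ hs0.le hst n
  refine (lintegral_compl_ball_le_tsum (G := fun s => ENNReal.ofReal (θ (r / s) / s ^ n))
    (by positivity) hG volume F c).trans ?_
  rw [mul_assoc, ← ENNReal.tsum_mul_right]
  refine ENNReal.tsum_le_tsum fun j => ?_
  have hρ : (0 : ℝ) < 2 ^ j * (2 * r) := by positivity
  rw [lintegral_const_mul' _ _ ENNReal.ofReal_ne_top]
  have h1 : r ≤ 2 ^ (j + 1) * (2 * r) := by
    have : (1 : ℝ) ≤ 2 ^ (j + 1) := one_le_pow₀ (by norm_num)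
    nlinarith
  refine (mul_le_mul_right (hF _ h1) _).trans (le_of_eq ?_)
  have h2 : volume (ball c (2 ^ (j + 1) * (2 * r))) =
      2 ^ n * (ENNReal.ofReal ((2 ^ j * (2 * r)) ^ n) * volume (ball (0 : E n) 1)) := by
    rw [show (2 : ℝ) ^ (j + 1) * (2 * r) = 2 * ((2 ^ j * (2 * r)) * 1) by ring,
      volume_ball_mul c (0 : E n) two_pos (by positivity),
      volume_ball_mul (0 : E n) 0 hρ one_pos, ENNReal.ofReal_pow hρ.le]
    simp
  have h3 : r / (2 ^ j * (2 * r)) = (1 / 2) ^ (j + 1) := by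
    rw [one_div, inv_pow, pow_succ]; field_simp
  rw [h2, h3]
  calc _ = ENNReal.ofReal (θ ((1 / 2) ^ (j + 1)) / (2 ^ j * (2 * r)) ^ n) *
        ENNReal.ofReal ((2 ^ j * (2 * r)) ^ n) * (2 ^ n * volume (ball (0 : E n) 1) * m) := by ring
    _ = _ := by
      rw [← ENNReal.ofReal_mul (div_nonneg (hθ.nonneg _ (by positivity)) (by positivity)),
        div_mul_cancel₀ _ (by positivity)]

/-! ### Smooth approximation -/

lemma exists_smooth_cutoff {n : ℕ} {s t : Set (E n)} (hs : IsClosed s) (ht : IsClosed t)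
    (hdis : Disjoint t s) : ∃ η : E n → ℝ, ContDiff ℝ (⊤ : ℕ∞) η ∧ (∀ x ∈ t, η x = 0) ∧
      (∀ x ∈ s, η x = 1) ∧ ∀ x, η x ∈ Icc (0 : ℝ) 1 := by
  obtain ⟨η, hη0, hη1, hη⟩ := exists_contMDiffMap_zero_one_of_isClosed (n := (⊤ : ℕ∞))
    (modelWithCornersSelf ℝ (E n)) ht hs hdis
  exact ⟨η, η.contMDiff.contDiff, hη0, hη1, hη⟩

/-- Approximation in `L²` by test functions that vanish on a closed set disjoint from the closed
set `s` off which `f` vanishes. -/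
lemma exists_smooth_approx {n : ℕ} {f : E n → ℂ} (hf : MemLp f 2 volume) {s t : Set (E n)}
    (hs : IsClosed s) (ht : IsClosed t) (hdis : Disjoint t s) (h0 : ∀ y ∉ s, f y = 0) :
    ∃ φ : ℕ → E n → ℂ, (∀ k, HasCompactSupport (φ k)) ∧ (∀ k, ContDiff ℝ (⊤ : ℕ∞) (φ k)) ∧
      (∀ k, ∀ x ∈ t, φ k x = 0) ∧
      Tendsto (fun k => eLpNorm (φ k - f) 2 volume) atTop (𝓝 0) := by
  obtain ⟨η, hηs, hη0, hη1, hη⟩ := exists_smooth_cutoff hs ht hdis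
  have hex : ∀ k : ℕ, ∃ g : E n → ℂ, HasCompactSupport g ∧ ContDiff ℝ (⊤ : ℕ∞) g ∧
      eLpNorm (f - g) 2 volume ≤ ENNReal.ofReal (1 / ((k : ℝ) + 1)) := fun k =>
    hf.exist_eLpNorm_sub_le ENNReal.ofNat_ne_top one_le_two Nat.one_div_pos_of_nat
  choose g hgc hgs hg using hex
  have hc : ∀ k, HasCompactSupport (fun x => η x • g k x) := fun k => by
    simp only [Complex.real_smul]
    exact (hgc k).mul_left (f := fun x => (η x : ℂ))
  refine ⟨fun k x => η x • g k x, hc, fun k => hηs.smul (hgs k),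
    fun k x hx => ?_, ?_⟩
  · have : η x = 0 := hη0 x hx
    simp [this]
  · have h1 : Tendsto (fun k : ℕ => ENNReal.ofReal (1 / ((k : ℝ) + 1))) atTop (𝓝 0) := by
      simpa using ENNReal.tendsto_ofReal
        (tendsto_one_div_add_atTop_nhds_zero_nat (𝕜 := ℝ))
    refine tendsto_of_tendsto_of_tendsto_of_le_of_le tendsto_const_nhds h1 (fun _ => zero_le)
      fun k => le_trans ?_ (hg k)
    refine eLpNorm_mono fun x => ?_
    have h2 : ((fun x => η x • g k x) - f) x = η x • (g k x - f x) := by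
      by_cases hx : x ∈ s
      · have : η x = 1 := hη1 x hx
        simp [this]
      · simp [h0 x hx]
    rw [h2, norm_smul, Pi.sub_apply, norm_sub_rev]
    refine mul_le_of_le_one_left (norm_nonneg _) ?_
    rw [Real.norm_of_nonneg (hη x).1]
    exact (hη x).2

/-! ### The operator on square integrable functions -/

open Classical in
/-- The operator on functions: the given `L²` operator applied to the class of `f`, and `0` if `f`
is not square integrable. -/
def ThetaCZO.app {n : ℕ} {θ : ℝ → ℝ} (T : ThetaCZO n θ) (f : E n → ℂ) : E n → ℂ :=
  if hf : MemLp f 2 volume then T.toL2 (hf.toLp f) else 0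

namespace ThetaCZO

variable {n : ℕ} {θ : ℝ → ℝ} (T : ThetaCZO n θ)

lemma app_of_memLp {f : E n → ℂ} (hf : MemLp f 2 volume) : T.app f = T.toL2 (hf.toLp f) :=
  dif_pos hf

lemma memLp_app (f : E n → ℂ) : MemLp (T.app f) 2 volume := by
  by_cases hf : MemLp f 2 volume
  · rw [T.app_of_memLp hf]; exact Lp.memLp _
  · rw [app, dif_neg hf]; exact MemLp.zero

lemma aestronglyMeasurable_app (f : E n → ℂ) : AEStronglyMeasurable (T.app f) volume :=
  (T.memLp_app f).1

lemma app_coe (φ : Lp ℂ 2 (volume : Measure (E n))) : T.app φ = T.toL2 φ := by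
  rw [T.app_of_memLp (Lp.memLp φ), Lp.toLp_coeFn]

lemma app_add {f g : E n → ℂ} (hf : MemLp f 2 volume) (hg : MemLp g 2 volume) :
    T.app (f + g) =ᵐ[volume] T.app f + T.app g := by
  rw [T.app_of_memLp hf, T.app_of_memLp hg, T.app_of_memLp (hf.add hg), MemLp.toLp_add, map_add]
  exact Lp.coeFn_add _ _

lemma app_sub {f g : E n → ℂ} (hf : MemLp f 2 volume) (hg : MemLp g 2 volume) :
    T.app (f - g) =ᵐ[volume] T.app f - T.app g := by
  rw [T.app_of_memLp hf, T.app_of_memLp hg, T.app_of_memLp (hf.sub hg), MemLp.toLp_sub, map_sub]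
  exact Lp.coeFn_sub _ _

lemma app_zero : T.app 0 =ᵐ[volume] 0 := by
  rw [T.app_of_memLp MemLp.zero, MemLp.toLp_zero, map_zero]
  exact Lp.coeFn_zero _ _ _

lemma app_sum {ι : Type*} (s : Finset ι) {f : ι → E n → ℂ} (hf : ∀ i, MemLp (f i) 2 volume) :
    T.app (∑ i ∈ s, f i) =ᵐ[volume] ∑ i ∈ s, T.app (f i) := by
  classical
  induction s using Finset.induction_on with
  | empty => simpa using T.app_zero
  | insert a s ha ih =>
    rw [Finset.sum_insert ha, Finset.sum_insert ha]
    exact (T.app_add (hf a) (memLp_finsetSum' s fun i _ => hf i)).trans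
      ((EventuallyEq.refl _ _).add ih)

lemma eLpNorm_app_le {f : E n → ℂ} (hf : MemLp f 2 volume) :
    eLpNorm (T.app f) 2 volume ≤ ‖T.toL2‖ₑ * eLpNorm f 2 volume := by
  have h := T.toL2.le_opENorm (hf.toLp f)
  rwa [T.app_of_memLp hf, ← Lp.enorm_def, ← Lp.enorm_toLp hf]

/-- Chebyshev's inequality for the operator on `L²`. -/
lemma measure_lt_app_le {f : E n → ℂ} (hf : MemLp f 2 volume) (t : ℝ≥0∞) :
    t ^ 2 * volume {x | t < ‖T.app f x‖ₑ} ≤ ‖T.toL2‖ₑ ^ 2 * ∫⁻ x, ‖f x‖ₑ ^ 2 := by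
  have key : ∀ g : E n → ℂ, eLpNorm g 2 volume ^ 2 = ∫⁻ x, ‖g x‖ₑ ^ 2 := by
    intro g
    have := eLpNorm_nnreal_pow_eq_lintegral (μ := (volume : Measure (E n))) (f := g) (p := 2)
      (by norm_num)
    rw [show ((2 : NNReal) : ℝ≥0∞) = 2 from rfl,
      show ((2 : NNReal) : ℝ) = ((2 : ℕ) : ℝ) by norm_num] at this
    simpa only [ENNReal.rpow_natCast] using this
  have h1 : t ^ 2 * volume {x | t < ‖T.app f x‖ₑ} ≤ ∫⁻ x, ‖T.app f x‖ₑ ^ 2 := by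
    refine le_trans ?_ (mul_meas_ge_le_lintegral₀
      ((T.aestronglyMeasurable_app f).enorm.pow_const 2) (t ^ 2))
    refine mul_le_mul_right (measure_mono fun x hx => ?_) _
    exact pow_le_pow_left₀ zero_le (le_of_lt (a := t) (b := ‖T.app f x‖ₑ) hx) 2
  refine h1.trans ?_
  rw [← key, ← key, ← mul_pow]
  exact pow_le_pow_left₀ zero_le (T.eLpNorm_app_le hf) 2

lemma exists_seq_tendsto_app {f : E n → ℂ} (hf : MemLp f 2 volume) {φ : ℕ → E n → ℂ}
    (hφ : ∀ k, MemLp (φ k) 2 volume)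
    (hlim : Tendsto (fun k => eLpNorm (φ k - f) 2 volume) atTop (𝓝 0)) :
    ∃ ns : ℕ → ℕ, StrictMono ns ∧ ∀ᵐ x ∂(volume : Measure (E n)),
      Tendsto (fun k => T.app (φ (ns k)) x) atTop (𝓝 (T.app f x)) := by
  refine TendstoInMeasure.exists_seq_tendsto_ae (f := fun k => T.app (φ k)) ?_
  refine tendstoInMeasure_of_tendsto_eLpNorm (p := 2) (by norm_num)
    (fun k => T.aestronglyMeasurable_app _) (T.aestronglyMeasurable_app _) ?_
  have h0 : Tendsto (fun k => ‖T.toL2‖ₑ * eLpNorm (φ k - f) 2 volume) atTop (𝓝 0) := by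
    simpa using ENNReal.Tendsto.const_mul hlim (Or.inr (enorm_ne_top))
  refine tendsto_of_tendsto_of_tendsto_of_le_of_le tendsto_const_nhds h0 (fun _ => zero_le)
    fun k => ?_
  rw [← eLpNorm_congr_ae (T.app_sub (hφ k) hf)]
  exact T.eLpNorm_app_le ((hφ k).sub hf)

/-! ### The kernel -/

lemma ae_aestronglyMeasurable_kernel (hn : 0 < n) :
    AEStronglyMeasurable (fun p : E n × E n => T.kernel p.1 p.2)
      ((volume : Measure (E n)).prod volume) := by
  have : Nonempty (Fin n) := ⟨⟨0, hn⟩⟩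
  have h := T.isThetaKernel.measurable
  rw [Measure.restrict_eq_self_of_ae_mem, Measure.volume_eq_prod] at h
  · exact h
  · rw [Measure.volume_eq_prod, ae_iff]
    have : {p : E n × E n | p ∉ {p : E n × E n | p.1 ≠ p.2}} = diagonal (E n) := by
      ext p; simp
    rw [this, Measure.measure_prod_null measurableSet_diagonal]
    refine Eventually.of_forall fun x => ?_
    have : Prod.mk x ⁻¹' diagonal (E n) = {x} := by ext y; simp [eq_comm]
    simp [this]

lemma ae_kernel_section (hn : 0 < n) : ∀ᵐ x ∂(volume : Measure (E n)),
    AEStronglyMeasurable (T.kernel x) volume :=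
  (T.ae_aestronglyMeasurable_kernel hn).prodMk_left

/-- A constant for which the size and smoothness conditions of the kernel hold. -/
def kernelConst : ℝ := T.isThetaKernel.bounds.choose

lemma kernelConst_pos : 0 < T.kernelConst := T.isThetaKernel.bounds.choose_spec.1

lemma norm_kernel_le {x y : E n} (h : x ≠ y) :
    ‖T.kernel x y‖ ≤ T.kernelConst / ‖x - y‖ ^ n :=
  T.isThetaKernel.bounds.choose_spec.2.1 x y h

lemma kernel_smooth {x y z : E n} (hxz : x ≠ z) (h : ‖x - z‖ < ‖x - y‖ / 2) :
    ‖T.kernel x y - T.kernel z y‖ + ‖T.kernel y x - T.kernel y z‖ ≤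
      T.kernelConst / ‖x - y‖ ^ n * θ (‖x - z‖ / ‖x - y‖) :=
  T.isThetaKernel.bounds.choose_spec.2.2 x y z hxz h

lemma norm_kernel_le_of_le {x y : E n} {δ : ℝ} (hδ : 0 < δ) (h : δ ≤ ‖x - y‖) :
    ‖T.kernel x y‖ ≤ T.kernelConst / δ ^ n := by
  refine (T.norm_kernel_le ?_).trans ?_
  · rintro rfl; simp at h; linarith
  · exact div_le_div_of_nonneg_left T.kernelConst_pos.le (by positivity)
      (pow_le_pow_left₀ hδ.le h n)

/-- Away from `x` the kernel `K(x, ·)` decays like `‖x - y‖⁻ⁿ`, and so is square integrable. -/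
lemma memLp_kernel (hn : 0 < n) {x : E n} (hx : AEStronglyMeasurable (T.kernel x) volume)
    {δ : ℝ} (hδ : 0 < δ) : MemLp ((ball x δ)ᶜ.indicator (T.kernel x)) 2 volume := by
  have hint : Integrable (fun y : E n => (1 + ‖y - x‖) ^ (-((2 * n : ℕ) : ℝ))) volume := by
    refine (integrable_one_add_norm (μ := (volume : Measure (E n))) (r := ((2 * n : ℕ) : ℝ))
      ?_).comp_sub_right x
    rw [finrank_euclideanSpace_fin]; exact_mod_cast (by omega : n < 2 * n)
  rw [memLp_two_iff_integrable_sq_norm (hx.indicator measurableSet_ball.compl)]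
  refine (hint.const_mul (T.kernelConst ^ 2 * (1 + 1 / δ) ^ (2 * n))).mono'
    ((hx.indicator measurableSet_ball.compl).norm.pow 2) (Eventually.of_forall fun y => ?_)
  have hK := T.kernelConst_pos
  by_cases hy : y ∈ ball x δ
  · rw [indicator_of_notMem (by simpa using hy)]
    simp only [norm_zero]
    norm_num
    positivity
  · rw [indicator_of_mem (by simpa using hy)]
    have hy' : δ ≤ ‖y - x‖ := by simpa [dist_eq_norm] using hy
    have hpos : 0 < ‖y - x‖ := hδ.trans_le hy'
    have h1 : ‖T.kernel x y‖ ≤ T.kernelConst / ‖y - x‖ ^ n := by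
      rw [← norm_sub_rev x y]
      exact T.norm_kernel_le_of_le (by rwa [norm_sub_rev]) le_rfl
    have h2 : 1 + ‖y - x‖ ≤ (1 + 1 / δ) * ‖y - x‖ := by
      have : 1 ≤ ‖y - x‖ / δ := (one_le_div hδ).2 hy'
      calc _ ≤ ‖y - x‖ / δ + ‖y - x‖ := by linarith
        _ = _ := by ring
    rw [Real.norm_of_nonneg (by positivity), Real.rpow_neg (by positivity), Real.rpow_natCast]
    calc ‖T.kernel x y‖ ^ 2 ≤ (T.kernelConst / ‖y - x‖ ^ n) ^ 2 := by gcongr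
      _ = T.kernelConst ^ 2 * (1 / ‖y - x‖ ^ (2 * n)) := by rw [div_pow]; ring
      _ ≤ T.kernelConst ^ 2 * ((1 + 1 / δ) ^ (2 * n) * ((1 + ‖y - x‖) ^ (2 * n))⁻¹) := by
          gcongr
          rw [← div_eq_mul_inv, div_le_div_iff₀ (by positivity) (by positivity), one_mul, ← mul_pow]
          gcongr
      _ = _ := by ring

/-- A function in `L²` that vanishes near `x` is integrable against the kernel at `x`. -/
lemma integrable_kernel_mul (hn : 0 < n) {x : E n}
    (hx : AEStronglyMeasurable (T.kernel x) volume) {δ : ℝ} (hδ : 0 < δ) {f : E n → ℂ}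
    (hf : MemLp f 2 volume) (h0 : ∀ y ∈ ball x δ, f y = 0) :
    Integrable (fun y => T.kernel x y * f y) volume ∧
      ‖∫ y, T.kernel x y * f y‖ₑ ≤
        eLpNorm ((ball x δ)ᶜ.indicator (T.kernel x)) 2 volume * eLpNorm f 2 volume := by
  have hK := T.memLp_kernel hn hx hδ
  have heq : (fun y => T.kernel x y * f y) = (ball x δ)ᶜ.indicator (T.kernel x) • f := by
    ext y
    by_cases hy : y ∈ ball x δ
    · simp [h0 y hy]
    · simp [indicator_of_mem (show y ∈ (ball x δ)ᶜ by simpa using hy)]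
  rw [heq]
  refine ⟨?_, ?_⟩
  · rw [← memLp_one_iff_integrable]
    exact hf.smul hK
  · refine (enorm_integral_le_lintegral_enorm _).trans ?_
    rw [← eLpNorm_one_eq_lintegral_enorm]
    exact eLpNorm_smul_le_mul_eLpNorm hf.1 hK.1

/-! ### The kernel represents the operator off the support -/

/-- The kernel representation for smooth compactly supported functions, in terms of `app`. -/
lemma app_eq_of_contDiff {φ : E n → ℂ} (hc : HasCompactSupport φ) (hs : ContDiff ℝ (⊤ : ℕ∞) φ) :
    ∀ᵐ x ∂(volume : Measure (E n)), x ∉ tsupport φ → T.app φ x = ∫ y, T.kernel x y * φ y := by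
  have h := T.representation (hc.toSchwartzMap hs) hc
  have hm : MemLp φ 2 volume := hs.continuous.memLp_of_hasCompactSupport hc
  have heq : (hc.toSchwartzMap hs).toLp 2 volume = hm.toLp φ := by
    ext1
    exact ((hc.toSchwartzMap hs).coeFn_toLp 2 volume).trans hm.coeFn_toLp.symm
  rw [heq, ← T.app_of_memLp hm] at h
  exact h

/-- The kernel represents the operator on every square integrable function, off its support. The
function is approximated by smooth functions, cut off smoothly near `s`. -/
theorem app_eq_integral (hn : 0 < n) {f : E n → ℂ} (hf : MemLp f 2 volume) {s : Set (E n)}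
    (hs : IsClosed s) (h0 : ∀ y ∉ s, f y = 0) :
    ∀ᵐ x ∂(volume : Measure (E n)), x ∉ s → T.app f x = ∫ y, T.kernel x y * f y := by
  have key : ∀ m : ℕ, ∀ᵐ x ∂(volume : Measure (E n)),
      (∀ y ∈ s, 2 / ((m : ℝ) + 1) ≤ dist x y) → T.app f x = ∫ y, T.kernel x y * f y := by
    intro m
    set ε : ℝ := 1 / ((m : ℝ) + 1) with hε
    have hε0 : 0 < ε := by positivity
    set t : Set (E n) := {x | ∀ y ∈ s, ε ≤ dist x y} with ht
    have htc : IsClosed t := by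
      have : t = ⋂ y ∈ s, {x | ε ≤ dist x y} := by ext; simp [ht]
      rw [this]
      exact isClosed_biInter fun y _ => isClosed_le continuous_const (by fun_prop)
    have hdis : Disjoint t s := by
      rw [Set.disjoint_left]
      intro x hx hxs
      have := hx x hxs
      rw [dist_self] at this
      linarith
    obtain ⟨φ, hφc, hφs, hφt, hlim⟩ := exists_smooth_approx hf hs htc hdis h0
    have hφm : ∀ k, MemLp (φ k) 2 volume :=
      fun k => (hφs k).continuous.memLp_of_hasCompactSupport (hφc k)
    obtain ⟨ns, hns, hae⟩ := T.exists_seq_tendsto_app hf hφm hlim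
    filter_upwards [hae, ae_all_iff.2 fun k => T.app_eq_of_contDiff (hφc k) (hφs k),
      T.ae_kernel_section hn] with x hx1 hx2 hx3 hxs
    have hball : ball x ε ⊆ t := by
      intro z hz y hy
      have h1 := hxs y hy
      have h2 := dist_triangle x z y
      rw [mem_ball, dist_comm] at hz
      have h3 : 2 / ((m : ℝ) + 1) = ε + ε := by rw [hε]; ring
      linarith
    have hxsupp : ∀ k, x ∉ tsupport (φ k) := by
      intro k
      rw [notMem_tsupport_iff_eventuallyEq]
      filter_upwards [isOpen_ball.mem_nhds (mem_ball_self hε0)] with z hz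
      exact hφt k z (hball hz)
    have hf0 : ∀ y ∈ ball x ε, f y = 0 := fun y hy =>
      h0 y fun hys => Set.disjoint_left.1 hdis (hball hy) hys
    refine tendsto_nhds_unique hx1 ?_
    have hbound : ∀ k, ‖T.app (φ (ns k)) x - ∫ y, T.kernel x y * f y‖ₑ ≤
        eLpNorm ((ball x ε)ᶜ.indicator (T.kernel x)) 2 volume *
          eLpNorm (φ (ns k) - f) 2 volume := by
      intro k
      have h1 := T.integrable_kernel_mul hn hx3 hε0 (hφm (ns k))
        fun y hy => hφt _ y (hball hy)
      have h2 := T.integrable_kernel_mul hn hx3 hε0 hf hf0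
      have h3 := T.integrable_kernel_mul hn hx3 hε0 ((hφm (ns k)).sub hf)
        fun y hy => by simp [hφt _ y (hball hy), hf0 y hy]
      rw [hx2 _ (hxsupp _), ← integral_sub h1.1 h2.1]
      simpa only [Pi.sub_apply, mul_sub] using h3.2
    rw [tendsto_iff_edist_tendsto_0]
    have h4 : Tendsto (fun k => eLpNorm ((ball x ε)ᶜ.indicator (T.kernel x)) 2 volume *
          eLpNorm (φ (ns k) - f) 2 volume) atTop (𝓝 0) := by
      simpa using ENNReal.Tendsto.const_mul (hlim.comp hns.tendsto_atTop)
        (Or.inr (T.memLp_kernel hn hx3 hε0).2.ne)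
    refine tendsto_of_tendsto_of_tendsto_of_le_of_le tendsto_const_nhds h4 (fun _ => zero_le)
      fun k => ?_
    rw [edist_eq_enorm_sub]
    exact hbound k
  filter_upwards [ae_all_iff.2 key] with x hx hxs
  obtain ⟨ε, hε, hball⟩ := Metric.isOpen_iff.1 hs.isOpen_compl x hxs
  obtain ⟨m, hm⟩ := exists_nat_one_div_lt (half_pos hε)
  refine hx m fun y hy => ?_
  by_contra! hlt
  refine hball (a := y) ?_ hy
  rw [mem_ball, dist_comm]
  refine hlt.trans ?_
  calc 2 / ((m : ℝ) + 1) = 2 * (1 / ((m : ℝ) + 1)) := by ring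
    _ < ε := by linarith

end ThetaCZO

/-! ### Whitney balls -/

/-- A Whitney-type covering of an open set `Ω`: disjoint balls whose radii are the fraction `1 / k`
of the distance of their centres to the complement, and whose sixfold dilates cover `Ω`. -/
lemma exists_whitney_balls {n : ℕ} {Ω : Set (E n)} (hΩ : IsOpen Ω) (hne : Ωᶜ.Nonempty) {R : ℝ}
    (hR : ∀ (c : E n) (r : ℝ), ball c r ⊆ Ω → r ≤ R) {k : ℝ} (hk : 1 ≤ k) :
    ∃ u : Set (E n × ℝ), u.Countable ∧ u.PairwiseDisjoint (fun b => ball b.1 b.2) ∧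
      (∀ b ∈ u, 0 < b.2 ∧ ball b.1 (k * b.2) ⊆ Ω ∧ ¬ ball b.1 ((k + 1) * b.2) ⊆ Ω) ∧
      Ω ⊆ ⋃ b ∈ u, ball b.1 (6 * b.2) := by
  have hk0 : 0 < k := by linarith
  set t : Set (E n × ℝ) := {b | b.1 ∈ Ω ∧ b.2 = infDist b.1 Ωᶜ / k} with ht
  have hsub : ∀ x, ball x (infDist x Ωᶜ) ⊆ Ω := fun x => by
    have := disjoint_ball_infDist (x := x) (s := Ωᶜ)
    rwa [Set.disjoint_compl_right_iff_subset] at this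
  have hpos : ∀ x ∈ Ω, 0 < infDist x Ωᶜ := fun x hx => by
    refine (hΩ.isClosed_compl.notMem_iff_infDist_pos hne).1 (by simpa using hx)
  have htR : ∀ b ∈ t, 0 < b.2 ∧ b.2 ≤ R := by
    rintro b ⟨hb1, hb2⟩
    have h0 := hpos b.1 hb1
    rw [hb2]
    refine ⟨div_pos h0 hk0, (div_le_self h0.le hk).trans (hR b.1 _ (hsub _))⟩
  obtain ⟨u, hut, huc, hdis, hcov⟩ := exists_disjoint_balls t R htR
  refine ⟨u, huc, hdis, fun b hb => ?_, fun x hx => ?_⟩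
  · obtain ⟨hb1, hb2⟩ := hut hb
    have h0 := hpos b.1 hb1
    have hkb : k * b.2 = infDist b.1 Ωᶜ := by rw [hb2]; field_simp
    have hb0 : 0 < b.2 := (htR b (hut hb)).1
    refine ⟨hb0, hkb ▸ hsub _, fun hsub' => ?_⟩
    obtain ⟨z, hz, hdist⟩ := (infDist_lt_iff hne).1
      (show infDist b.1 Ωᶜ < (k + 1) * b.2 by rw [← hkb]; nlinarith)
    exact hz (hsub' (by rwa [mem_ball, dist_comm]))
  · obtain ⟨b, hb, hab⟩ := hcov (x, infDist x Ωᶜ / k) ⟨hx, rfl⟩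
    exact mem_biUnion hb (hab (mem_ball_self (div_pos (hpos x hx) hk0)))

lemma exists_disjoint_refinement {α ι : Type*} [MeasurableSpace α] [Countable ι]
    {A : ι → Set α} (hA : ∀ i, MeasurableSet (A i)) :
    ∃ Q : ι → Set α, (∀ i, MeasurableSet (Q i)) ∧ Pairwise (Function.onFun Disjoint Q) ∧
      (∀ i, Q i ⊆ A i) ∧ ⋃ i, Q i = ⋃ i, A i := by
  obtain ⟨e, he⟩ := Countable.exists_injective_nat ι
  refine ⟨fun i => A i \ ⋃ j, ⋃ (_ : e j < e i), A j, fun i => ?_, ?_, fun i => sdiff_subset, ?_⟩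
  · exact (hA i).diff (MeasurableSet.iUnion fun j => MeasurableSet.iUnion fun _ => hA j)
  · intro i j hij
    rw [Function.onFun, Set.disjoint_left]
    rintro x ⟨hxi, hxi'⟩ ⟨hxj, hxj'⟩
    rcases lt_or_gt_of_ne (he.ne hij) with h | h
    · exact hxj' (mem_iUnion₂.2 ⟨i, h, hxi⟩)
    · exact hxi' (mem_iUnion₂.2 ⟨j, h, hxj⟩)
  · refine subset_antisymm (iUnion_mono fun i => sdiff_subset) fun x hx => ?_
    classical
    obtain ⟨i, hi⟩ := mem_iUnion.1 hx
    have hex : ∃ m, ∃ i, e i = m ∧ x ∈ A i := ⟨_, i, rfl, hi⟩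
    obtain ⟨i0, hi0, hxi0⟩ := Nat.find_spec hex
    refine mem_iUnion.2 ⟨i0, hxi0, fun h => ?_⟩
    obtain ⟨j, hj, hxj⟩ := mem_iUnion₂.1 h
    exact Nat.find_min hex (hi0 ▸ hj) ⟨j, rfl, hxj⟩

lemma lintegral_enorm_sq_sum_indicator {α ι : Type*} [MeasurableSpace α] {μ : Measure α}
    {B : ι → Set α} (hB : ∀ i, MeasurableSet (B i)) (hd : Pairwise (Function.onFun Disjoint B))
    (a : ι → ℂ) (s : Finset ι) :
    ∫⁻ x, ‖(∑ i ∈ s, (B i).indicator (fun _ => a i)) x‖ₑ ^ 2 ∂μ =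
      ∑ i ∈ s, ‖a i‖ₑ ^ 2 * μ (B i) := by
  have hpt : ∀ x, ‖(∑ i ∈ s, (B i).indicator (fun _ => a i)) x‖ₑ ^ 2 =
      ∑ i ∈ s, (B i).indicator (fun _ => ‖a i‖ₑ ^ 2) x := by
    intro x
    rw [Finset.sum_apply]
    by_cases hx : ∃ i ∈ s, x ∈ B i
    · obtain ⟨i, his, hxi⟩ := hx
      have hne : ∀ j ∈ s, j ≠ i → x ∉ B j :=
        fun j _ hji hxj => Set.disjoint_left.1 (hd hji) hxj hxi
      rw [Finset.sum_eq_single_of_mem i his fun j hj hji => indicator_of_notMem (hne j hj hji) _,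
        Finset.sum_eq_single_of_mem i his fun j hj hji => indicator_of_notMem (hne j hj hji) _,
        indicator_of_mem hxi, indicator_of_mem hxi]
    · push Not at hx
      rw [Finset.sum_eq_zero fun i hi => indicator_of_notMem (hx i hi) _,
        Finset.sum_eq_zero fun i hi => indicator_of_notMem (hx i hi) _]
      simp
  simp_rw [hpt]
  rw [lintegral_finsetSum _ fun i _ => measurable_const.indicator (hB i)]
  exact Finset.sum_congr rfl fun i _ => lintegral_indicator_const (hB i) _

namespace ThetaCZO

variable {n : ℕ} {θ : ℝ → ℝ} (T : ThetaCZO n θ)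

/-! ### Smoothness of the kernel in integrated form -/

lemma enorm_kernel_sub_fst_le (hθ : IsDiniModulus θ) {c x x' y : E n} {r : ℝ}
    (hx : x ∈ ball c r) (hx' : x' ∈ ball c r) (hy : y ∉ ball c (5 * r)) :
    ‖T.kernel x y - T.kernel x' y‖ₑ ≤ ENNReal.ofReal (T.kernelConst * (5 / 4) ^ n) *
      ENNReal.ofReal (θ ((5 / 2 * r) / ‖y - c‖) / ‖y - c‖ ^ n) := by
  have hr : 0 < r := pos_of_mem_ball hx
  have hK := T.kernelConst_pos
  rcases eq_or_ne x x' with rfl | hne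
  · simp
  have h1 : ‖x - c‖ < r := by simpa [dist_eq_norm] using hx
  have h2 : ‖x' - c‖ < r := by simpa [dist_eq_norm] using hx'
  have h3 : 5 * r ≤ ‖y - c‖ := by simpa [dist_eq_norm] using hy
  have h4 : ‖x - x'‖ < 2 * r := by
    have := norm_sub_le_norm_sub_add_norm_sub x c x'
    rw [norm_sub_rev c x'] at this
    linarith
  have h5 : 4 / 5 * ‖y - c‖ ≤ ‖x - y‖ := by
    have := norm_sub_le_norm_sub_add_norm_sub y x c
    rw [norm_sub_rev y x] at this
    linarith
  have hyc : 0 < ‖y - c‖ := by linarith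
  have hxy : 0 < ‖x - y‖ := by linarith
  have h6 := T.kernel_smooth (y := y) hne (by linarith)
  have hxx' : 0 < ‖x - x'‖ := norm_pos_iff.2 (sub_ne_zero.2 hne)
  have h7 : θ (‖x - x'‖ / ‖x - y‖) ≤ θ ((5 / 2 * r) / ‖y - c‖) := by
    refine hθ.mono (div_pos hxx' hxy) (by simp only [mem_Ioi]; positivity) ?_
    rw [div_le_div_iff₀ hxy hyc]
    nlinarith
  have h8 : T.kernelConst / ‖x - y‖ ^ n ≤ T.kernelConst * (5 / 4) ^ n / ‖y - c‖ ^ n := by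
    rw [div_le_div_iff₀ (by positivity) (by positivity), mul_assoc, ← mul_pow]
    gcongr
    linarith
  have h9 : 0 ≤ θ (‖x - x'‖ / ‖x - y‖) := hθ.nonneg _ (by positivity)
  rw [← ENNReal.ofReal_mul (by positivity), ← ofReal_norm]
  refine ENNReal.ofReal_le_ofReal ?_
  calc ‖T.kernel x y - T.kernel x' y‖
      ≤ T.kernelConst / ‖x - y‖ ^ n * θ (‖x - x'‖ / ‖x - y‖) :=
        (le_add_of_nonneg_right (norm_nonneg _)).trans h6
    _ ≤ T.kernelConst * (5 / 4) ^ n / ‖y - c‖ ^ n * θ ((5 / 2 * r) / ‖y - c‖) := by gcongr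
    _ = _ := by ring

lemma enorm_kernel_sub_snd_le (hθ : IsDiniModulus θ) {c x y : E n} {r : ℝ}
    (hy : y ∈ ball c r) (hx : x ∉ ball c (2 * r)) :
    ‖T.kernel x y - T.kernel x c‖ₑ ≤ ENNReal.ofReal T.kernelConst *
      ENNReal.ofReal (θ (r / ‖x - c‖) / ‖x - c‖ ^ n) := by
  have hr : 0 < r := pos_of_mem_ball hy
  have hK := T.kernelConst_pos
  rcases eq_or_ne c y with rfl | hne
  · simp
  have h1 : ‖c - y‖ < r := by simpa [dist_eq_norm'] using hy
  have h3 : 2 * r ≤ ‖c - x‖ := by simpa [dist_eq_norm'] using hx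
  have h6 := T.kernel_smooth (y := x) hne (by linarith)
  have hcy : 0 < ‖c - y‖ := norm_pos_iff.2 (sub_ne_zero.2 hne)
  have hcx : 0 < ‖c - x‖ := by linarith
  have h7 : θ (‖c - y‖ / ‖c - x‖) ≤ θ (r / ‖c - x‖) :=
    hθ.mono (div_pos hcy hcx) (div_pos hr hcx) (by gcongr)
  rw [← ENNReal.ofReal_mul (by positivity), ← ofReal_norm, norm_sub_rev x c,
    norm_sub_rev (T.kernel x y)]
  refine ENNReal.ofReal_le_ofReal ?_
  calc ‖T.kernel x c - T.kernel x y‖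
      ≤ T.kernelConst / ‖c - x‖ ^ n * θ (‖c - y‖ / ‖c - x‖) :=
        (le_add_of_nonneg_left (norm_nonneg _)).trans h6
    _ ≤ T.kernelConst / ‖c - x‖ ^ n * θ (r / ‖c - x‖) := by gcongr
    _ = _ := by ring

/-- Oscillation on a ball of the part of the operator that comes from far away. -/
lemma exists_oscillation_bound (hθ : IsDiniModulus θ) :
    ∃ A : ℝ≥0∞, A ≠ ∞ ∧ ∀ (c x x' : E n) (r : ℝ) (f : E n → ℂ) (m : ℝ≥0∞),
      x ∈ ball c r → x' ∈ ball c r → (∀ y ∈ ball c (5 * r), f y = 0) →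
      (∀ R, r ≤ R → ∫⁻ y in ball c R, ‖f y‖ₑ ≤ m * volume (ball c R)) →
      ∫⁻ y, ‖T.kernel x y * f y - T.kernel x' y * f y‖ₑ ≤ A * m := by
  obtain ⟨A, hA, hbound⟩ := hθ.exists_tail_bound n
  refine ⟨ENNReal.ofReal (T.kernelConst * (5 / 4) ^ n) * A,
    ENNReal.mul_ne_top ENNReal.ofReal_ne_top hA, fun c x x' r f m hx hx' hf hm => ?_⟩
  have hr : 0 < r := pos_of_mem_ball hx
  have h1 := hbound c (5 / 2 * r) (fun y => ‖f y‖ₑ) m (by positivity)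
    fun R hR => hm R (by linarith)
  rw [show 2 * (5 / 2 * r) = 5 * r by ring] at h1
  calc ∫⁻ y, ‖T.kernel x y * f y - T.kernel x' y * f y‖ₑ
      ≤ ∫⁻ y, (ball c (5 * r))ᶜ.indicator (fun y =>
          ENNReal.ofReal (T.kernelConst * (5 / 4) ^ n) *
          (ENNReal.ofReal (θ ((5 / 2 * r) / ‖y - c‖) / ‖y - c‖ ^ n) * ‖f y‖ₑ)) y := by
        refine lintegral_mono fun y => ?_
        by_cases hy : y ∈ ball c (5 * r)
        · simp [hf y hy]
        · rw [indicator_of_mem (by simpa using hy), ← sub_mul, enorm_mul, ← mul_assoc]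
          exact mul_le_mul_left (T.enorm_kernel_sub_fst_le hθ hx hx' hy) _
    _ = ENNReal.ofReal (T.kernelConst * (5 / 4) ^ n) * ∫⁻ y in (ball c (5 * r))ᶜ,
          ENNReal.ofReal (θ ((5 / 2 * r) / ‖y - c‖) / ‖y - c‖ ^ n) * ‖f y‖ₑ := by
        rw [lintegral_indicator measurableSet_ball.compl,
          lintegral_const_mul' _ _ ENNReal.ofReal_ne_top]
    _ ≤ _ := by rw [mul_assoc]; exact mul_le_mul_right h1 _

/-- The image of a function with mean value zero that is supported in a ball is integrable away
from the ball (Hörmander's condition). -/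
lemma exists_atom_bound (hn : 0 < n) (hθ : IsDiniModulus θ) :
    ∃ A : ℝ≥0∞, A ≠ ∞ ∧ ∀ (c : E n) (r : ℝ) (b : E n → ℂ), 0 < r → MemLp b 2 volume →
      Integrable b volume → (∀ y ∉ ball c r, b y = 0) → ∫ y, b y = 0 →
      ∫⁻ x in (ball c (2 * r))ᶜ, ‖T.app b x‖ₑ ≤ A * ∫⁻ y, ‖b y‖ₑ := by
  obtain ⟨A, hA, hbound⟩ := hθ.exists_tail_bound n
  refine ⟨ENNReal.ofReal T.kernelConst * A, ENNReal.mul_ne_top ENNReal.ofReal_ne_top hA,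
    fun c r b hr hb hbi hb0 hbm => ?_⟩
  have h1 := hbound c r (fun _ => 1) 1 hr fun R _ => by simp
  have hrep := T.app_eq_integral hn hb (isClosed_closedBall (x := c) (ε := r))
    fun y hy => hb0 y fun h => hy (ball_subset_closedBall h)
  have hpt : ∀ᵐ x ∂(volume.restrict (ball c (2 * r))ᶜ), ‖T.app b x‖ₑ ≤
      ENNReal.ofReal T.kernelConst * (∫⁻ y, ‖b y‖ₑ) *
        (ENNReal.ofReal (θ (r / ‖x - c‖) / ‖x - c‖ ^ n) * 1) := by
    rw [ae_restrict_iff' measurableSet_ball.compl]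
    filter_upwards [hrep, T.ae_kernel_section hn] with x hx hxK hxb
    have hxb' : x ∉ ball c (2 * r) := by simpa using hxb
    have hxr : 2 * r ≤ dist x c := by simpa using hxb
    rw [hx (by simp only [mem_closedBall]; linarith)]
    have hi : Integrable (fun y => T.kernel x y * b y) volume := by
      refine (T.integrable_kernel_mul hn hxK hr hb fun y hy => hb0 y ?_).1
      intro hyc
      rw [mem_ball] at hy hyc
      linarith [dist_triangle_left x c y]
    have heq : ∫ y, T.kernel x y * b y = ∫ y, (T.kernel x y - T.kernel x c) * b y := by
      simp_rw [sub_mul]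
      rw [integral_sub hi (hbi.const_mul _), integral_const_mul, hbm, mul_zero, sub_zero]
    rw [heq]
    refine (enorm_integral_le_lintegral_enorm _).trans ?_
    calc ∫⁻ y, ‖(T.kernel x y - T.kernel x c) * b y‖ₑ
        ≤ ∫⁻ y, ENNReal.ofReal T.kernelConst *
            ENNReal.ofReal (θ (r / ‖x - c‖) / ‖x - c‖ ^ n) * ‖b y‖ₑ := by
          refine lintegral_mono fun y => ?_
          by_cases hy : y ∈ ball c r
          · rw [enorm_mul]
            exact mul_le_mul_left (T.enorm_kernel_sub_snd_le hθ hy hxb') _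
          · simp [hb0 y hy]
      _ = _ := by
          rw [lintegral_const_mul' _ _
            (ENNReal.mul_ne_top ENNReal.ofReal_ne_top ENNReal.ofReal_ne_top)]
          ring
  have hbfin : ENNReal.ofReal T.kernelConst * (∫⁻ y, ‖b y‖ₑ) ≠ ∞ :=
    ENNReal.mul_ne_top ENNReal.ofReal_ne_top hbi.2.ne
  calc _ ≤ _ := lintegral_mono_ae hpt
    _ = ENNReal.ofReal T.kernelConst * (∫⁻ y, ‖b y‖ₑ) * ∫⁻ x in (ball c (2 * r))ᶜ,
        (ENNReal.ofReal (θ (r / ‖x - c‖) / ‖x - c‖ ^ n) * 1) := lintegral_const_mul' _ _ hbfin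
    _ ≤ ENNReal.ofReal T.kernelConst * (∫⁻ y, ‖b y‖ₑ) * (A * 1) := mul_le_mul_right h1 _
    _ = _ := by ring

end ThetaCZO

/-! ### The unweighted weak type inequality -/

/-- The sets of a Calderón–Zygmund decomposition at height `t`: disjoint balls and disjoint sets
`Q i` contained in their sixfold dilates, such that `|f| ≤ t` off `⋃ Q i`, while the average of
`|f|` over the dilate is comparable to `t` and the balls have small total volume. -/
lemma exists_calderonZygmund_sets {n : ℕ} (hn : 0 < n) {f : E n → ℂ} (hf : Integrable f volume)
    {t : ℝ≥0∞} (ht : t ≠ 0) :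
    ∃ (ι : Type) (_ : Countable ι) (c : ι → E n) (r : ι → ℝ) (Q : ι → Set (E n)),
      (∀ i, 0 < r i) ∧ Pairwise (Function.onFun Disjoint fun i => ball (c i) (r i)) ∧
      (∀ i, MeasurableSet (Q i)) ∧ Pairwise (Function.onFun Disjoint Q) ∧
      (∀ i, Q i ⊆ ball (c i) (6 * r i)) ∧
      (∀ᵐ x ∂(volume : Measure (E n)), x ∉ ⋃ i, Q i → ‖f x‖ₑ ≤ t) ∧
      (∀ i, ∫⁻ y in ball (c i) (6 * r i), ‖f y‖ₑ ≤ 11 ^ n * t * volume (ball (c i) (r i))) ∧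
      t * ∑' i, volume (ball (c i) (r i)) ≤ 6 ^ n * ∫⁻ y, ‖f y‖ₑ := by
  set F : E n → ℝ≥0∞ := fun y => ‖f y‖ₑ with hF
  have hFm : AEMeasurable F volume := hf.1.enorm
  have hFi : ∫⁻ y, F y ≠ ∞ := hf.2.ne
  set Ω : Set (E n) := {x | t < maximalFn F x} with hΩ
  have hweak : t * volume Ω ≤ 6 ^ n * ∫⁻ y, F y := by
    simpa using A1Measure.volume.weak_maximalFn hn hFm hFi t
  have hΩfin : volume Ω ≠ ∞ := by
    intro h
    rw [h, ENNReal.mul_top ht] at hweak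
    exact ENNReal.mul_ne_top (by simp) hFi (top_le_iff.1 hweak)
  obtain ⟨R, hR⟩ := exists_radius_bound (n := n) hn hΩfin
  have hRΩ : ∀ (c : E n) (r : ℝ), ball c r ⊆ Ω → r ≤ R := fun c r h => hR c r (measure_mono h)
  have hne : Ωᶜ.Nonempty := by
    rw [nonempty_compl]
    intro h
    have := hRΩ 0 (R + 1) (h ▸ subset_univ _)
    linarith
  have hΩo : IsOpen Ω := isOpen_lt_maximalFn F t
  obtain ⟨u, huc, hdis, hu, hcov⟩ := exists_whitney_balls hΩo hne hRΩ (k := 10) (by norm_num)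
  have := huc.to_subtype
  obtain ⟨Q, hQm, hQd, hQs, hQu⟩ := exists_disjoint_refinement
    (A := fun b : u => ball b.1.1 (6 * b.1.2)) fun _ => measurableSet_ball
  have hballd : Pairwise (Function.onFun Disjoint fun b : u => ball b.1.1 b.1.2) :=
    fun a b hab => hdis a.2 b.2 fun h => hab (Subtype.ext h)
  have hdoub : ∀ b : u, ∀ k : ℝ, 0 < k → volume (ball b.1.1 (k * b.1.2)) =
      ENNReal.ofReal k ^ n * volume (ball b.1.1 b.1.2) :=
    fun b k hk => volume_ball_mul _ _ hk (hu b.1 b.2).1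
  refine ⟨u, this, fun b => b.1.1, fun b => b.1.2, Q, fun b => (hu b.1 b.2).1, hballd, hQm, hQd,
    hQs, ?_, fun b => ?_, ?_⟩
  · filter_upwards [ae_le_maximalFn hFm hFi] with x hx hxQ
    have hxΩ : x ∉ Ω := by
      intro h
      obtain ⟨b, hb, hxb⟩ := mem_iUnion₂.1 (hcov h)
      exact hxQ (hQu ▸ mem_iUnion.2 ⟨⟨b, hb⟩, hxb⟩)
    exact hx.trans (not_lt.1 hxΩ)
  · -- the elevenfold dilate contains a point at which the maximal function is at most `t`
    obtain ⟨h0, -, hnot⟩ := hu b.1 b.2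
    obtain ⟨z, hz, hzΩ⟩ := not_subset.1 hnot
    have h1 := lintegral_ball_le_maximalFn F hz
    have h2 : ball b.1.1 (6 * b.1.2) ⊆ ball b.1.1 ((10 + 1) * b.1.2) :=
      ball_subset_ball (by nlinarith)
    refine (lintegral_mono_set h2).trans (h1.trans ?_)
    rw [hdoub b _ (by norm_num)]
    have h3 : ENNReal.ofReal (10 + 1) = 11 := by norm_num
    rw [h3]
    calc _ ≤ t * (11 ^ n * volume (ball b.1.1 b.1.2)) := mul_le_mul_left (not_lt.1 hzΩ) _
      _ = _ := by rw [← mul_assoc, mul_comm t]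
  · refine le_trans (mul_le_mul_right ?_ t) hweak
    rw [← measure_iUnion hballd fun _ => measurableSet_ball]
    refine measure_mono (iUnion_subset fun b => ?_)
    refine (ball_subset_ball ?_).trans (hu b.1 b.2).2.1
    nlinarith [(hu b.1 b.2).1]

namespace ThetaCZO

variable {n : ℕ} {θ : ℝ → ℝ} (T : ThetaCZO n θ)

lemma mul_measure_lt_app_le_of_sq {f : E n → ℂ} (hf : MemLp f 2 volume) {t X : ℝ≥0∞} (ht : t ≠ 0)
    (ht' : t ≠ ∞) (h : ∫⁻ x, ‖f x‖ₑ ^ 2 ≤ t * X) :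
    t * volume {x | t < ‖T.app f x‖ₑ} ≤ ‖T.toL2‖ₑ ^ 2 * X := by
  rw [← ENNReal.mul_le_mul_iff_right ht ht']
  calc t * (t * volume {x | t < ‖T.app f x‖ₑ}) = t ^ 2 * volume {x | t < ‖T.app f x‖ₑ} := by
        rw [← mul_assoc, sq]
    _ ≤ ‖T.toL2‖ₑ ^ 2 * ∫⁻ x, ‖f x‖ₑ ^ 2 := T.measure_lt_app_le hf t
    _ ≤ ‖T.toL2‖ₑ ^ 2 * (t * X) := mul_le_mul_right h _
    _ = _ := mul_left_comm _ _ _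

/-- The contribution of finitely many atoms to the weak type inequality. -/
lemma mul_measure_lt_app_sum_le {A : ℝ≥0∞} {ι : Type*} (s : Finset ι) {b : ι → E n → ℂ}
    (hb : ∀ i, MemLp (b i) 2 volume) {S : ι → Set (E n)} (hS : ∀ i, MeasurableSet (S i))
    (hA : ∀ i, ∫⁻ x in (S i)ᶜ, ‖T.app (b i) x‖ₑ ≤ A * ∫⁻ y, ‖b i y‖ₑ) (t : ℝ≥0∞) :
    t * volume {x | t < ‖T.app (∑ i ∈ s, b i) x‖ₑ} ≤
      t * ∑ i ∈ s, volume (S i) + A * ∑ i ∈ s, ∫⁻ y, ‖b i y‖ₑ := by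
  set U : Set (E n) := ⋃ i ∈ s, S i with hU
  have hUm : MeasurableSet U := Finset.measurableSet_biUnion s fun i _ => hS i
  set g := T.app (∑ i ∈ s, b i) with hg
  have h1 : volume {x | t < ‖g x‖ₑ} ≤ volume U + volume.restrict Uᶜ {x | t ≤ ‖g x‖ₑ} := by
    rw [Measure.restrict_apply' hUm.compl]
    refine (measure_mono fun x hx => ?_).trans (measure_union_le _ _)
    by_cases hxU : x ∈ U
    · exact Or.inl hxU
    · exact Or.inr ⟨le_of_lt (show t < ‖g x‖ₑ from hx), hxU⟩
  have h2 : t * volume.restrict Uᶜ {x | t ≤ ‖g x‖ₑ} ≤ ∫⁻ x in Uᶜ, ‖g x‖ₑ :=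
    mul_meas_ge_le_lintegral₀ (T.aestronglyMeasurable_app _).enorm.restrict t
  have h3 : ∫⁻ x in Uᶜ, ‖g x‖ₑ ≤ ∑ i ∈ s, ∫⁻ x in Uᶜ, ‖T.app (b i) x‖ₑ := by
    rw [← lintegral_finsetSum' _ fun i _ => (T.aestronglyMeasurable_app (b i)).enorm.restrict]
    refine lintegral_mono_ae (ae_restrict_of_ae ?_)
    filter_upwards [T.app_sum s hb] with x hx
    rw [hg, hx, Finset.sum_apply]
    exact enorm_sum_le _ _
  have h4 : ∑ i ∈ s, ∫⁻ x in Uᶜ, ‖T.app (b i) x‖ₑ ≤ A * ∑ i ∈ s, ∫⁻ y, ‖b i y‖ₑ := by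
    rw [Finset.mul_sum]
    refine Finset.sum_le_sum fun i hi => le_trans (lintegral_mono_set ?_) (hA i)
    exact compl_subset_compl.2 (subset_biUnion_of_mem (u := S) hi)
  calc t * volume {x | t < ‖g x‖ₑ}
      ≤ t * (volume U + volume.restrict Uᶜ {x | t ≤ ‖g x‖ₑ}) := mul_le_mul_right h1 _
    _ = t * volume U + t * volume.restrict Uᶜ {x | t ≤ ‖g x‖ₑ} := mul_add _ _ _
    _ ≤ _ := add_le_add (mul_le_mul_right (measure_biUnion_finset_le _ _) _)
        (h2.trans (h3.trans h4))

/-- The image of a sum of four functions is large only where one of the four images is. -/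
lemma measure_lt_app_add_le {f₁ f₂ f₃ f₄ : E n → ℂ} (h₁ : MemLp f₁ 2 volume)
    (h₂ : MemLp f₂ 2 volume) (h₃ : MemLp f₃ 2 volume) (h₄ : MemLp f₄ 2 volume) (t : ℝ≥0∞) :
    volume {x | 4 * t < ‖T.app (f₁ + f₂ + f₃ + f₄) x‖ₑ} ≤
      volume {x | t < ‖T.app f₁ x‖ₑ} + volume {x | t < ‖T.app f₂ x‖ₑ} +
        volume {x | t < ‖T.app f₃ x‖ₑ} + volume {x | t < ‖T.app f₄ x‖ₑ} := by
  have hsub : {x | 4 * t < ‖T.app (f₁ + f₂ + f₃ + f₄) x‖ₑ} ≤ᵐ[volume]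
      ((({x | t < ‖T.app f₁ x‖ₑ} ∪ {x | t < ‖T.app f₂ x‖ₑ}) ∪ {x | t < ‖T.app f₃ x‖ₑ}) ∪
        {x | t < ‖T.app f₄ x‖ₑ} : Set (E n)) := by
    filter_upwards [T.app_add ((h₁.add h₂).add h₃) h₄, T.app_add (h₁.add h₂) h₃,
      T.app_add h₁ h₂] with x hx1 hx2 hx3 hx
    by_contra hcon
    have hx' : 4 * t < ‖T.app (f₁ + f₂ + f₃ + f₄) x‖ₑ := hx
    have hcon' : ¬ (((t < ‖T.app f₁ x‖ₑ ∨ t < ‖T.app f₂ x‖ₑ) ∨ t < ‖T.app f₃ x‖ₑ) ∨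
      t < ‖T.app f₄ x‖ₑ) := hcon
    push Not at hcon'
    obtain ⟨⟨⟨k1, k2⟩, k3⟩, k4⟩ := hcon'
    rw [hx1, Pi.add_apply, hx2, Pi.add_apply, hx3, Pi.add_apply] at hx'
    refine absurd hx' (not_lt.2 ?_)
    calc _ ≤ ‖T.app f₁ x‖ₑ + ‖T.app f₂ x‖ₑ + ‖T.app f₃ x‖ₑ + ‖T.app f₄ x‖ₑ := by
          refine (enorm_add_le _ _).trans (add_le_add_left ?_ _)
          refine (enorm_add_le _ _).trans (add_le_add_left ?_ _)
          exact enorm_add_le _ _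
      _ ≤ t + t + t + t := add_le_add (add_le_add (add_le_add k1 k2) k3) k4
      _ = 4 * t := by ring
  refine (measure_mono_ae hsub).trans ?_
  refine (measure_union_le _ _).trans (add_le_add_left ?_ _)
  refine (measure_union_le _ _).trans (add_le_add_left ?_ _)
  exact measure_union_le _ _

/-- The part of a finite integral over a disjoint union that is left out by finitely many of the
sets tends to `0`. -/
lemma tendsto_lintegral_diff_biUnion {α ι : Type*} [MeasurableSpace α] [Countable ι]
    {μ : Measure α} {Q : ι → Set α} (hQ : ∀ i, MeasurableSet (Q i))
    (hd : Pairwise (Function.onFun Disjoint Q)) {G : α → ℝ≥0∞} (hG : ∫⁻ x, G x ∂μ ≠ ∞) :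
    Tendsto (fun s : Finset ι => ∫⁻ x in (⋃ i, Q i) \ ⋃ i ∈ s, Q i, G x ∂μ) atTop (𝓝 0) := by
  have hsum : ∑' i, ∫⁻ x in Q i, G x ∂μ ≠ ∞ := by
    rw [← lintegral_iUnion hQ hd]
    exact ne_top_of_le_ne_top hG (setLIntegral_le_lintegral _ _)
  refine tendsto_of_tendsto_of_tendsto_of_le_of_le tendsto_const_nhds
    (ENNReal.tendsto_tsum_compl_atTop_zero hsum) (fun _ => zero_le) fun s => ?_
  have hsub : (⋃ i, Q i) \ ⋃ i ∈ s, Q i ⊆ ⋃ i : {i // i ∉ s}, Q i := by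
    rintro x ⟨hx, hxs⟩
    obtain ⟨i, hi⟩ := mem_iUnion.1 hx
    exact mem_iUnion.2 ⟨⟨i, fun his => hxs (mem_biUnion his hi)⟩, hi⟩
  exact (lintegral_mono_set hsub).trans (lintegral_iUnion_le _ _)

/-- The weak type `(1, 1)` inequality with respect to Lebesgue measure, by a Calderón–Zygmund
decomposition. The balls, rather than the sets `Q i`, carry the averages in the good part, so that
these are bounded however small the `Q i` are. Only finitely many atoms are split off; the remaining
part of `f` is small in `L²`. -/
theorem exists_weak_type_volume (hn : 0 < n) (hθ : IsDiniModulus θ) :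
    ∃ A : ℝ≥0∞, A ≠ ∞ ∧ ∀ (f : E n → ℂ) (t : ℝ≥0∞), MemLp f 2 volume → Integrable f volume →
      t * volume {x | t < ‖T.app f x‖ₑ} ≤ A * ∫⁻ y, ‖f y‖ₑ := by
  obtain ⟨A, hA, hatom⟩ := T.exists_atom_bound hn hθ
  set N : ℝ≥0∞ := ‖T.toL2‖ₑ ^ 2 with hN
  have hNt : N ≠ ∞ := by simp [hN]
  set D : ℝ≥0∞ := N + N * 11 ^ n + (12 ^ n * 6 ^ n + A * 2) with hD
  have hDt : D ≠ ∞ := by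
    refine ENNReal.add_ne_top.2 ⟨ENNReal.add_ne_top.2 ⟨hNt, ENNReal.mul_ne_top hNt (by simp)⟩,
      ENNReal.add_ne_top.2 ⟨ENNReal.mul_ne_top (by simp) (by simp),
        ENNReal.mul_ne_top hA (by simp)⟩⟩
  suffices key : ∀ (f : E n → ℂ) (t : ℝ≥0∞), MemLp f 2 volume → Integrable f volume → t ≠ 0 →
      t ≠ ∞ → t * volume {x | 4 * t < ‖T.app f x‖ₑ} ≤ D * ∫⁻ y, ‖f y‖ₑ by
    refine ⟨4 * D, ENNReal.mul_ne_top (by simp) hDt, fun f t hf hfi => ?_⟩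
    rcases eq_or_ne t 0 with rfl | ht
    · simp
    rcases eq_or_ne t ∞ with rfl | ht'
    · simp
    have h4 : (4 : ℝ≥0∞) * (t / 4) = t := ENNReal.mul_div_cancel (by simp) (by simp)
    have := mul_le_mul_right (key f (t / 4) hf hfi (ENNReal.div_ne_zero.2 ⟨ht, by simp⟩)
      (ENNReal.div_ne_top ht' (by simp))) 4
    rwa [← mul_assoc, h4, ← mul_assoc] at this
  intro f t hf hfi ht ht'
  obtain ⟨ι, _, c, r, Q, hr, hBd, hQm, hQd, hQs, hsmall, havg, hvol⟩ :=
    exists_calderonZygmund_sets hn hfi ht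
  set I := ∫⁻ y, ‖f y‖ₑ with hI
  set U : Set (E n) := ⋃ i, Q i with hU
  have hUm : MeasurableSet U := MeasurableSet.iUnion hQm
  set B : ι → Set (E n) := fun i => ball (c i) (r i) with hB
  have hBm : ∀ i, MeasurableSet (B i) := fun _ => measurableSet_ball
  have hB0 : ∀ i, volume (B i) ≠ 0 := fun i => volume_ball_ne_zero _ (hr i)
  have hBt : ∀ i, volume (B i) ≠ ∞ := fun i => volume_ball_ne_top _ _
  -- the mass of `f` on `Q i` is spread over the ball `B i`
  set a : ι → ℂ := fun i => (volume.real (B i))⁻¹ • ∫ y in Q i, f y with ha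
  set b : ι → E n → ℂ := fun i => (Q i).indicator f - (B i).indicator fun _ => a i with hb
  have hBr : ∀ i, volume.real (B i) ≠ 0 := fun i => (ENNReal.toReal_pos (hB0 i) (hBt i)).ne'
  have hQI : ∀ s : Finset ι, ∑ i ∈ s, ∫⁻ y in Q i, ‖f y‖ₑ ≤ I := fun s => by
    refine (ENNReal.sum_le_tsum s).trans ?_
    rw [← lintegral_iUnion hQm hQd]
    exact setLIntegral_le_lintegral _ _
  have haB : ∀ i, ‖a i‖ₑ * volume (B i) ≤ ∫⁻ y in Q i, ‖f y‖ₑ := fun i => by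
    have h1 : ‖a i‖ₑ * volume (B i) = ‖∫ y in Q i, f y‖ₑ := by
      rw [ha, enorm_smul, Real.enorm_of_nonneg (inv_nonneg.2 measureReal_nonneg),
        Measure.real, ENNReal.ofReal_inv_of_pos (ENNReal.toReal_pos (hB0 i) (hBt i)),
        ENNReal.ofReal_toReal (hBt i), mul_right_comm, ENNReal.inv_mul_cancel (hB0 i) (hBt i),
        one_mul]
    rw [h1]
    exact enorm_integral_le_lintegral_enorm _
  have ha' : ∀ i, ‖a i‖ₑ ≤ 11 ^ n * t := fun i => by
    rw [← ENNReal.mul_le_mul_iff_left (hB0 i) (hBt i)]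
    exact (haB i).trans ((lintegral_mono_set (hQs i)).trans (havg i))
  have hBmem : ∀ i, MemLp ((B i).indicator fun _ => a i) 2 volume := fun i =>
    memLp_indicator_const 2 (hBm i) (a i) (Or.inr (hBt i))
  have hbmem : ∀ i, MemLp (b i) 2 volume := fun i => (hf.indicator (hQm i)).sub (hBmem i)
  have hBint : ∀ i, Integrable ((B i).indicator fun _ => a i) volume := fun i =>
    (integrable_indicator_iff (hBm i)).2 (integrableOn_const (hBt i))
  have hbint : ∀ i, Integrable (b i) volume := fun i =>
    (hfi.indicator (hQm i)).sub (hBint i)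
  have hbzero : ∀ i, ∀ y ∉ ball (c i) (6 * r i), b i y = 0 := fun i y hy => by
    have h1 : y ∉ Q i := fun h => hy (hQs i h)
    have h2 : y ∉ B i := fun h => hy (ball_subset_ball (by nlinarith [hr i]) h)
    simp [hb, h1, h2]
  have hbmean : ∀ i, ∫ y, b i y = 0 := fun i => by
    have h1 : ∫ y, b i y = (∫ y in Q i, f y) - volume.real (B i) • a i := by
      simp only [hb, Pi.sub_apply]
      rw [integral_sub (hfi.indicator (hQm i)) (hBint i), integral_indicator (hQm i),
        integral_indicator (hBm i), setIntegral_const]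
    rw [h1, ha, smul_smul, mul_inv_cancel₀ (hBr i), one_smul, sub_self]
  have hbnorm : ∀ i, ∫⁻ y, ‖b i y‖ₑ ≤ 2 * ∫⁻ y in Q i, ‖f y‖ₑ := fun i => by
    calc ∫⁻ y, ‖b i y‖ₑ ≤ ∫⁻ y, ((Q i).indicator (fun y => ‖f y‖ₑ) y +
          (B i).indicator (fun _ => ‖a i‖ₑ) y) := by
          refine lintegral_mono fun y => ?_
          simp only [hb, Pi.sub_apply]
          refine (enorm_sub_le).trans (le_of_eq ?_)
          rw [enorm_indicator_eq_indicator_enorm, enorm_indicator_eq_indicator_enorm]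
      _ = (∫⁻ y in Q i, ‖f y‖ₑ) + ‖a i‖ₑ * volume (B i) := by
          rw [lintegral_add_right _ (measurable_const.indicator (hBm i)),
            lintegral_indicator (hQm i), lintegral_indicator_const (hBm i)]
      _ ≤ (∫⁻ y in Q i, ‖f y‖ₑ) + ∫⁻ y in Q i, ‖f y‖ₑ := add_le_add_right (haB i) _
      _ = _ := (two_mul _).symm
  have hbad : ∀ s : Finset ι, t * volume {x | t < ‖T.app (∑ i ∈ s, b i) x‖ₑ} ≤
      (12 ^ n * 6 ^ n + A * 2) * I := fun s => by
    have h1 := T.mul_measure_lt_app_sum_le s hbmem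
      (S := fun i => ball (c i) (2 * (6 * r i))) (fun _ => measurableSet_ball)
      (fun i => hatom (c i) (6 * r i) (b i) (by linarith [hr i]) (hbmem i) (hbint i) (hbzero i)
        (hbmean i)) t
    refine h1.trans ?_
    rw [add_mul]
    refine add_le_add ?_ ?_
    · have h2 : ∀ i, volume (ball (c i) (2 * (6 * r i))) = 12 ^ n * volume (B i) := fun i => by
        rw [show 2 * (6 * r i) = 12 * r i by ring,
          volume_ball_mul (c i) (c i) (by norm_num) (hr i),
          ENNReal.ofReal_ofNat]
      simp_rw [h2]
      rw [← Finset.mul_sum, mul_left_comm, mul_assoc]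
      exact mul_le_mul_right ((mul_le_mul_right (ENNReal.sum_le_tsum s) t).trans hvol) _
    · rw [mul_assoc]
      refine mul_le_mul_right ?_ A
      refine (Finset.sum_le_sum fun i _ => hbnorm i).trans ?_
      rw [← Finset.mul_sum]
      exact mul_le_mul_right (hQI s) 2
  have hout : t * volume {x | t < ‖T.app (Uᶜ.indicator f) x‖ₑ} ≤ N * I := by
    refine T.mul_measure_lt_app_le_of_sq (hf.indicator hUm.compl) ht ht' ?_
    rw [hI, ← lintegral_const_mul' _ _ ht']
    refine lintegral_mono_ae ?_
    filter_upwards [hsmall] with x hx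
    by_cases hxU : x ∈ U
    · rw [indicator_of_notMem (by simpa using hxU)]; simp
    · rw [indicator_of_mem (by simpa using hxU), sq]
      exact mul_le_mul_left (hx hxU) _
  have hgood : ∀ s : Finset ι,
      t * volume {x | t < ‖T.app (∑ i ∈ s, (B i).indicator fun _ => a i) x‖ₑ} ≤
        N * (11 ^ n * I) := fun s => by
    refine T.mul_measure_lt_app_le_of_sq (memLp_finsetSum' s fun i _ => hBmem i) ht ht' ?_
    rw [lintegral_enorm_sq_sum_indicator hBm hBd]
    calc ∑ i ∈ s, ‖a i‖ₑ ^ 2 * volume (B i)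
        ≤ ∑ i ∈ s, 11 ^ n * t * ∫⁻ y in Q i, ‖f y‖ₑ := by
          refine Finset.sum_le_sum fun i _ => ?_
          rw [sq, mul_assoc]
          exact mul_le_mul' (ha' i) (haB i)
      _ = 11 ^ n * t * ∑ i ∈ s, ∫⁻ y in Q i, ‖f y‖ₑ := (Finset.mul_sum _ _ _).symm
      _ ≤ 11 ^ n * t * I := mul_le_mul_right (hQI s) _
      _ = _ := by rw [mul_assoc, mul_left_comm]
  have hSm : ∀ s : Finset ι, MeasurableSet (U \ ⋃ i ∈ s, Q i) := fun s =>
    hUm.diff (Finset.measurableSet_biUnion s fun i _ => hQm i)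
  -- only `f ∈ L²` is used for the remainder, at the cost of a factor `t⁻¹` that the limit absorbs
  have hrest : ∀ s : Finset ι,
      t * volume {x | t < ‖T.app ((U \ ⋃ i ∈ s, Q i).indicator f) x‖ₑ} ≤
        N * (t⁻¹ * ∫⁻ y in U \ ⋃ i ∈ s, Q i, ‖f y‖ₑ ^ 2) := fun s => by
    refine T.mul_measure_lt_app_le_of_sq (hf.indicator (hSm s)) ht ht' ?_
    rw [← mul_assoc, ENNReal.mul_inv_cancel ht ht', one_mul, ← lintegral_indicator (hSm s)]
    refine lintegral_mono fun y => ?_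
    by_cases hy : y ∈ U \ ⋃ i ∈ s, Q i
    · rw [indicator_of_mem hy, indicator_of_mem hy]
    · rw [indicator_of_notMem hy]; simp
  -- `f` is the part off all `Q i`, plus averages, plus atoms, plus the part on the `Q i`, `i ∉ s`
  have hdecomp : ∀ s : Finset ι, f = Uᶜ.indicator f + (∑ i ∈ s, (B i).indicator fun _ => a i) +
      (∑ i ∈ s, b i) + (U \ ⋃ i ∈ s, Q i).indicator f := fun s => by
    have h1 : (∑ i ∈ s, (B i).indicator fun _ => a i) + ∑ i ∈ s, b i =
        (⋃ i ∈ s, Q i).indicator f := by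
      rw [← Finset.sum_add_distrib, Finset.indicator_biUnion s Q fun i _ j _ hij => hQd hij]
      ext x
      simp [hb, Finset.sum_apply]
    have h2 : ⋃ i ∈ s, Q i ⊆ U := iUnion₂_subset fun i _ => subset_iUnion Q i
    rw [add_assoc (Uᶜ.indicator f), h1]
    ext x
    by_cases hxs : x ∈ ⋃ i ∈ s, Q i
    · have hxU := h2 hxs
      simp only [Pi.add_apply]
      rw [indicator_of_mem hxs, indicator_of_notMem (by simpa using hxU),
        indicator_of_notMem (fun h => h.2 hxs)]
      simp
    · by_cases hxU : x ∈ U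
      · simp only [Pi.add_apply]
        rw [indicator_of_notMem hxs, indicator_of_notMem (by simpa using hxU),
          indicator_of_mem (show x ∈ U \ ⋃ i ∈ s, Q i from ⟨hxU, hxs⟩)]
        simp
      · simp only [Pi.add_apply]
        rw [indicator_of_notMem hxs, indicator_of_mem (by simpa using hxU),
          indicator_of_notMem (fun h => hxU h.1)]
        simp
  have htotal : ∀ s : Finset ι, t * volume {x | 4 * t < ‖T.app f x‖ₑ} ≤
      D * I + N * (t⁻¹ * ∫⁻ y in U \ ⋃ i ∈ s, Q i, ‖f y‖ₑ ^ 2) := fun s => by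
    have h1 := T.measure_lt_app_add_le (hf.indicator hUm.compl)
      (memLp_finsetSum' s fun i _ => hBmem i) (memLp_finsetSum' s fun i _ => hbmem i)
      (hf.indicator (hSm s)) t
    rw [← hdecomp s] at h1
    refine (mul_le_mul_right h1 t).trans ?_
    rw [mul_add, mul_add, mul_add]
    refine add_le_add ?_ (hrest s)
    rw [hD, add_mul, add_mul]
    refine add_le_add (add_le_add hout ?_) (hbad s)
    rw [mul_assoc]
    exact hgood s
  have hf2 : ∫⁻ y, ‖f y‖ₑ ^ 2 ≠ ∞ := by
    have := (hf.eLpNorm_lt_top)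
    rw [eLpNorm_lt_top_iff_lintegral_rpow_enorm_lt_top (by simp) (by simp)] at this
    simpa using this.ne
  have hlim : Tendsto (fun s : Finset ι =>
      D * I + N * (t⁻¹ * ∫⁻ y in U \ ⋃ i ∈ s, Q i, ‖f y‖ₑ ^ 2)) atTop (𝓝 (D * I)) := by
    have h0 := tendsto_lintegral_diff_biUnion (μ := volume) hQm hQd hf2
    have h1 := ENNReal.Tendsto.const_mul (a := t⁻¹) h0 (Or.inr (ENNReal.inv_ne_top.2 ht))
    have h2 := ENNReal.Tendsto.const_mul (a := N) h1 (Or.inr hNt)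
    simpa using h2.const_add (D * I)
  exact ge_of_tendsto' hlim htotal

end ThetaCZO

/-! ### A good-`λ` inequality -/

/-- The points that lie in a ball on more than half of which `|g| > t`. It is open, it contains
almost all of `{|g| > t}`, and its measure is comparable to that of `{|g| > t}`. -/
def medianSet {n : ℕ} (g : E n → ℂ) (t : ℝ≥0∞) : Set (E n) :=
  {x | 1 / 2 < maximalFn ({y | t < ‖g y‖ₑ}.indicator 1) x}

lemma measurableSet_lt_enorm {n : ℕ} {g : E n → ℂ} (hg : StronglyMeasurable g) (t : ℝ≥0∞) :
    MeasurableSet {y | t < ‖g y‖ₑ} :=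
  measurableSet_lt measurable_const hg.measurable.enorm

lemma half_lt_maximalFn_indicator_iff {n : ℕ} {H : Set (E n)} (hH : MeasurableSet H) {x : E n} :
    1 / 2 < maximalFn (H.indicator 1) x ↔
      ∃ c r, x ∈ ball c r ∧ volume (ball c r) < 2 * volume (ball c r ∩ H) := by
  rw [lt_maximalFn_iff]
  refine exists_congr fun c => exists_congr fun r => and_congr_right fun _ => ?_
  rw [lintegral_indicator_one hH, Measure.restrict_apply hH, inter_comm H, one_div,
    ← ENNReal.div_eq_inv_mul, ENNReal.div_lt_iff (by simp) (by simp), mul_comm]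

lemma mem_medianSet_iff {n : ℕ} {g : E n → ℂ} (hg : StronglyMeasurable g) {t : ℝ≥0∞} {x : E n} :
    x ∈ medianSet g t ↔
      ∃ c r, x ∈ ball c r ∧ volume (ball c r) < 2 * volume (ball c r ∩ {y | t < ‖g y‖ₑ}) :=
  half_lt_maximalFn_indicator_iff (measurableSet_lt_enorm hg t)

lemma medianSet_anti {n : ℕ} (g : E n → ℂ) {s t : ℝ≥0∞} (h : s ≤ t) :
    medianSet g t ⊆ medianSet g s := by
  intro x hx
  change 1 / 2 < maximalFn _ x at hx
  change 1 / 2 < maximalFn _ x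
  refine hx.trans_le (maximalFn_mono (fun y => ?_) x)
  exact indicator_le_indicator_of_subset (fun _ hz => h.trans_lt hz) (fun _ => zero_le) y

lemma A1Measure.measure_medianSet_le {n : ℕ} {μ : Measure (E n)} {C : ℝ≥0∞} (h : A1Measure μ C)
    (hn : 0 < n) {g : E n → ℂ} (hg : StronglyMeasurable g) {t : ℝ≥0∞}
    (hfin : MeasureTheory.volume {y | t < ‖g y‖ₑ} ≠ ∞) :
    μ (medianSet g t) ≤ 2 * (C * 6 ^ n * C * μ {y | t < ‖g y‖ₑ}) := by
  have hH := measurableSet_lt_enorm hg t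
  have h1 := h.weak_maximalFn hn (F := {y | t < ‖g y‖ₑ}.indicator 1)
    (aemeasurable_one.indicator hH) (by rwa [lintegral_indicator_one hH]) (1 / 2)
  rw [lintegral_indicator_one hH] at h1
  calc μ (medianSet g t) = 2 * (1 / 2 * μ (medianSet g t)) := by
        rw [← mul_assoc, ENNReal.mul_div_cancel (by simp) (by simp), one_mul]
    _ ≤ _ := mul_le_mul_right h1 2

lemma ae_mem_medianSet {n : ℕ} {g : E n → ℂ} (hg : StronglyMeasurable g) {t : ℝ≥0∞}
    (hfin : volume {y | t < ‖g y‖ₑ} ≠ ∞) :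
    ∀ᵐ x ∂(volume : Measure (E n)), t < ‖g x‖ₑ → x ∈ medianSet g t := by
  have hH := measurableSet_lt_enorm hg t
  filter_upwards [ae_le_maximalFn (F := {y | t < ‖g y‖ₑ}.indicator 1)
    (aemeasurable_one.indicator hH) (by rwa [lintegral_indicator_one hH])] with x hx hxt
  rw [indicator_of_mem (show x ∈ {y | t < ‖g y‖ₑ} from hxt), Pi.one_apply] at hx
  refine lt_of_lt_of_le ?_ hx
  rw [one_div]
  exact ENNReal.inv_lt_one.2 (by norm_num)

namespace ThetaCZO

variable {n : ℕ} {θ : ℝ → ℝ} (T : ThetaCZO n θ)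

lemma stronglyMeasurable_app (f : E n → ℂ) : StronglyMeasurable (T.app f) := by
  by_cases hf : MemLp f 2 volume
  · rw [T.app_of_memLp hf]; exact Lp.stronglyMeasurable _
  · rw [app, dif_neg hf]; exact stronglyMeasurable_zero

lemma volume_lt_app_ne_top {f : E n → ℂ} (hf : MemLp f 2 volume) {t : ℝ≥0∞} (ht : t ≠ 0) :
    volume {y | t < ‖T.app f y‖ₑ} ≠ ∞ := by
  intro h
  have h1 := T.measure_lt_app_le hf t
  rw [h, ENNReal.mul_top (pow_ne_zero 2 ht)] at h1
  refine ENNReal.mul_ne_top (by simp) ?_ (top_le_iff.1 h1)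
  have := hf.eLpNorm_lt_top
  rw [eLpNorm_lt_top_iff_lintegral_rpow_enorm_lt_top (by simp) (by simp)] at this
  simpa using this.ne

/-- On a ball `B` that contains a point `x₀` with `M f(x₀) ≤ γ t`, and at least half of which lies
in `{|T f| ≤ t}`, the set `{|T f| > (1 + 4 ε) t}` has small measure if `γ` is small with respect to
`ε`. Write `f = f χ_{5B} + f χ_{(5B)ᶜ}`: the first part is small on most of `B` by the weak type
inequality, and the second part is almost constant on `B`, with a value of modulus at most about
`t`, since there is a point at which both `T f` and `T (f χ_{5B})` are under control. -/
lemma exists_local_bound (hn : 0 < n) (hθ : IsDiniModulus θ) :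
    ∃ A : ℝ≥0∞, A ≠ ∞ ∧ ∀ (f : E n → ℂ), MemLp f 2 volume → Integrable f volume →
      ∀ (c x₀ : E n) (r : ℝ) (t ε γ : ℝ≥0∞), t ≠ 0 → t ≠ ∞ → ε ≠ 0 → ε ≠ ∞ →
      A * γ ≤ ε → x₀ ∈ ball c r → maximalFn (fun y => ‖f y‖ₑ) x₀ ≤ γ * t →
      2 * volume (ball c r ∩ {y | t < ‖T.app f y‖ₑ}) ≤ volume (ball c r) →
      ε * volume (ball c r ∩ {y | (1 + 4 * ε) * t < ‖T.app f y‖ₑ}) ≤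
        A * γ * volume (ball c r) := by
  obtain ⟨A₁, hA₁, hweak⟩ := T.exists_weak_type_volume hn hθ
  obtain ⟨A₂, hA₂, hosc⟩ := T.exists_oscillation_bound hθ
  refine ⟨4 * (A₁ * 5 ^ n) + A₂, ENNReal.add_ne_top.2 ⟨ENNReal.mul_ne_top (by simp)
    (ENNReal.mul_ne_top hA₁ (by simp)), hA₂⟩, ?_⟩
  intro f hf hfi c x₀ r t ε γ ht ht' hε hε' hA hx₀ hM hhalf
  have hr : 0 < r := pos_of_mem_ball hx₀
  set B := ball c r with hB
  have hB0 : volume B ≠ 0 := volume_ball_ne_zero c hr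
  have hBt : volume B ≠ ∞ := volume_ball_ne_top c r
  set S := ball c (5 * r) with hS
  have hSm : MeasurableSet S := measurableSet_ball
  set f₁ := S.indicator f with hf₁
  set f₂ := Sᶜ.indicator f with hf₂
  have hf₁m : MemLp f₁ 2 volume := hf.indicator hSm
  have hf₂m : MemLp f₂ 2 volume := hf.indicator hSm.compl
  have hsum : f₁ + f₂ = f := indicator_self_add_compl S f
  have hf₂0 : ∀ y ∈ S, f₂ y = 0 := fun y hy => indicator_of_notMem (by simpa using hy) f
  have havg : ∀ R, r ≤ R → ∫⁻ y in ball c R, ‖f y‖ₑ ≤ γ * t * volume (ball c R) := fun R hR =>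
    (lintegral_ball_le_maximalFn _ (ball_subset_ball hR hx₀)).trans (mul_le_mul_left hM _)
  have havg₂ : ∀ R, r ≤ R → ∫⁻ y in ball c R, ‖f₂ y‖ₑ ≤ γ * t * volume (ball c R) :=
    fun R hR => (lintegral_mono fun y => by
      rw [hf₂, enorm_indicator_eq_indicator_enorm]
      exact indicator_le_self _ _ _).trans (havg R hR)
  -- the local part: `bad` occupies at most a quarter of `B`
  set bad : Set (E n) := {x | ε * t < ‖T.app f₁ x‖ₑ} with hbad
  have hbad1 : ε * volume bad ≤ A₁ * 5 ^ n * γ * volume B := by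
    have h1 := hweak f₁ (ε * t) hf₁m (hfi.indicator hSm)
    have h2 : ∫⁻ y, ‖f₁ y‖ₑ ≤ γ * t * (5 ^ n * volume B) := by
      rw [hf₁]
      simp_rw [enorm_indicator_eq_indicator_enorm]
      rw [lintegral_indicator hSm]
      refine (havg (5 * r) (by linarith)).trans (le_of_eq ?_)
      rw [volume_ball_mul c c (by norm_num) hr, ENNReal.ofReal_ofNat]
    rw [← ENNReal.mul_le_mul_iff_right ht ht']
    calc t * (ε * volume bad) = ε * t * volume bad := by ring
      _ ≤ A₁ * (γ * t * (5 ^ n * volume B)) := h1.trans (mul_le_mul_right h2 _)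
      _ = _ := by ring
  have hbad2 : 4 * volume bad ≤ volume B := by
    rw [← ENNReal.mul_le_mul_iff_right hε hε']
    calc ε * (4 * volume bad) = 4 * (ε * volume bad) := by ring
      _ ≤ 4 * (A₁ * 5 ^ n * γ * volume B) := mul_le_mul_right hbad1 _
      _ = 4 * (A₁ * 5 ^ n) * γ * volume B := by ring
      _ ≤ (4 * (A₁ * 5 ^ n) + A₂) * γ * volume B := by gcongr; exact le_self_add
      _ ≤ ε * volume B := mul_le_mul_left hA _
  -- the part `k` of `T f` that comes from far away oscillates by at most `ε t` on `B`
  set k : E n → ℂ := fun x => ∫ y, T.kernel x y * f₂ y with hk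
  have hgood : ∀ᵐ x ∂(volume : Measure (E n)), x ∈ B →
      AEStronglyMeasurable (T.kernel x) volume ∧ T.app f x = T.app f₁ x + k x := by
    filter_upwards [T.app_eq_integral hn hf₂m (isOpen_ball (x := c) (ε := 5 * r)).isClosed_compl
      (fun y hy => hf₂0 y (not_not.1 hy)), T.app_add hf₁m hf₂m,
      T.ae_kernel_section hn] with x hx1 hx2 hx3 hxB
    have hxS : x ∈ S := ball_subset_ball (by linarith) hxB
    refine ⟨hx3, ?_⟩
    rw [← hsum, hx2, Pi.add_apply, hx1 (fun h => h hxS)]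
  have hkdiff : ∀ x x', x ∈ B → x' ∈ B → AEStronglyMeasurable (T.kernel x) volume →
      AEStronglyMeasurable (T.kernel x') volume → ‖k x - k x'‖ₑ ≤ A₂ * (γ * t) := by
    intro x x' hx hx' hxm hx'm
    have hi : ∀ z ∈ B, AEStronglyMeasurable (T.kernel z) volume →
        Integrable (fun y => T.kernel z y * f₂ y) volume := fun z hz hzm =>
      (T.integrable_kernel_mul hn hzm (δ := 4 * r) (by positivity) hf₂m fun y hy => hf₂0 y (by
        rw [hB, mem_ball] at hz
        rw [mem_ball] at hy
        rw [hS, mem_ball]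
        linarith [dist_triangle y z c])).1
    simp only [hk]
    rw [← integral_sub (hi x hx hxm) (hi x' hx' hx'm)]
    exact (enorm_integral_le_lintegral_enorm _).trans
      (hosc c x x' r f₂ (γ * t) hx hx' hf₂0 havg₂)
  -- `bad` and `{|T f| > t}` together cover at most three quarters of `B`
  obtain ⟨x', hx'B, hx'bad, hx't, hx'm, hx'eq⟩ : ∃ x' ∈ B, x' ∉ bad ∧ ‖T.app f x'‖ₑ ≤ t ∧
      AEStronglyMeasurable (T.kernel x') volume ∧ T.app f x' = T.app f₁ x' + k x' := by
    by_contra! hcon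
    have hsub : B ≤ᵐ[volume] (bad ∪ (B ∩ {y | t < ‖T.app f y‖ₑ}) : Set (E n)) := by
      filter_upwards [hgood] with x hx hxB
      by_contra hx2
      have hx3 : ¬ (x ∈ bad ∨ (x ∈ B ∧ t < ‖T.app f x‖ₑ)) := hx2
      push Not at hx3
      exact hcon x hxB hx3.1 (hx3.2 hxB) (hx hxB).1 (hx hxB).2
    have h1 := (measure_mono_ae hsub).trans (measure_union_le _ _)
    have h2 : 4 * volume B ≤ 3 * volume B := by
      calc 4 * volume B ≤ 4 * (volume bad + volume (B ∩ {y | t < ‖T.app f y‖ₑ})) :=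
            mul_le_mul_right h1 _
        _ = 4 * volume bad + 2 * (2 * volume (B ∩ {y | t < ‖T.app f y‖ₑ})) := by ring
        _ ≤ volume B + 2 * volume B := add_le_add hbad2 (mul_le_mul_right hhalf _)
        _ = 3 * volume B := by ring
    rw [ENNReal.mul_le_mul_iff_left hB0 hBt] at h2
    norm_num at h2
  have hfinal : (B ∩ {y | (1 + 4 * ε) * t < ‖T.app f y‖ₑ} : Set (E n)) ≤ᵐ[volume] bad := by
    filter_upwards [hgood] with x hx hxH
    have hxB : x ∈ B := hxH.1
    have hxt : (1 + 4 * ε) * t < ‖T.app f x‖ₑ := hxH.2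
    by_contra hxbad
    have hxbad' : ‖T.app f₁ x‖ₑ ≤ ε * t := not_lt.1 hxbad
    have hx'bad' : ‖T.app f₁ x'‖ₑ ≤ ε * t := not_lt.1 hx'bad
    refine absurd hxt (not_lt.2 ?_)
    have h1 : ‖k x - k x'‖ₑ ≤ ε * t := by
      refine (hkdiff x x' hxB hx'B (hx hxB).1 hx'm).trans ?_
      rw [← mul_assoc]
      refine mul_le_mul_left (le_trans ?_ hA) t
      exact mul_le_mul_left le_add_self γ
    have h2 : T.app f x = T.app f₁ x + (k x - k x') + T.app f x' - T.app f₁ x' := by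
      rw [(hx hxB).2, hx'eq]; ring
    rw [h2]
    calc _ ≤ ‖T.app f₁ x‖ₑ + ‖k x - k x'‖ₑ + ‖T.app f x'‖ₑ + ‖T.app f₁ x'‖ₑ := by
          refine enorm_sub_le.trans (add_le_add_left ?_ _)
          refine (enorm_add_le _ _).trans (add_le_add_left ?_ _)
          exact enorm_add_le _ _
      _ ≤ ε * t + ε * t + t + ε * t :=
          add_le_add (add_le_add (add_le_add hxbad' h1) hx't) hx'bad'
      _ ≤ ε * t + ε * t + t + ε * t + ε * t := le_self_add
      _ = (1 + 4 * ε) * t := by ring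
  calc ε * volume (B ∩ {y | (1 + 4 * ε) * t < ‖T.app f y‖ₑ}) ≤ ε * volume bad :=
        mul_le_mul_right (measure_mono_ae hfinal) _
    _ ≤ A₁ * 5 ^ n * γ * volume B := hbad1
    _ ≤ (4 * (A₁ * 5 ^ n) + A₂) * γ * volume B := by
        gcongr
        refine le_add_right ?_
        exact le_mul_of_one_le_left zero_le (by norm_num)

/-- The same estimate for the set of points with a large median, on a ball whose double is not
contained in `medianSet (T f) t`. A ball that witnesses membership in the smaller set is either
short, hence contained in the tripled ball, or long, in which case the local bound applies to its
fourfold dilate and gives a contradiction. -/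
lemma exists_medianSet_ball_bound (hn : 0 < n) (hθ : IsDiniModulus θ) {ε : ℝ≥0∞} (hε : ε ≠ 0)
    (hε' : ε ≠ ∞) :
    ∃ γ : ℝ≥0∞, γ ≠ 0 ∧ γ ≠ ∞ ∧ ∀ (f : E n → ℂ), MemLp f 2 volume → Integrable f volume →
      ∀ (c x₀ : E n) (r : ℝ) (t : ℝ≥0∞), t ≠ 0 → t ≠ ∞ →
      x₀ ∈ ball c r → maximalFn (fun y => ‖f y‖ₑ) x₀ ≤ γ * t →
      ¬ ball c (2 * r) ⊆ medianSet (T.app f) t →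
      2 * volume (ball c r ∩ medianSet (T.app f) ((1 + 4 * ε) * t)) ≤ volume (ball c r) := by
  obtain ⟨A, hA, hloc⟩ := T.exists_local_bound hn hθ
  set L : ℝ≥0∞ := 4 * 18 ^ n with hL
  have hLt : L ≠ ∞ := ENNReal.mul_ne_top (by simp) (by simp)
  have hL1 : 1 ≤ L := one_le_mul (by norm_num) (one_le_pow₀ (by norm_num))
  have hden : L * A + 1 ≠ ∞ := ENNReal.add_ne_top.2 ⟨ENNReal.mul_ne_top hLt hA, by simp⟩
  refine ⟨ε / (L * A + 1), ENNReal.div_ne_zero.2 ⟨hε, hden⟩, ENNReal.div_ne_top hε' (by simp), ?_⟩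
  intro f hf hfi c x₀ r t ht ht' hx₀ hM hnot
  set γ := ε / (L * A + 1) with hγ
  have hLAγ : L * (A * γ) ≤ ε := by
    rw [← mul_assoc]
    calc L * A * γ ≤ (L * A + 1) * γ := mul_le_mul_left le_self_add _
      _ = ε := ENNReal.mul_div_cancel (by simp) hden
  have hAγ : A * γ ≤ ε := (le_mul_of_one_le_left zero_le hL1).trans hLAγ
  have hg := T.stronglyMeasurable_app f
  have hr : 0 < r := pos_of_mem_ball hx₀
  obtain ⟨z, hz, hzΩ⟩ := not_subset.1 hnot
  set H := {y | (1 + 4 * ε) * t < ‖T.app f y‖ₑ} with hH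
  have hHm : MeasurableSet H := measurableSet_lt_enorm hg _
  -- balls through `z` have small median, because `z` is not in the median set
  have hD : ∀ (c' : E n) (r' : ℝ), z ∈ ball c' r' → x₀ ∈ ball c' r' →
      L * volume (ball c' r' ∩ H) ≤ volume (ball c' r') := by
    intro c' r' hz' hx₀'
    have h1 : 2 * volume (ball c' r' ∩ {y | t < ‖T.app f y‖ₑ}) ≤ volume (ball c' r') := by
      by_contra! hlt
      exact hzΩ ((mem_medianSet_iff hg).2 ⟨c', r', hz', hlt⟩)
    have h2 := hloc f hf hfi c' x₀ r' t ε γ ht ht' hε hε' hAγ hx₀' hM h1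
    rw [← ENNReal.mul_le_mul_iff_right hε hε']
    calc ε * (L * volume (ball c' r' ∩ H)) = L * (ε * volume (ball c' r' ∩ H)) :=
          mul_left_comm _ _ _
      _ ≤ L * (A * γ * volume (ball c' r')) := mul_le_mul_right h2 _
      _ = L * (A * γ) * volume (ball c' r') := (mul_assoc _ _ _).symm
      _ ≤ ε * volume (ball c' r') := mul_le_mul_left hLAγ _
  have hzd : dist z c < 2 * r := hz
  have hxd : dist x₀ c < r := hx₀
  -- a witnessing ball with `r' ≥ r` has a fourfold dilate that contains both `z` and `x₀`
  have hsub : ball c r ∩ medianSet (T.app f) ((1 + 4 * ε) * t) ⊆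
      {x | 1 / 2 < maximalFn ((ball c (3 * r) ∩ H).indicator 1) x} := by
    rintro y ⟨hy, hyΩ⟩
    have hyd : dist y c < r := hy
    obtain ⟨c', r', hyc', hlt⟩ := (mem_medianSet_iff hg).1 hyΩ
    have hyd' : dist y c' < r' := hyc'
    have hr' : 0 < r' := pos_of_mem_ball hyc'
    rcases le_or_gt r r' with hrr | hrr
    · exfalso
      have hcc : dist c c' < r + r' := by linarith [dist_triangle_left c c' y]
      have h1 := hD c' (4 * r') (by rw [mem_ball]; linarith [dist_triangle z c c'])
        (by rw [mem_ball]; linarith [dist_triangle x₀ c c'])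
      rw [volume_ball_mul c' c' (by norm_num) hr', ENNReal.ofReal_ofNat] at h1
      have h2 : (4 : ℝ≥0∞) ^ n * volume (ball c' r') < 4 ^ n * volume (ball c' r') := by
        calc (4 : ℝ≥0∞) ^ n * volume (ball c' r')
            < 4 ^ n * (2 * volume (ball c' r' ∩ H)) :=
              ENNReal.mul_lt_mul_right (by simp) (by simp) hlt
          _ = 4 ^ n * 2 * volume (ball c' r' ∩ H) := (mul_assoc _ _ _).symm
          _ ≤ L * volume (ball c' (4 * r') ∩ H) := by
              refine mul_le_mul' ?_ (measure_mono (inter_subset_inter_left _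
                (ball_subset_ball (by linarith))))
              have h18 : (4 : ℝ≥0∞) ≤ 18 := by norm_num
              rw [hL, mul_comm (4 : ℝ≥0∞)]
              exact mul_le_mul' (pow_le_pow_left₀ zero_le h18 n) (by norm_num)
          _ ≤ _ := h1
      exact lt_irrefl _ h2
    · refine (half_lt_maximalFn_indicator_iff (measurableSet_ball.inter hHm)).2
        ⟨c', r', hyc', hlt.trans_le (mul_le_mul_right (measure_mono ?_) _)⟩
      rintro v ⟨hv, hvH⟩
      refine ⟨hv, ?_, hvH⟩
      have hv' : dist v c' < r' := hv
      rw [mem_ball]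
      linarith [dist_triangle v c' c, dist_triangle_left c' c y]
  have h3 := hD c (3 * r) (by rw [mem_ball]; linarith) (by rw [mem_ball]; linarith)
  have hHm' : MeasurableSet (ball c (3 * r) ∩ H) := measurableSet_ball.inter hHm
  have hfin : volume (ball c (3 * r) ∩ H) ≠ ∞ :=
    ne_top_of_le_ne_top (volume_ball_ne_top c (3 * r)) (measure_mono inter_subset_left)
  have h4 := A1Measure.volume.weak_maximalFn hn (F := (ball c (3 * r) ∩ H).indicator 1)
    (aemeasurable_one.indicator hHm') (by rwa [lintegral_indicator_one hHm']) (1 / 2)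
  rw [lintegral_indicator_one hHm', one_mul, mul_one] at h4
  rw [volume_ball_mul c c (by norm_num) hr, ENNReal.ofReal_ofNat] at h3
  rw [← ENNReal.mul_le_mul_iff_right (a := 3 ^ n) (by simp) (by simp)]
  refine le_trans ?_ h3
  have h5 : volume (ball c r ∩ medianSet (T.app f) ((1 + 4 * ε) * t)) ≤
      2 * (6 ^ n * volume (ball c (3 * r) ∩ H)) := by
    calc _ ≤ volume {x | 1 / 2 < maximalFn ((ball c (3 * r) ∩ H).indicator 1) x} :=
          measure_mono hsub
      _ = 2 * (1 / 2 * volume {x | 1 / 2 < maximalFn ((ball c (3 * r) ∩ H).indicator 1) x}) := by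
          rw [← mul_assoc, ENNReal.mul_div_cancel (by simp) (by simp), one_mul]
      _ ≤ _ := mul_le_mul_right h4 2
  have h18 : (18 : ℝ≥0∞) ^ n = 3 ^ n * 6 ^ n := by rw [← mul_pow]; norm_num
  calc 3 ^ n * (2 * volume (ball c r ∩ medianSet (T.app f) ((1 + 4 * ε) * t)))
      ≤ 3 ^ n * (2 * (2 * (6 ^ n * volume (ball c (3 * r) ∩ H)))) :=
        mul_le_mul_right (mul_le_mul_right h5 _) _
    _ = L * volume (ball c (3 * r) ∩ H) := by rw [hL, h18]; ring

/-- The good-`λ` inequality, in the form of a decay of the measure of the median sets. -/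
lemma exists_goodLambda (hn : 0 < n) (hθ : IsDiniModulus θ) {μ : Measure (E n)} {C : ℝ≥0∞}
    (hμ : A1Measure μ C) {ε : ℝ≥0∞} (hε : ε ≠ 0) (hε' : ε ≠ ∞) :
    ∃ γ : ℝ≥0∞, γ ≠ 0 ∧ γ ≠ ∞ ∧ ∀ (f : E n → ℂ), MemLp f 2 volume → Integrable f volume →
      ∀ t : ℝ≥0∞, t ≠ 0 → t ≠ ∞ →
      μ (medianSet (T.app f) t) + C * 6 ^ n * (2 * C + 1) *
        μ (medianSet (T.app f) ((1 + 4 * ε) * t) \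
          {x | γ * t < maximalFn (fun y => ‖f y‖ₑ) x}) ≤
      C * 6 ^ n * (2 * C + 1) * μ (medianSet (T.app f) t) := by
  obtain ⟨γ, hγ, hγ', hball⟩ := T.exists_medianSet_ball_bound hn hθ hε hε'
  refine ⟨γ, hγ, hγ', fun f hf hfi t ht ht' => ?_⟩
  have hg := T.stronglyMeasurable_app f
  set Ω := medianSet (T.app f) t with hΩ
  set Ω' := medianSet (T.app f) ((1 + 4 * ε) * t) with hΩ'
  set M := {x | γ * t < maximalFn (fun y => ‖f y‖ₑ) x} with hM
  have hΩo : IsOpen Ω := isOpen_lt_maximalFn _ _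
  have hΩo' : IsOpen Ω' := isOpen_lt_maximalFn _ _
  have hMo : IsOpen M := isOpen_lt_maximalFn _ _
  have hXm : MeasurableSet (Ω' \ M) := hΩo'.measurableSet.diff hMo.measurableSet
  have hsub : Ω' \ M ⊆ Ω := sdiff_subset.trans (medianSet_anti _
    (le_mul_of_one_le_left zero_le le_self_add))
  have hHfin : volume {y | t < ‖T.app f y‖ₑ} ≠ ∞ := T.volume_lt_app_ne_top hf ht
  have hΩfin : volume Ω ≠ ∞ := ne_top_of_le_ne_top
    (ENNReal.mul_ne_top (by simp) (ENNReal.mul_ne_top (by simp) hHfin))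
    (A1Measure.volume.measure_medianSet_le hn hg hHfin)
  obtain ⟨R, hR⟩ := exists_radius_bound (n := n) hn hΩfin
  have hRΩ : ∀ (c : E n) (r : ℝ), ball c r ⊆ Ω → r ≤ R := fun c r h => hR c r (measure_mono h)
  have hne : Ωᶜ.Nonempty := by
    rw [nonempty_compl]
    intro h
    have := hRΩ 0 (R + 1) (h ▸ subset_univ _)
    linarith
  obtain ⟨u, huc, hdis, hu, hcov⟩ := exists_whitney_balls hΩo hne hRΩ (k := 1) le_rfl
  have := huc.to_subtype
  -- each Whitney ball loses a fixed proportion of its measure on passing to `Ω' \ M`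
  have hkey : ∀ b ∈ u, μ (ball b.1 b.2) ≤ (2 * C + 1) * μ (ball b.1 b.2 \ (Ω' \ M)) := by
    intro b hb
    obtain ⟨hb0, -, hbnot⟩ := hu b hb
    by_cases hx : ∃ x₀ ∈ ball b.1 b.2, x₀ ∉ M
    · obtain ⟨x₀, hx₀, hx₀M⟩ := hx
      have h1 := hball f hf hfi b.1 x₀ b.2 t ht ht' hx₀ (not_lt.1 hx₀M)
        (by rwa [one_add_one_eq_two] at hbnot)
      have hB0 := volume_ball_ne_zero b.1 hb0
      have hBt := volume_ball_ne_top b.1 b.2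
      have h2 : volume (ball b.1 b.2) ≤ 2 * volume (ball b.1 b.2 \ Ω') := by
        have h3 := measure_inter_add_sdiff (μ := volume) (ball b.1 b.2) hΩo'.measurableSet
        have h4 : volume (ball b.1 b.2) + volume (ball b.1 b.2) ≤
            volume (ball b.1 b.2) + 2 * volume (ball b.1 b.2 \ Ω') := by
          calc volume (ball b.1 b.2) + volume (ball b.1 b.2)
              = 2 * volume (ball b.1 b.2 ∩ Ω') + 2 * volume (ball b.1 b.2 \ Ω') := by
                rw [← mul_add, h3, two_mul]
            _ ≤ _ := add_le_add_left h1 _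
        exact (ENNReal.add_le_add_iff_left hBt).1 h4
      have h5 := hμ.measure_mul_le b.1 b.2 (measurableSet_ball.diff hΩo'.measurableSet)
        (A := ball b.1 b.2 \ Ω') sdiff_subset
      rw [← ENNReal.mul_le_mul_iff_left hB0 hBt]
      calc μ (ball b.1 b.2) * volume (ball b.1 b.2)
          ≤ μ (ball b.1 b.2) * (2 * volume (ball b.1 b.2 \ Ω')) := mul_le_mul_right h2 _
        _ = 2 * (μ (ball b.1 b.2) * volume (ball b.1 b.2 \ Ω')) := mul_left_comm _ _ _
        _ ≤ 2 * (C * volume (ball b.1 b.2) * μ (ball b.1 b.2 \ Ω')) := mul_le_mul_right h5 _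
        _ = 2 * C * μ (ball b.1 b.2 \ Ω') * volume (ball b.1 b.2) := by ring
        _ ≤ (2 * C + 1) * μ (ball b.1 b.2 \ (Ω' \ M)) * volume (ball b.1 b.2) := by
            refine mul_le_mul_left (mul_le_mul' le_self_add (measure_mono ?_)) _
            exact sdiff_subset_sdiff_right sdiff_subset
    · push Not at hx
      have : ball b.1 b.2 \ (Ω' \ M) = ball b.1 b.2 := by
        ext y
        refine ⟨fun h => h.1, fun h => ⟨h, fun h' => h'.2 (hx y h)⟩⟩
      rw [this]
      exact le_mul_of_one_le_left zero_le le_add_self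
  have h1 : μ Ω ≤ C * 6 ^ n * (2 * C + 1) * μ (Ω \ (Ω' \ M)) := by
    have h2 : μ Ω ≤ ∑' b : u, μ (ball b.1.1 (6 * b.1.2)) :=
      (measure_mono hcov).trans (measure_biUnion_le μ huc _)
    have h3 : ∀ b : u, μ (ball b.1.1 (6 * b.1.2)) ≤
        C * 6 ^ n * (2 * C + 1) * μ (ball b.1.1 b.1.2 \ (Ω' \ M)) := by
      intro b
      have h4 := hμ.doubling_self b.1.1 (k := 6) (by norm_num) (hu b.1 b.2).1
      rw [ENNReal.ofReal_ofNat] at h4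
      refine h4.trans ?_
      rw [mul_assoc (C * 6 ^ n)]
      exact mul_le_mul_right (hkey b.1 b.2) _
    refine h2.trans ((ENNReal.tsum_le_tsum h3).trans ?_)
    rw [ENNReal.tsum_mul_left]
    refine mul_le_mul_right ?_ _
    rw [← measure_iUnion]
    · refine measure_mono (iUnion_subset fun b => sdiff_subset_sdiff_left ?_)
      have := (hu b.1 b.2).2.1
      rwa [one_mul] at this
    · intro a b hab
      exact (hdis a.2 b.2 fun h => hab (Subtype.ext h)).mono sdiff_subset sdiff_subset
    · exact fun b => measurableSet_ball.diff hXm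
  calc μ Ω + C * 6 ^ n * (2 * C + 1) * μ (Ω' \ M)
      ≤ C * 6 ^ n * (2 * C + 1) * μ (Ω \ (Ω' \ M)) +
          C * 6 ^ n * (2 * C + 1) * μ (Ω' \ M) := add_le_add_left h1 _
    _ = C * 6 ^ n * (2 * C + 1) * (μ (Ω ∩ (Ω' \ M)) + μ (Ω \ (Ω' \ M))) := by
        rw [← mul_add, add_comm (μ (Ω \ _)), inter_eq_self_of_subset_right hsub]
    _ = _ := by rw [measure_inter_add_sdiff Ω hXm]

end ThetaCZO

/-! ### The weighted weak type inequality -/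

lemma A1Measure.one_le {n : ℕ} {μ : Measure (E n)} {C : ℝ≥0∞} (h : A1Measure μ C) : 1 ≤ C := by
  have h1 := h.le 0 1 1 aemeasurable_one
  simp only [Pi.one_apply, setLIntegral_one] at h1
  have hv0 := volume_ball_ne_zero (0 : E n) one_pos
  have hvt := volume_ball_ne_top (0 : E n) 1
  have hμ0 := h.ball_ne_zero 0 one_pos
  have hμt := h.ball_ne_top 0 1
  rw [← ENNReal.mul_le_mul_iff_left hv0 hvt, ← ENNReal.mul_le_mul_iff_left hμ0 hμt]
  calc 1 * MeasureTheory.volume (ball (0 : E n) 1) * μ (ball 0 1)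
      = μ (ball 0 1) * MeasureTheory.volume (ball (0 : E n) 1) := by rw [one_mul, mul_comm]
    _ ≤ _ := h1

/-- A bounded solution of `s k ≤ a + q s (k + 1)` with `q < 1` is bounded by the sum of the
geometric series. Without an a priori bound the recursion towards increasing `k` says nothing. -/
lemma le_of_le_add_mul_succ {s : ℕ → ℝ≥0∞} {a q M : ℝ≥0∞} (hM : M ≠ ∞) (hs : ∀ k, s k ≤ M)
    (hq : q < 1) (h : ∀ k, s k ≤ a + q * s (k + 1)) : s 0 ≤ (1 - q)⁻¹ * a := by
  set S := ⨆ k, s k with hS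
  have hSt : S ≠ ∞ := ne_top_of_le_ne_top hM (iSup_le hs)
  have h1 : S ≤ a + q * S := iSup_le fun k =>
    (h k).trans (add_le_add_right (mul_le_mul_right (le_iSup s (k + 1)) q) a)
  have h2 : (1 - q) * S + q * S ≤ a + q * S := by
    rwa [← add_mul, tsub_add_cancel_of_le hq.le, one_mul]
  have h3 : (1 - q) * S ≤ a :=
    (ENNReal.add_le_add_iff_right (ENNReal.mul_ne_top (hq.trans ENNReal.one_lt_top).ne hSt)).1 h2
  have hq0 : 1 - q ≠ 0 := (tsub_pos_of_lt hq).ne'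
  have hqt : 1 - q ≠ ∞ := (tsub_le_self.trans_lt ENNReal.one_lt_top).ne
  refine (le_iSup s 0).trans ?_
  calc S = (1 - q)⁻¹ * ((1 - q) * S) := by
        rw [← mul_assoc, ENNReal.inv_mul_cancel hq0 hqt, one_mul]
    _ ≤ _ := mul_le_mul_right h3 _

lemma integrable_of_memLp_of_ball {n : ℕ} {f : E n → ℂ} (hf : MemLp f 2 volume) {R : ℝ}
    (h0 : ∀ y ∉ ball (0 : E n) R, f y = 0) : Integrable f volume := by
  have h1 : IntegrableOn f (ball 0 R) volume := by
    have : IsFiniteMeasure (volume.restrict (ball (0 : E n) R)) :=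
      ⟨by rw [Measure.restrict_apply_univ]; exact measure_ball_lt_top⟩
    exact (hf.restrict _).integrable (by norm_num)
  refine (integrableOn_iff_integrable_of_support_subset ?_).1 h1
  intro y hy
  by_contra hcon
  exact hy (h0 y hcon)

namespace ThetaCZO

variable {n : ℕ} {θ : ℝ → ℝ} (T : ThetaCZO n θ)

/-- For a function supported in a ball, the size condition on the kernel bounds the level sets of
its image, so that `t μ {|T f| > t}` stays bounded as `t → 0`. -/
lemma exists_apriori_bound (hn : 0 < n) {μ : Measure (E n)} {C : ℝ≥0∞}
    (hμ : A1Measure μ C) {f : E n → ℂ} (hf : MemLp f 2 volume) {R : ℝ} (hR : 0 < R)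
    (h0 : ∀ y ∉ ball (0 : E n) R, f y = 0) {t₀ : ℝ≥0∞} (ht₀ : t₀ ≠ ∞) :
    ∃ M : ℝ≥0∞, M ≠ ∞ ∧ ∀ t, t ≠ 0 → t ≤ t₀ → t * μ {x | t < ‖T.app f x‖ₑ} ≤ M := by
  have hfi := integrable_of_memLp_of_ball hf h0
  have hK := T.kernelConst_pos
  set Z : ℝ := T.kernelConst * 2 ^ n * ∫ y, ‖f y‖ with hZ
  have hI0 : 0 ≤ ∫ y, ‖f y‖ := integral_nonneg fun _ => norm_nonneg _
  have hZ0 : 0 ≤ Z := by positivity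
  have hdecay : ∀ᵐ x ∂(volume : Measure (E n)), 2 * R ≤ ‖x‖ → ‖T.app f x‖ * ‖x‖ ^ n ≤ Z := by
    filter_upwards [T.app_eq_integral hn hf (isClosed_closedBall (x := 0) (ε := R))
      fun y hy => h0 y fun h => hy (ball_subset_closedBall h)] with x hx hxR
    have hx0 : 0 < ‖x‖ := by linarith
    rw [hx (by rw [mem_closedBall, dist_zero_right]; linarith)]
    have hb : ‖∫ y, T.kernel x y * f y‖ ≤ ∫ y, T.kernelConst * 2 ^ n / ‖x‖ ^ n * ‖f y‖ := by
      refine norm_integral_le_of_norm_le (hfi.norm.const_mul _) (Eventually.of_forall fun y => ?_)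
      by_cases hy : y ∈ ball (0 : E n) R
      · rw [norm_mul]
        refine mul_le_mul_of_nonneg_right ?_ (norm_nonneg _)
        rw [mem_ball, dist_zero_right] at hy
        have hxy : ‖x‖ / 2 ≤ ‖x - y‖ := by linarith [norm_sub_norm_le x y]
        refine (T.norm_kernel_le_of_le (half_pos hx0) hxy).trans (le_of_eq ?_)
        rw [div_pow]; field_simp
      · simp [h0 y hy]
    rw [integral_const_mul] at hb
    calc _ ≤ T.kernelConst * 2 ^ n / ‖x‖ ^ n * (∫ y, ‖f y‖) * ‖x‖ ^ n := by gcongr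
      _ = Z := by rw [hZ]; field_simp
  set W : ℝ := (2 * R) ^ n + 1 with hW
  have hW0 : 0 < W := by positivity
  refine ⟨C * μ (ball 0 1) * (t₀ * ENNReal.ofReal W + ENNReal.ofReal Z), ?_, fun t ht ht' => ?_⟩
  · exact ENNReal.mul_ne_top (ENNReal.mul_ne_top hμ.ne_top (hμ.ball_ne_top _ _))
      (ENNReal.add_ne_top.2 ⟨ENNReal.mul_ne_top ht₀ ENNReal.ofReal_ne_top, ENNReal.ofReal_ne_top⟩)
  have htt : t ≠ ∞ := ne_top_of_le_ne_top ht₀ ht'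
  set s : ℝ := t.toReal with hs
  have hs0 : 0 < s := ENNReal.toReal_pos ht htt
  have hst : ENNReal.ofReal s = t := ENNReal.ofReal_toReal htt
  have hX0 : 0 ≤ Z / s := by positivity
  set ρ : ℝ := (W + Z / s) ^ ((n : ℝ)⁻¹) with hρ
  have hρn : ρ ^ n = W + Z / s := Real.rpow_inv_natCast_pow (by positivity) hn.ne'
  have hρ0 : 0 ≤ ρ := by positivity
  have hρ1 : 1 ≤ ρ := by
    refine Real.one_le_rpow ?_ (by positivity)
    have : 0 ≤ (2 * R) ^ n := by positivity
    rw [hW]; linarith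
  have hsub : {x | t < ‖T.app f x‖ₑ} ≤ᵐ[volume] (ball (0 : E n) ρ : Set (E n)) := by
    filter_upwards [hdecay] with x hx hxt
    have hxt : t < ‖T.app f x‖ₑ := hxt
    have hxs : s < ‖T.app f x‖ := by
      rw [← hst, ← ofReal_norm, ENNReal.ofReal_lt_ofReal_iff_of_nonneg hs0.le] at hxt
      exact hxt
    change x ∈ ball (0 : E n) ρ
    rw [mem_ball, dist_zero_right]
    refine lt_of_pow_lt_pow_left₀ n hρ0 ?_
    rw [hρn]
    rcases lt_or_ge ‖x‖ (2 * R) with h | h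
    · have : ‖x‖ ^ n ≤ (2 * R) ^ n := pow_le_pow_left₀ (norm_nonneg _) h.le n
      rw [hW]; linarith
    · have h1 := hx h
      have h2 : s * ‖x‖ ^ n ≤ Z :=
        (mul_le_mul_of_nonneg_right hxs.le (by positivity)).trans h1
      have h3 : ‖x‖ ^ n ≤ Z / s := by rw [le_div_iff₀ hs0]; linarith
      linarith
  have hμsub : μ {x | t < ‖T.app f x‖ₑ} ≤ C * ENNReal.ofReal (W + Z / s) * μ (ball 0 1) := by
    refine (measure_mono_ae (hμ.ac.ae_le hsub)).trans ?_
    have := hμ.doubling_self (0 : E n) hρ1 one_pos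
    rwa [mul_one, ← ENNReal.ofReal_pow hρ0, hρn] at this
  calc t * μ {x | t < ‖T.app f x‖ₑ}
      ≤ t * (C * ENNReal.ofReal (W + Z / s) * μ (ball 0 1)) := mul_le_mul_right hμsub _
    _ = C * μ (ball 0 1) * (t * ENNReal.ofReal W + t * ENNReal.ofReal (Z / s)) := by
        rw [ENNReal.ofReal_add hW0.le hX0]; ring
    _ = C * μ (ball 0 1) * (t * ENNReal.ofReal W + ENNReal.ofReal Z) := by
        rw [← hst, ← ENNReal.ofReal_mul hs0.le (q := Z / s), mul_div_cancel₀ _ hs0.ne']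
    _ ≤ _ := by gcongr

/-- The weak type `(1, 1)` inequality with respect to an `A₁` measure, for functions in `L²` with
bounded support. The good-`λ` inequality is iterated towards level zero; the step `1 + 4 ε` between
levels is so close to `1` that the product `t μ (medianSet (T f) t)` contracts. -/
lemma exists_weak_type_of_ball (hn : 0 < n) (hθ : IsDiniModulus θ) {μ : Measure (E n)} {C : ℝ≥0∞}
    (hμ : A1Measure μ C) :
    ∃ A : ℝ≥0∞, A ≠ 0 ∧ A ≠ ∞ ∧ ∀ (f : E n → ℂ) (R : ℝ), MemLp f 2 volume → 0 < R →
      (∀ y ∉ ball (0 : E n) R, f y = 0) → ∀ t : ℝ≥0∞,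
      t * μ {x | t < ‖T.app f x‖ₑ} ≤ A * ∫⁻ y, ‖f y‖ₑ ∂μ := by
  have hC1 := hμ.one_le
  set D : ℝ≥0∞ := C * 6 ^ n * (2 * C + 1) with hD
  have hDt : D ≠ ∞ := ENNReal.mul_ne_top (ENNReal.mul_ne_top hμ.ne_top (by simp))
    (ENNReal.add_ne_top.2 ⟨ENNReal.mul_ne_top (by simp) hμ.ne_top, by simp⟩)
  have hD1 : 1 ≤ D := one_le_mul (one_le_mul hC1 (one_le_pow₀ (by norm_num))) le_add_self
  have hD0 : D ≠ 0 := (zero_lt_one.trans_le hD1).ne'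
  set d : ℝ≥0∞ := D⁻¹ with hd
  have hd0 : d ≠ 0 := ENNReal.inv_ne_zero.2 hDt
  have hd1 : d ≤ 1 := ENNReal.inv_le_one.2 hD1
  have hdt : d ≠ ∞ := (hd1.trans_lt ENNReal.one_lt_top).ne
  set ε : ℝ≥0∞ := d / 4 with hε
  have h4ε : 4 * ε = d := ENNReal.mul_div_cancel (by simp) (by simp)
  obtain ⟨γ, hγ, hγ', hgood⟩ := T.exists_goodLambda hn hθ hμ (ε := ε)
    (ENNReal.div_ne_zero.2 ⟨hd0, by simp⟩) (ENNReal.div_ne_top hdt (by simp))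
  rw [h4ε] at hgood
  have h1d : 1 - d < 1 := ENNReal.sub_lt_self (by simp) (by simp) hd0
  set q : ℝ≥0∞ := (1 + d) * (1 - d) with hq
  -- `q = 1 - d²`
  have hq1 : q < 1 := by
    calc q = (1 - d) + d * (1 - d) := by rw [hq, add_mul, one_mul]
      _ < (1 - d) + d := by
          refine ENNReal.add_lt_add_left (h1d.trans ENNReal.one_lt_top).ne ?_
          calc d * (1 - d) < d * 1 := ENNReal.mul_lt_mul_right hd0 hdt h1d
            _ = d := mul_one d
      _ = 1 := tsub_add_cancel_of_le hd1
  set A₁ : ℝ≥0∞ := (1 + d) * (γ⁻¹ * (C * 6 ^ n * C)) with hA₁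
  have hA₁t : A₁ ≠ ∞ := ENNReal.mul_ne_top (ENNReal.add_ne_top.2 ⟨by simp, hdt⟩)
    (ENNReal.mul_ne_top (ENNReal.inv_ne_top.2 hγ)
      (ENNReal.mul_ne_top (ENNReal.mul_ne_top hμ.ne_top (by simp)) hμ.ne_top))
  have hqinv : (1 - q)⁻¹ ≠ ∞ := ENNReal.inv_ne_top.2 (tsub_pos_of_lt hq1).ne'
  refine ⟨(1 - q)⁻¹ * A₁ + 1, by simp, ENNReal.add_ne_top.2
    ⟨ENNReal.mul_ne_top hqinv hA₁t, by simp⟩, fun f R hf hR h0 t => ?_⟩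
  rcases eq_or_ne t 0 with rfl | ht
  · simp
  rcases eq_or_ne t ∞ with rfl | ht'
  · simp
  have hfi := integrable_of_memLp_of_ball hf h0
  have hg := T.stronglyMeasurable_app f
  set I := ∫⁻ y, ‖f y‖ₑ ∂μ with hI
  -- the good-`λ` inequality between the levels `τ` and `(1 + d) τ`
  have hstep : ∀ τ : ℝ≥0∞, τ ≠ 0 → τ ≠ ∞ →
      (1 + d) * τ * μ (medianSet (T.app f) ((1 + d) * τ)) ≤
        A₁ * I + q * (τ * μ (medianSet (T.app f) τ)) := by
    intro τ hτ hτ'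
    set Ω := medianSet (T.app f) τ with hΩ
    set Ω' := medianSet (T.app f) ((1 + d) * τ) with hΩ'
    set M := {x | γ * τ < maximalFn (fun y => ‖f y‖ₑ) x} with hM
    have hHfin : volume {y | τ < ‖T.app f y‖ₑ} ≠ ∞ := T.volume_lt_app_ne_top hf hτ
    have hΩfin : μ Ω ≠ ∞ := by
      obtain ⟨B, hB, hbound⟩ := T.exists_apriori_bound hn hμ hf hR h0 hτ'
      have h1 := hbound τ hτ le_rfl
      have h2 : μ {x | τ < ‖T.app f x‖ₑ} ≠ ∞ := by
        intro h
        rw [h, ENNReal.mul_top hτ] at h1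
        exact hB (top_le_iff.1 h1)
      exact ne_top_of_le_ne_top (ENNReal.mul_ne_top (by simp) (ENNReal.mul_ne_top
        (ENNReal.mul_ne_top (ENNReal.mul_ne_top hμ.ne_top (by simp)) hμ.ne_top) h2))
        (hμ.measure_medianSet_le hn hg hHfin)
    have h1 : μ (Ω' \ M) ≤ (1 - d) * μ Ω := by
      have h2 : d * (μ Ω + D * μ (Ω' \ M)) ≤ d * (D * μ Ω) :=
        mul_le_mul_right (hgood f hf hfi τ hτ hτ') d
      have hdD : d * D = 1 := ENNReal.inv_mul_cancel hD0 hDt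
      rw [mul_add, ← mul_assoc d D, ← mul_assoc d D, hdD, one_mul, one_mul] at h2
      have h3 : d * μ Ω + μ (Ω' \ M) ≤ d * μ Ω + (1 - d) * μ Ω := by
        rwa [← add_mul, add_tsub_cancel_of_le hd1, one_mul]
      exact (ENNReal.add_le_add_iff_left (ENNReal.mul_ne_top hdt hΩfin)).1 h3
    have h2 : τ * μ M ≤ γ⁻¹ * (C * 6 ^ n * C) * I := by
      have h3 := mul_le_mul_right (hμ.weak_maximalFn hn hfi.1.enorm hfi.2.ne (γ * τ)) γ⁻¹
      rwa [mul_assoc γ, ← mul_assoc, ENNReal.inv_mul_cancel hγ hγ', one_mul, ← mul_assoc] at h3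
    have h3 : μ Ω' ≤ μ M + μ (Ω' \ M) := by
      refine (measure_mono fun x hx => ?_).trans (measure_union_le _ _)
      by_cases hxM : x ∈ M
      · exact Or.inl hxM
      · exact Or.inr ⟨hx, hxM⟩
    calc (1 + d) * τ * μ Ω' ≤ (1 + d) * τ * (μ M + (1 - d) * μ Ω) :=
          mul_le_mul_right (h3.trans (add_le_add_right h1 _)) _
      _ = (1 + d) * (τ * μ M) + q * (τ * μ Ω) := by rw [hq]; ring
      _ ≤ (1 + d) * (γ⁻¹ * (C * 6 ^ n * C) * I) + q * (τ * μ Ω) :=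
          add_le_add_left (mul_le_mul_right h2 _) _
      _ = _ := by rw [hA₁]; ring
  -- the levels `t (1 + d)⁻ᵏ`
  have h1d0 : 1 + d ≠ 0 := by simp
  have h1dt : 1 + d ≠ ∞ := ENNReal.add_ne_top.2 ⟨by simp, hdt⟩
  set τ : ℕ → ℝ≥0∞ := fun k => t * ((1 + d)⁻¹) ^ k with hτ
  have hτ0 : ∀ k, τ k ≠ 0 := fun k =>
    mul_ne_zero ht (pow_ne_zero k (ENNReal.inv_ne_zero.2 h1dt))
  have hτt : ∀ k, τ k ≤ t := fun k => mul_le_of_le_one_right zero_le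
    (pow_le_one₀ zero_le (ENNReal.inv_le_one.2 le_self_add))
  have hτs : ∀ k, (1 + d) * τ (k + 1) = τ k := fun k => by
    simp only [hτ]
    rw [pow_succ, mul_left_comm, mul_comm _ (1 + d)⁻¹, ← mul_assoc (1 + d),
      ENNReal.mul_inv_cancel h1d0 h1dt, one_mul]
  obtain ⟨M, hM, hbound⟩ := T.exists_apriori_bound hn hμ hf hR h0 ht'
  have hiter := le_of_le_add_mul_succ (s := fun k => τ k * μ (medianSet (T.app f) (τ k)))
    (a := A₁ * I) (q := q) (M := 2 * (C * 6 ^ n * C * M))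
    (ENNReal.mul_ne_top (by simp) (ENNReal.mul_ne_top
      (ENNReal.mul_ne_top (ENNReal.mul_ne_top hμ.ne_top (by simp)) hμ.ne_top) hM))
    (fun k => by
      refine (mul_le_mul_right (hμ.measure_medianSet_le hn hg
        (T.volume_lt_app_ne_top hf (hτ0 k))) (τ k)).trans ?_
      rw [mul_left_comm, mul_left_comm (τ k)]
      exact mul_le_mul_right (mul_le_mul_right (hbound _ (hτ0 k) (hτt k)) _) _)
    hq1 (fun k => by
      have := hstep (τ (k + 1)) (hτ0 _) (ne_top_of_le_ne_top ht' (hτt _))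
      rwa [hτs k] at this)
  have hτ00 : τ 0 = t := by simp [hτ]
  rw [hτ00] at hiter
  have hH : μ {x | t < ‖T.app f x‖ₑ} ≤ μ (medianSet (T.app f) t) :=
    measure_mono_ae (hμ.ac.ae_le (ae_mem_medianSet hg (T.volume_lt_app_ne_top hf ht)))
  calc t * μ {x | t < ‖T.app f x‖ₑ} ≤ t * μ (medianSet (T.app f) t) := mul_le_mul_right hH _
    _ ≤ (1 - q)⁻¹ * (A₁ * I) := hiter
    _ = (1 - q)⁻¹ * A₁ * I := (mul_assoc _ _ _).symm
    _ ≤ _ := mul_le_mul_left le_self_add _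

end ThetaCZO

/-- Fatou's lemma for the distribution function. -/
lemma measure_lt_enorm_le_liminf {α : Type*} [MeasurableSpace α] {μ : Measure α}
    {g : ℕ → α → ℂ} {h : α → ℂ} (hg : ∀ k, AEStronglyMeasurable (g k) μ)
    (hlim : ∀ᵐ x ∂μ, Tendsto (fun k => g k x) atTop (𝓝 (h x))) (t : ℝ≥0∞) :
    μ {x | t < ‖h x‖ₑ} ≤ liminf (fun k => μ {x | t < ‖g k x‖ₑ}) atTop := by
  have hm : ∀ k, NullMeasurableSet {x | t < ‖g k x‖ₑ} μ := fun k =>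
    nullMeasurableSet_lt aemeasurable_const (hg k).enorm
  calc μ {x | t < ‖h x‖ₑ} = ∫⁻ x, {x | t < ‖h x‖ₑ}.indicator 1 x ∂μ := by
        have hh : AEStronglyMeasurable h μ := aestronglyMeasurable_of_tendsto_ae atTop hg hlim
        rw [lintegral_indicator_one₀ (nullMeasurableSet_lt aemeasurable_const hh.enorm)]
    _ ≤ ∫⁻ x, liminf (fun k => {x | t < ‖g k x‖ₑ}.indicator 1 x) atTop ∂μ := by
        refine lintegral_mono_ae ?_
        filter_upwards [hlim] with x hx
        by_cases hxt : t < ‖h x‖ₑ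
        · have hev : ∀ᶠ k in atTop, t < ‖g k x‖ₑ :=
            hx.enorm.eventually_const_lt hxt
          refine le_liminf_of_le (by isBoundedDefault) ?_
          filter_upwards [hev] with k hk
          rw [indicator_of_mem (show x ∈ {x | t < ‖g k x‖ₑ} from hk)]
          exact indicator_le_self' (fun _ _ => zero_le) x
        · rw [indicator_of_notMem (show x ∉ {x | t < ‖h x‖ₑ} from hxt)]
          exact zero_le
    _ ≤ liminf (fun k => ∫⁻ x, {x | t < ‖g k x‖ₑ}.indicator 1 x ∂μ) atTop :=
        lintegral_liminf_le' fun k => (aemeasurable_one.indicator₀ (hm k))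
    _ = _ := by simp_rw [lintegral_indicator_one₀ (hm _)]

lemma tendsto_eLpNorm_indicator_ball_sub {n : ℕ} {f : E n → ℂ} (hf : MemLp f 2 volume) :
    Tendsto (fun k : ℕ => eLpNorm ((ball (0 : E n) (k + 1)).indicator f - f) 2 volume)
      atTop (𝓝 0) := by
  have h2 : ∫⁻ x, ‖f x‖ₑ ^ 2 ≠ ∞ := by
    have := hf.eLpNorm_lt_top
    rw [eLpNorm_lt_top_iff_lintegral_rpow_enorm_lt_top (by simp) (by simp)] at this
    simpa using this.ne
  have h3 : Tendsto (fun k : ℕ => ∫⁻ x, ‖((ball (0 : E n) (k + 1)).indicator f - f) x‖ₑ ^ 2)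
      atTop (𝓝 (∫⁻ _ : E n, 0)) := by
    refine tendsto_lintegral_of_dominated_convergence' (fun x => ‖f x‖ₑ ^ 2) (fun k => ?_)
      (fun k => Eventually.of_forall fun x => ?_) h2 (Eventually.of_forall fun x => ?_)
    · exact (((hf.1.indicator measurableSet_ball).sub hf.1).enorm).pow_const 2
    · refine pow_le_pow_left₀ zero_le ?_ 2
      by_cases hx : x ∈ ball (0 : E n) (k + 1) <;> simp [hx]
    · refine tendsto_const_nhds.congr' ?_
      obtain ⟨m, hm⟩ := exists_nat_gt ‖x‖
      filter_upwards [eventually_ge_atTop m] with k hk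
      have hx : x ∈ ball (0 : E n) (k + 1) := by
        rw [mem_ball, dist_zero_right]
        have : (m : ℝ) ≤ k := by exact_mod_cast hk
        linarith
      rw [Pi.sub_apply, indicator_of_mem hx, sub_self]
      simp
  rw [lintegral_zero] at h3
  have h4 := (ENNReal.continuous_rpow_const (y := (1 / 2 : ℝ))).tendsto 0 |>.comp h3
  rw [ENNReal.zero_rpow_of_pos (by norm_num)] at h4
  refine h4.congr fun k => ?_
  rw [eLpNorm_eq_lintegral_rpow_enorm_toReal (by simp) (by simp)]
  simp

/-- The weak type `(1, 1)` inequality with respect to an `A₁` measure, on all of `L²`. -/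
theorem ThetaCZO.exists_weak_type {n : ℕ} {θ : ℝ → ℝ} (T : ThetaCZO n θ) (hn : 0 < n)
    (hθ : IsDiniModulus θ) {μ : Measure (E n)} {C : ℝ≥0∞} (hμ : A1Measure μ C) :
    ∃ A : ℝ≥0∞, A ≠ 0 ∧ A ≠ ∞ ∧ ∀ f : E n → ℂ, MemLp f 2 volume → ∀ t : ℝ≥0∞,
      t * μ {x | t < ‖T.app f x‖ₑ} ≤ A * ∫⁻ y, ‖f y‖ₑ ∂μ := by
  obtain ⟨A, hA0, hA, hbound⟩ := T.exists_weak_type_of_ball hn hθ hμ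
  refine ⟨A, hA0, hA, fun f hf t => ?_⟩
  rcases eq_or_ne t 0 with rfl | ht
  · simp
  rcases eq_or_ne t ∞ with rfl | ht'
  · simp
  set φ : ℕ → E n → ℂ := fun k => (ball (0 : E n) (k + 1)).indicator f with hφ
  have hφm : ∀ k, MemLp (φ k) 2 volume := fun k => hf.indicator measurableSet_ball
  obtain ⟨ns, -, hlim⟩ := T.exists_seq_tendsto_app hf hφm (tendsto_eLpNorm_indicator_ball_sub hf)
  have h1 := measure_lt_enorm_le_liminf
    (fun k => (T.stronglyMeasurable_app (φ (ns k))).aestronglyMeasurable)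
    (hμ.ac.ae_le hlim) t
  have h2 : ∀ k, μ {x | t < ‖T.app (φ (ns k)) x‖ₑ} ≤ A * (∫⁻ y, ‖f y‖ₑ ∂μ) / t := by
    intro k
    rw [ENNReal.le_div_iff_mul_le (Or.inl ht) (Or.inl ht'), mul_comm]
    refine (hbound (φ (ns k)) (ns k + 1) (hφm _) (by positivity)
      (fun y hy => indicator_of_notMem hy f) t).trans (mul_le_mul_right ?_ _)
    refine lintegral_mono fun y => ?_
    simp only [hφ]
    rw [enorm_indicator_eq_indicator_enorm]
    exact indicator_le_self _ _ _
  have h3 : μ {x | t < ‖T.app f x‖ₑ} ≤ A * (∫⁻ y, ‖f y‖ₑ ∂μ) / t :=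
    h1.trans (liminf_le_of_le (by isBoundedDefault) fun b hb => by
      obtain ⟨k, hk⟩ := hb.exists
      exact hk.trans (h2 k))
  rw [ENNReal.le_div_iff_mul_le (Or.inl ht) (Or.inl ht'), mul_comm] at h3
  exact h3

/-! ### The measure of an `A₁` weight -/

/-- The `A₁` condition on `w` gives the integrated form, by `ess inf_B w · ∫_B F ≤ ∫_B F w`. -/
lemma IsA1.exists_a1Measure {n : ℕ} {w : E n → ℝ} (hw : IsA1 w) :
    ∃ C : ℝ≥0∞, A1Measure (wMeasure w) C := by
  obtain ⟨C, hC, hbound⟩ := hw.bound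
  have hwm : AEMeasurable (fun x => ENNReal.ofReal (w x)) volume :=
    hw.isWeight.locallyIntegrable.aestronglyMeasurable.aemeasurable.ennreal_ofReal
  refine ⟨ENNReal.ofReal C, ENNReal.ofReal_ne_top, fun c r => ?_, fun c r F hF => ?_,
    withDensity_absolutelyContinuous _ _, withDensity_absolutelyContinuous' hwm ?_⟩
  · rw [wMeasure, withDensity_apply _ measurableSet_ball]
    have h1 : IntegrableOn w (ball c r) volume :=
      (hw.isWeight.locallyIntegrable.integrableOn_isCompact
        (isCompact_closedBall c r)).mono_set ball_subset_closedBall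
    refine ne_top_of_le_ne_top h1.2.ne (lintegral_mono fun x => ?_)
    exact Real.ofReal_le_enorm _
  · rcases le_or_gt r 0 with hr | hr
    · simp [ball_eq_empty.2 hr]
    set e := essInf (fun x => ENNReal.ofReal (w x)) (volume.restrict (ball c r)) with he
    have h1 : wMeasure w (ball c r) ≤ ENNReal.ofReal C * e * volume (ball c r) := by
      have h2 := hbound c r hr
      rw [ENNReal.div_le_iff (volume_ball_ne_zero c hr) (volume_ball_ne_top c r)] at h2
      rwa [wMeasure, withDensity_apply _ measurableSet_ball]
    have h3 : e * ∫⁻ y in ball c r, F y ≤ ∫⁻ y in ball c r, F y ∂(wMeasure w) := by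
      rw [wMeasure, restrict_withDensity measurableSet_ball,
        lintegral_withDensity_eq_lintegral_mul₀ hwm.restrict hF.restrict]
      refine (lintegral_const_mul_le _ _).trans (lintegral_mono_ae ?_)
      filter_upwards [ae_essInf_le (f := fun x => ENNReal.ofReal (w x))
        (μ := volume.restrict (ball c r))] with y hy
      exact mul_le_mul_left hy _
    calc wMeasure w (ball c r) * ∫⁻ y in ball c r, F y
        ≤ ENNReal.ofReal C * e * volume (ball c r) * ∫⁻ y in ball c r, F y :=
          mul_le_mul_left h1 _
      _ = ENNReal.ofReal C * volume (ball c r) * (e * ∫⁻ y in ball c r, F y) := by ring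
      _ ≤ _ := mul_le_mul_right h3 _
  · filter_upwards [hw.isWeight.pos] with x hx
    simpa using hx

/-! ### The extension of the operator to weighted `L¹` -/

/-- Approximation in `L¹(μ)` by square integrable truncations of the given function. -/
lemma exists_truncations {n : ℕ} {μ : Measure (E n)} (hac : volume ≪ μ)
    {u : E n → ℂ} (hu : Integrable u μ) :
    ∃ S : ℕ → Set (E n), (∀ k, MemLp ((S k).indicator u) 2 volume) ∧
      (∀ x, ∀ᶠ k in atTop, x ∈ S k) ∧
      Tendsto (fun k => ∫⁻ x, ‖(S k).indicator u x - u x‖ₑ ∂μ) atTop (𝓝 0) := by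
  set v := hu.1.mk u with hv
  have hvm : StronglyMeasurable v := hu.1.stronglyMeasurable_mk
  have huv : u =ᵐ[μ] v := hu.1.ae_eq_mk
  set S : ℕ → Set (E n) := fun k => ball 0 (k + 1) ∩ {x | ‖v x‖ ≤ k} with hS
  have hSm : ∀ k, MeasurableSet (S k) := fun k =>
    measurableSet_ball.inter (measurableSet_le hvm.norm.measurable measurable_const)
  have hev : ∀ x, ∀ᶠ k in atTop, x ∈ S k := by
    intro x
    obtain ⟨m, hm⟩ := exists_nat_gt (max ‖x‖ ‖v x‖)
    filter_upwards [eventually_ge_atTop m] with k hk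
    have h1 : (m : ℝ) ≤ k := by exact_mod_cast hk
    have h2 := le_max_left ‖x‖ ‖v x‖
    have h3 := le_max_right ‖x‖ ‖v x‖
    refine ⟨?_, show ‖v x‖ ≤ k by linarith⟩
    rw [mem_ball, dist_zero_right]
    linarith
  have huvol : AEStronglyMeasurable u volume := hu.1.mono_ac hac
  refine ⟨S, fun k => ?_, hev, ?_⟩
  · have : IsFiniteMeasure (volume.restrict (S k)) := ⟨by
      rw [Measure.restrict_apply_univ]
      exact (measure_mono inter_subset_left).trans_lt measure_ball_lt_top⟩
    rw [memLp_indicator_iff_restrict (hSm k)]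
    refine MemLp.of_bound huvol.restrict k ?_
    rw [ae_restrict_iff' (hSm k)]
    filter_upwards [hac.ae_le huv] with x hx hxS
    rw [hx]
    exact hxS.2
  · have h := tendsto_lintegral_of_dominated_convergence' (μ := μ)
      (F := fun k x => ‖(S k).indicator u x - u x‖ₑ) (f := fun _ => 0) (fun x => ‖u x‖ₑ)
      (fun k => ((hu.1.indicator (hSm k)).sub hu.1).enorm)
      (fun k => Eventually.of_forall fun x => ?_) hu.2.ne (Eventually.of_forall fun x => ?_)
    · simpa using h
    · by_cases hx : x ∈ S k <;> simp [hx]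
    · refine tendsto_const_nhds.congr' ?_
      filter_upwards [hev x] with k hk
      simp [hk]

namespace ThetaCZO

variable {n : ℕ} {θ : ℝ → ℝ} (T : ThetaCZO n θ)

/-- A quantitative form of `IsL1Value`: the distance in weak `L¹` from `h` to the image of any
`φ ∈ L²` is controlled by the distance from `u` to `φ` in `L¹(μ)`. -/
structure WeakApprox (μ : Measure (E n)) (A : ℝ≥0∞) (u h : E n → ℂ) : Prop where
  aesm : AEStronglyMeasurable h volume
  bound : ∀ φ : E n → ℂ, MemLp φ 2 volume → ∀ t : ℝ≥0∞,
    t * μ {x | t < ‖T.app φ x - h x‖ₑ} ≤ A * ∫⁻ y, ‖φ y - u y‖ₑ ∂μ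

variable {T}

lemma measure_lt_app_sub_le {μ : Measure (E n)} {A : ℝ≥0∞} (hac : μ ≪ volume)
    (hA : ∀ f : E n → ℂ, MemLp f 2 volume → ∀ t : ℝ≥0∞,
      t * μ {x | t < ‖T.app f x‖ₑ} ≤ A * ∫⁻ y, ‖f y‖ₑ ∂μ) {φ ψ : E n → ℂ}
    (hφ : MemLp φ 2 volume) (hψ : MemLp ψ 2 volume) (t : ℝ≥0∞) :
    t * μ {x | t < ‖T.app φ x - T.app ψ x‖ₑ} ≤ A * ∫⁻ y, ‖φ y - ψ y‖ₑ ∂μ := by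
  refine le_trans (mul_le_mul_right (measure_mono_ae ?_) t) (hA (φ - ψ) (hφ.sub hψ) t)
  filter_upwards [hac.ae_le (T.app_sub hφ hψ)] with x hx hxt
  change t < ‖T.app (φ - ψ) x‖ₑ
  rw [hx]
  exact hxt

/-- The extension to `L¹(μ)` exists: the images of a rapidly converging sequence of truncations
converge almost everywhere. -/
lemma exists_weakApprox {μ : Measure (E n)} {A : ℝ≥0∞} (hA' : A ≠ ∞) (hac : μ ≪ volume)
    (hac' : volume ≪ μ)
    (hA : ∀ f : E n → ℂ, MemLp f 2 volume → ∀ t : ℝ≥0∞,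
      t * μ {x | t < ‖T.app f x‖ₑ} ≤ A * ∫⁻ y, ‖f y‖ₑ ∂μ) {u : E n → ℂ} (hu : Integrable u μ) :
    ∃ h : E n → ℂ, T.WeakApprox μ A u h := by
  obtain ⟨S, hS, -, hlim⟩ := exists_truncations hac' hu
  have hex : ∀ j : ℕ, ∃ k, ∫⁻ x, ‖(S k).indicator u x - u x‖ₑ ∂μ ≤ ((4 : ℝ≥0∞)⁻¹) ^ j := fun j =>
    ((hlim.eventually_le_const (u := ((4 : ℝ≥0∞)⁻¹) ^ j)
      (pos_iff_ne_zero.2 (pow_ne_zero _ (by simp)))).exists)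
  -- rates `4⁻ʲ` in `L¹(μ)` make the images differ by at most `2⁻ʲ` off a set of measure `O(2⁻ʲ)`
  choose k hk using hex
  set φ : ℕ → E n → ℂ := fun j => (S (k j)).indicator u with hφ
  have hφm : ∀ j, MemLp (φ j) 2 volume := fun j => hS _
  set g : ℕ → E n → ℂ := fun j => T.app (φ j) with hg
  have hum : AEStronglyMeasurable u μ := hu.1
  have hφμ : ∀ j, AEStronglyMeasurable (φ j) μ := fun j => (hφm j).1.mono_ac hac
  have hdiff : ∀ j, ∫⁻ x, ‖φ j x - φ (j + 1) x‖ₑ ∂μ ≤ 2 * ((4 : ℝ≥0∞)⁻¹) ^ j := fun j => by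
    calc ∫⁻ x, ‖φ j x - φ (j + 1) x‖ₑ ∂μ
        ≤ ∫⁻ x, (‖φ j x - u x‖ₑ + ‖φ (j + 1) x - u x‖ₑ) ∂μ := by
          refine lintegral_mono fun x => ?_
          rw [show φ j x - φ (j + 1) x = (φ j x - u x) - (φ (j + 1) x - u x) by ring]
          exact enorm_sub_le
      _ = ∫⁻ x, ‖φ j x - u x‖ₑ ∂μ + ∫⁻ x, ‖φ (j + 1) x - u x‖ₑ ∂μ :=
          lintegral_add_left' ((hφμ j).sub hum).enorm _
      _ ≤ (4 : ℝ≥0∞)⁻¹ ^ j + (4 : ℝ≥0∞)⁻¹ ^ j := by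
          refine add_le_add (hk j) ((hk (j + 1)).trans ?_)
          exact pow_le_pow_of_le_one zero_le (ENNReal.inv_le_one.2 (by norm_num)) (Nat.le_succ j)
      _ = _ := (two_mul _).symm
  have h42 : ∀ j : ℕ, ((4 : ℝ≥0∞)⁻¹) ^ j = (2⁻¹) ^ j * (2⁻¹) ^ j := fun j => by
    rw [← mul_pow, ← ENNReal.mul_inv (by simp) (by simp)]; norm_num
  have h20 : ∀ j : ℕ, ((2 : ℝ≥0∞)⁻¹) ^ j ≠ 0 := fun j => pow_ne_zero _ (by simp)
  have h2t : ∀ j : ℕ, ((2 : ℝ≥0∞)⁻¹) ^ j ≠ ∞ := fun j => ENNReal.pow_ne_top (by simp)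
  have hmeas : ∀ j, μ {x | (2⁻¹) ^ j < ‖g j x - g (j + 1) x‖ₑ} ≤ 2 * A * (2⁻¹) ^ j := fun j => by
    have h1 := (measure_lt_app_sub_le hac hA (hφm j) (hφm (j + 1)) ((2⁻¹) ^ j)).trans
      (mul_le_mul_right (hdiff j) A)
    rw [← ENNReal.mul_le_mul_iff_right (h20 j) (h2t j)]
    refine h1.trans (le_of_eq ?_)
    rw [h42]; ring
  have hsum : ∑' j, μ {x | (2⁻¹) ^ j < ‖g j x - g (j + 1) x‖ₑ} ≠ ∞ := by
    refine ne_top_of_le_ne_top ?_ (ENNReal.tsum_le_tsum hmeas)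
    rw [ENNReal.tsum_mul_left, ENNReal.tsum_geometric]
    refine ENNReal.mul_ne_top (ENNReal.mul_ne_top (by simp) hA') ?_
    simp
  have hcauchy : ∀ᵐ x ∂(volume : Measure (E n)), ∃ l, Tendsto (fun j => g j x) atTop (𝓝 l) := by
    filter_upwards [hac'.ae_le (ae_eventually_notMem hsum)] with x hx
    obtain ⟨N, hN⟩ := eventually_atTop.1 hx
    refine cauchySeq_tendsto_of_complete ?_
    rw [← cauchySeq_shift N]
    refine cauchySeq_of_edist_le_geometric_two 1 (by simp) fun j => ?_
    have h1 : ‖g (j + N) x - g (j + N + 1) x‖ₑ ≤ (2⁻¹) ^ (j + N) :=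
      not_lt.1 (hN (j + N) (by omega))
    rw [edist_eq_enorm_sub, show j + 1 + N = j + N + 1 by omega, one_div, ENNReal.inv_pow]
    refine h1.trans ?_
    exact pow_le_pow_of_le_one zero_le (ENNReal.inv_le_one.2 (by norm_num)) (by omega)
  obtain ⟨h, hhm, hh⟩ := exists_stronglyMeasurable_limit_of_tendsto_ae
    (fun j => T.aestronglyMeasurable_app (φ j)) hcauchy
  refine ⟨h, hhm.aestronglyMeasurable, fun ψ hψ t => ?_⟩
  rcases eq_or_ne t 0 with rfl | ht
  · simp
  rcases eq_or_ne t ∞ with rfl | ht'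
  · simp
  have h1 := measure_lt_enorm_le_liminf (μ := μ) (g := fun j x => T.app ψ x - g j x)
    (h := fun x => T.app ψ x - h x)
    (fun j => (((T.aestronglyMeasurable_app ψ).sub (T.aestronglyMeasurable_app (φ j))).mono_ac hac))
    (by filter_upwards [hac.ae_le hh] with x hx using tendsto_const_nhds.sub hx) t
  have h2 : ∀ j, μ {x | t < ‖T.app ψ x - g j x‖ₑ} ≤
      A * (∫⁻ y, ‖ψ y - u y‖ₑ ∂μ + (4 : ℝ≥0∞)⁻¹ ^ j) / t := fun j => by
    rw [ENNReal.le_div_iff_mul_le (Or.inl ht) (Or.inl ht'), mul_comm]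
    refine (measure_lt_app_sub_le hac hA hψ (hφm j) t).trans (mul_le_mul_right ?_ A)
    calc ∫⁻ y, ‖ψ y - φ j y‖ₑ ∂μ ≤ ∫⁻ y, (‖ψ y - u y‖ₑ + ‖φ j y - u y‖ₑ) ∂μ := by
          refine lintegral_mono fun x => ?_
          rw [show ψ x - φ j x = (ψ x - u x) - (φ j x - u x) by ring]
          exact enorm_sub_le
      _ = ∫⁻ x, ‖ψ x - u x‖ₑ ∂μ + ∫⁻ x, ‖φ j x - u x‖ₑ ∂μ :=
          lintegral_add_left' ((hψ.1.mono_ac hac).sub hum).enorm _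
      _ ≤ _ := add_le_add_right (hk j) _
  have h3 : Tendsto (fun j : ℕ => A * (∫⁻ y, ‖ψ y - u y‖ₑ ∂μ + (4 : ℝ≥0∞)⁻¹ ^ j) / t) atTop
      (𝓝 (A * (∫⁻ y, ‖ψ y - u y‖ₑ ∂μ + 0) / t)) := by
    refine ENNReal.Tendsto.div_const (ENNReal.Tendsto.const_mul ?_ (Or.inr hA')) (Or.inr ht)
    refine tendsto_const_nhds.add (ENNReal.tendsto_pow_atTop_nhds_zero_of_lt_one ?_)
    exact ENNReal.inv_lt_one.2 (by norm_num)
  have h4 := h1.trans ((liminf_le_liminf (Eventually.of_forall h2)).trans h3.liminf_eq.le)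
  rw [add_zero, ENNReal.le_div_iff_mul_le (Or.inl ht) (Or.inl ht'), mul_comm] at h4
  exact h4

variable {w : E n → ℝ} {A : ℝ≥0∞}

lemma WeakApprox.isL1Value {u h : E n → ℂ} (H : T.WeakApprox (wMeasure w) A u h) (hA' : A ≠ ∞)
    (hu : Integrable u (wMeasure w)) : T.IsL1Value w u h := by
  refine ⟨hu, H.aesm, fun φ hφ ε hε => ?_⟩
  -- a finite positive number below `ε` turns the non-strict inequality into a strict one
  obtain ⟨t, ht0, htε⟩ := exists_between hε
  have ht : t ≠ 0 := ht0.ne'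
  have ht' : t ≠ ∞ := (htε.trans_le le_top).ne
  have h1 : ∀ k, wMeasure w {x | ε ≤ edist (T.toL2 (φ k) x) (h x)} ≤
      A * (∫⁻ y, ‖φ k y - u y‖ₑ ∂(wMeasure w)) / t := fun k => by
    rw [ENNReal.le_div_iff_mul_le (Or.inl ht) (Or.inl ht'), mul_comm]
    refine le_trans (mul_le_mul_right (measure_mono fun x hx => ?_) t)
      (H.bound (φ k) (Lp.memLp _) t)
    have hx : ε ≤ edist (T.toL2 (φ k) x) (h x) := hx
    change t < ‖T.app (φ k) x - h x‖ₑ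
    rw [T.app_coe, ← edist_eq_enorm_sub]
    exact htε.trans_le hx
  have h2 : Tendsto (fun k => A * (∫⁻ y, ‖φ k y - u y‖ₑ ∂(wMeasure w)) / t) atTop (𝓝 0) := by
    have := ENNReal.Tendsto.div_const (ENNReal.Tendsto.const_mul hφ (Or.inr hA'))
      (Or.inr ht)
    simpa using this
  exact tendsto_of_tendsto_of_tendsto_of_le_of_le tendsto_const_nhds h2 (fun _ => zero_le) h1

lemma IsL1Value.tendsto {u h : E n → ℂ} (H : T.IsL1Value w u h) (hac : wMeasure w ≪ volume)
    {φ : ℕ → E n → ℂ} (hφ : ∀ k, MemLp (φ k) 2 volume)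
    (hlim : Tendsto (fun k => ∫⁻ x, ‖φ k x - u x‖ₑ ∂(wMeasure w)) atTop (𝓝 0)) :
    TendstoInMeasure (wMeasure w) (fun k => T.app (φ k)) atTop h := by
  have h1 := H.2.2 (fun k => (hφ k).toLp (φ k)) ?_
  · simpa only [← T.app_of_memLp (hφ _)] using h1
  · refine hlim.congr fun k => lintegral_congr_ae ?_
    filter_upwards [hac.ae_le (hφ k).coeFn_toLp] with x hx
    rw [hx]

/-- The value is unique because some sequence in `L²` does converge to `u`, namely that of the
truncations. -/
lemma IsL1Value.unique {u h h' : E n → ℂ} (H : T.IsL1Value w u h) (H' : T.IsL1Value w u h')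
    (hac : wMeasure w ≪ volume) (hac' : volume ≪ wMeasure w) : h =ᵐ[volume] h' := by
  obtain ⟨S, hS, -, hlim⟩ := exists_truncations hac' H.1
  exact hac'.ae_le (tendstoInMeasure_ae_unique (H.tendsto hac hS hlim) (H'.tendsto hac hS hlim))

/-- Additivity of the extension. The values are almost everywhere limits along a common
subsequence. -/
lemma IsL1Value.add {u₁ u₂ h₁ h₂ h : E n → ℂ} (H₁ : T.IsL1Value w u₁ h₁)
    (H₂ : T.IsL1Value w u₂ h₂) (H : T.IsL1Value w (u₁ + u₂) h)
    (hac : wMeasure w ≪ volume) (hac' : volume ≪ wMeasure w) : h =ᵐ[volume] h₁ + h₂ := by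
  obtain ⟨S₁, hS₁, -, hlim₁⟩ := exists_truncations hac' H₁.1
  obtain ⟨S₂, hS₂, -, hlim₂⟩ := exists_truncations hac' H₂.1
  have hlim : Tendsto (fun k => ∫⁻ x, ‖((S₁ k).indicator u₁ + (S₂ k).indicator u₂) x -
      (u₁ + u₂) x‖ₑ ∂(wMeasure w)) atTop (𝓝 0) := by
    have h0 := hlim₁.add hlim₂
    rw [add_zero] at h0
    refine tendsto_of_tendsto_of_tendsto_of_le_of_le tendsto_const_nhds h0 (fun _ => zero_le)
      fun k => ?_
    have hm : AEMeasurable (fun x => ‖(S₁ k).indicator u₁ x - u₁ x‖ₑ) (wMeasure w) :=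
      (((hS₁ k).1.mono_ac hac).sub H₁.1.1).enorm
    change _ ≤ ∫⁻ x, ‖(S₁ k).indicator u₁ x - u₁ x‖ₑ ∂(wMeasure w) +
      ∫⁻ x, ‖(S₂ k).indicator u₂ x - u₂ x‖ₑ ∂(wMeasure w)
    rw [← lintegral_add_left' hm]
    refine lintegral_mono fun x => ?_
    simp only [Pi.add_apply]
    rw [add_sub_add_comm]
    exact enorm_add_le _ _
  have t₁ := H₁.tendsto hac hS₁ hlim₁
  have t₂ := H₂.tendsto hac hS₂ hlim₂
  have t := H.tendsto hac (fun k => (hS₁ k).add (hS₂ k)) hlim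
  obtain ⟨a, ha, h1⟩ := t₁.exists_seq_tendsto_ae
  obtain ⟨b, hb, h2⟩ := (t₂.comp ha.tendsto_atTop).exists_seq_tendsto_ae
  obtain ⟨c, hc, h3⟩ := (t.comp (ha.tendsto_atTop.comp hb.tendsto_atTop)).exists_seq_tendsto_ae
  have hadd : ∀ᵐ x ∂(volume : Measure (E n)), ∀ k,
      T.app ((S₁ k).indicator u₁ + (S₂ k).indicator u₂) x =
        T.app ((S₁ k).indicator u₁) x + T.app ((S₂ k).indicator u₂) x :=
    ae_all_iff.2 fun k => T.app_add (hS₁ k) (hS₂ k)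
  filter_upwards [hac'.ae_le h1, hac'.ae_le h2, hac'.ae_le h3, hadd] with x hx1 hx2 hx3 hx
  refine tendsto_nhds_unique hx3 ?_
  have h4 := (hx1.comp (hb.tendsto_atTop.comp hc.tendsto_atTop)).add (hx2.comp hc.tendsto_atTop)
  refine h4.congr fun k => ?_
  simp only [Function.comp, hx]

/-- The kernel represents the extension off the support. -/
lemma IsL1Value.eq_integral {u h : E n → ℂ} (H : T.IsL1Value w u h) (hn : 0 < n)
    (hac : wMeasure w ≪ volume) (hac' : volume ≪ wMeasure w) (hu : Integrable u volume)
    {s : Set (E n)} (hs : IsClosed s) (h0 : ∀ y ∉ s, u y = 0) :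
    ∀ᵐ x ∂(volume : Measure (E n)), x ∉ s →
      Integrable (fun y => T.kernel x y * u y) volume ∧ h x = ∫ y, T.kernel x y * u y := by
  obtain ⟨S, hS, hev, hlim⟩ := exists_truncations hac' H.1
  obtain ⟨a, ha, h1⟩ := (H.tendsto hac hS hlim).exists_seq_tendsto_ae
  have hrep : ∀ᵐ x ∂(volume : Measure (E n)), ∀ k, x ∉ s →
      T.app ((S k).indicator u) x = ∫ y, T.kernel x y * (S k).indicator u y :=
    ae_all_iff.2 fun k => T.app_eq_integral hn (hS k) hs fun y hy => by
      by_cases hk : y ∈ S k <;> simp [hk, h0 y hy]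
  filter_upwards [hac'.ae_le h1, hrep, T.ae_kernel_section hn] with x hx1 hx2 hx3 hxs
  obtain ⟨δ, hδ, hball⟩ := Metric.isOpen_iff.1 hs.isOpen_compl x hxs
  have hint : Integrable (fun y => T.kernel x y * u y) volume := by
    refine (hu.norm.const_mul (T.kernelConst / δ ^ n)).mono' (hx3.mul hu.1)
      (Eventually.of_forall fun y => ?_)
    by_cases hy : y ∈ s
    · rw [norm_mul]
      refine mul_le_mul_of_nonneg_right (T.norm_kernel_le_of_le hδ ?_) (norm_nonneg _)
      by_contra! hlt
      exact hball (show y ∈ ball x δ by rwa [mem_ball, dist_comm, dist_eq_norm]) hy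
    · simp [h0 y hy]
  refine ⟨hint, tendsto_nhds_unique hx1 ?_⟩
  simp only [fun k => hx2 (a k) hxs]
  refine tendsto_integral_of_dominated_convergence (fun y => ‖T.kernel x y * u y‖)
    (fun k => hx3.mul (hS _).1) hint.norm (fun k => Eventually.of_forall fun y => ?_)
    (Eventually.of_forall fun y => ?_)
  · rw [norm_mul, norm_mul]
    exact mul_le_mul_of_nonneg_left (norm_indicator_le_norm_self _ _) (norm_nonneg _)
  · refine tendsto_const_nhds.congr' ?_
    filter_upwards [ha.tendsto_atTop.eventually (hev y)] with k hk
    rw [indicator_of_mem hk]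

end ThetaCZO

/-! ### Reverse doubling and the growth function -/

/-- Reverse doubling: the ball `2B` contains a ball disjoint from `B` and comparable to `2B`. -/
lemma A1Measure.exists_reverse_doubling {n : ℕ} {μ : Measure (E n)} {C : ℝ≥0∞}
    (hμ : A1Measure μ C) (hn : 0 < n) :
    ∃ δ : ℝ, 0 < δ ∧ δ < 1 ∧ ∀ (c : E n) (r : ℝ), 0 < r →
      (μ (ball c r)).toReal ≤ δ * (μ (ball c (2 * r))).toReal := by
  set D : ℝ := (C * ENNReal.ofReal 4 ^ n).toReal with hD
  have hDt : C * ENNReal.ofReal 4 ^ n ≠ ∞ := ENNReal.mul_ne_top hμ.ne_top (by simp)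
  have hD0 : 0 ≤ D := ENNReal.toReal_nonneg
  refine ⟨(D + 1) / (D + 2), by positivity, (div_lt_one (by positivity)).2 (by linarith),
    fun c r hr => ?_⟩
  -- the ball of radius `r / 2` about `c'` touches `B` from outside and `2B` from inside
  set c' : E n := c + (3 / 2 * r) • EuclideanSpace.single ⟨0, hn⟩ (1 : ℝ) with hc'
  have hdist : dist c c' = 3 / 2 * r := by
    rw [hc', dist_self_add_right, norm_smul, PiLp.norm_single, Real.norm_eq_abs,
      abs_of_pos (by positivity)]
    simp
  have hdisj : Disjoint (ball c r) (ball c' (r / 2)) :=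
    ball_disjoint_ball (by rw [hdist]; linarith)
  have hsub : ball c' (r / 2) ⊆ ball c (4 * (r / 2)) :=
    ball_subset_ball' (by rw [dist_comm, hdist]; linarith)
  have h1 : (μ (ball c (2 * r))).toReal ≤ D * (μ (ball c' (r / 2))).toReal := by
    rw [hD, ← ENNReal.toReal_mul]
    refine ENNReal.toReal_mono (ENNReal.mul_ne_top hDt (hμ.ball_ne_top _ _)) ?_
    have := hμ.doubling c c' (k := 4) (by norm_num) (half_pos hr) hsub
    rwa [show 4 * (r / 2) = 2 * r by ring] at this
  have h2 : (μ (ball c r)).toReal + (μ (ball c' (r / 2))).toReal ≤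
      (μ (ball c (2 * r))).toReal := by
    rw [← ENNReal.toReal_add (hμ.ball_ne_top _ _) (hμ.ball_ne_top _ _),
      ← measure_union hdisj measurableSet_ball]
    refine ENNReal.toReal_mono (hμ.ball_ne_top _ _) (measure_mono (union_subset
      (ball_subset_ball (by linarith)) ?_))
    rwa [show 4 * (r / 2) = 2 * r by ring] at hsub
  rw [div_mul_eq_mul_div, le_div_iff₀ (by positivity)]
  have h3 : 0 ≤ (μ (ball c r)).toReal := ENNReal.toReal_nonneg
  have h4 : 0 ≤ (μ (ball c' (r / 2))).toReal := ENNReal.toReal_nonneg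
  nlinarith

/-- The condition `𝒟_κ` in terms of the quotients `ψ(t) / t`. Allowing `a = b` costs a constant at
least `1`. -/
lemma SatisfiesD.exists_div_le {κ : ℝ} {ψ : ℝ → ℝ} (hψ : SatisfiesD κ ψ) :
    ∃ C : ℝ, 0 < C ∧ ∀ a b : ℝ, 0 < a → a ≤ b → ψ b / b ≤ C * (a / b) ^ (1 - κ) * (ψ a / a) := by
  obtain ⟨C, hC, h⟩ := hψ.bound
  refine ⟨max C 1, by positivity, fun a b ha hab => ?_⟩
  have hb : 0 < b := ha.trans_le hab
  have hψa := hψ.pos a ha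
  have hψb := hψ.pos b hb
  have h1 : ψ b / b ^ κ ≤ max C 1 * (ψ a / a ^ κ) := by
    have h0 : 0 ≤ ψ a / a ^ κ := by positivity
    rcases hab.eq_or_lt with rfl | hlt
    · exact le_mul_of_one_le_left h0 (le_max_right _ _)
    · exact (h a b ha hlt).trans (mul_le_mul_of_nonneg_right (le_max_left _ _) h0)
  have key : ∀ s : ℝ, 0 < s → ψ s / s = ψ s / s ^ κ * s ^ (κ - 1) := fun s hs => by
    rw [Real.rpow_sub hs, Real.rpow_one]
    have := (Real.rpow_pos_of_pos hs κ).ne'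
    field_simp
  calc ψ b / b = ψ b / b ^ κ * b ^ (κ - 1) := key b hb
    _ ≤ max C 1 * (ψ a / a ^ κ) * b ^ (κ - 1) :=
      mul_le_mul_of_nonneg_right h1 (Real.rpow_nonneg hb.le _)
    _ = max C 1 * (a / b) ^ (1 - κ) * (ψ a / a) := by
      rw [key a ha, Real.div_rpow ha.le hb.le, show κ - 1 = -(1 - κ) by ring,
        Real.rpow_neg ha.le, Real.rpow_neg hb.le]
      have := (Real.rpow_pos_of_pos ha (1 - κ)).ne'
      have := (Real.rpow_pos_of_pos ha κ).ne'
      have := (Real.rpow_pos_of_pos hb (1 - κ)).ne'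
      field_simp

/-- The quantity `ψ (μ B)` for the ball `B` with centre `c` and radius `r`, in `[0, ∞]`. -/
def growth {n : ℕ} (ψ : ℝ → ℝ) (μ : Measure (E n)) (c : E n) (r : ℝ) : ℝ≥0∞ :=
  ENNReal.ofReal (ψ (μ (ball c r)).toReal)

lemma growth_ne_top {n : ℕ} (ψ : ℝ → ℝ) (μ : Measure (E n)) (c : E n) (r : ℝ) :
    growth ψ μ c r ≠ ∞ := ENNReal.ofReal_ne_top

lemma A1Measure.toReal_ball_pos {n : ℕ} {μ : Measure (E n)} {C : ℝ≥0∞} (hμ : A1Measure μ C)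
    (c : E n) {r : ℝ} (hr : 0 < r) : 0 < (μ (ball c r)).toReal :=
  ENNReal.toReal_pos (hμ.ball_ne_zero c hr) (hμ.ball_ne_top c r)

lemma A1Measure.growth_ne_zero {n : ℕ} {μ : Measure (E n)} {C : ℝ≥0∞} (hμ : A1Measure μ C)
    {κ : ℝ} {ψ : ℝ → ℝ} (hψ : SatisfiesD κ ψ) (c : E n) {r : ℝ} (hr : 0 < r) :
    growth ψ μ c r ≠ 0 :=
  (ENNReal.ofReal_pos.2 (hψ.pos _ (hμ.toReal_ball_pos c hr))).ne'

/-- By reverse doubling and the condition `𝒟_κ` with `κ < 1`, the averages `ψ (μ (2ʲB)) / μ (2ʲB)`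
decay geometrically in `j`. -/
lemma A1Measure.exists_growth_decay {n : ℕ} {μ : Measure (E n)} {C : ℝ≥0∞} (hμ : A1Measure μ C)
    (hn : 0 < n) {κ : ℝ} (hκ : κ < 1) {ψ : ℝ → ℝ} (hψ : SatisfiesD κ ψ) :
    ∃ M q : ℝ≥0∞, M ≠ ∞ ∧ q < 1 ∧ ∀ (c : E n) (r : ℝ), 0 < r → ∀ j : ℕ,
      growth ψ μ c (2 ^ j * r) / μ (ball c (2 ^ j * r)) ≤
        M * q ^ j * (growth ψ μ c r / μ (ball c r)) := by
  obtain ⟨δ, hδ0, hδ1, hδ⟩ := hμ.exists_reverse_doubling hn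
  obtain ⟨M, hM, hD⟩ := hψ.exists_div_le
  have hq0 : 0 ≤ δ ^ (1 - κ) := Real.rpow_nonneg hδ0.le _
  refine ⟨ENNReal.ofReal M, ENNReal.ofReal (δ ^ (1 - κ)), ENNReal.ofReal_ne_top, ?_,
    fun c r hr j => ?_⟩
  · rw [← ENNReal.ofReal_one, ENNReal.ofReal_lt_ofReal_iff one_pos]
    exact Real.rpow_lt_one hδ0.le hδ1 (by linarith)
  have hdec : ∀ j : ℕ, (μ (ball c r)).toReal ≤ δ ^ j * (μ (ball c (2 ^ j * r))).toReal := by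
    intro j
    induction j with
    | zero => simp
    | succ j ih =>
      refine ih.trans ?_
      have := hδ c (2 ^ j * r) (by positivity)
      rw [← mul_assoc, ← pow_succ'] at this
      rw [pow_succ, mul_assoc]
      exact mul_le_mul_of_nonneg_left this (by positivity)
  have hrj : 0 < 2 ^ j * r := by positivity
  set a := (μ (ball c r)).toReal with ha
  set b := (μ (ball c (2 ^ j * r))).toReal with hb
  have ha0 : 0 < a := hμ.toReal_ball_pos c hr
  have hb0 : 0 < b := hμ.toReal_ball_pos c hrj
  have hab : a ≤ b := (hdec j).trans
    (mul_le_of_le_one_left hb0.le (pow_le_one₀ hδ0.le hδ1.le))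
  have hdiv : ∀ {s : ℝ}, 0 < s → growth ψ μ c s / μ (ball c s) =
      ENNReal.ofReal (ψ (μ (ball c s)).toReal / (μ (ball c s)).toReal) := fun hs => by
    rw [ENNReal.ofReal_div_of_pos (hμ.toReal_ball_pos c hs),
      ENNReal.ofReal_toReal (hμ.ball_ne_top c _), growth]
  rw [hdiv hrj, hdiv hr, ← ENNReal.ofReal_pow hq0, ← ENNReal.ofReal_mul hM.le,
    ← ENNReal.ofReal_mul (by positivity)]
  refine ENNReal.ofReal_le_ofReal ((hD a b ha0 hab).trans ?_)
  have hψa := hψ.pos a ha0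
  refine mul_le_mul_of_nonneg_right (mul_le_mul_of_nonneg_left ?_ hM.le) (by positivity)
  calc (a / b) ^ (1 - κ) ≤ (δ ^ j) ^ (1 - κ) :=
        Real.rpow_le_rpow (by positivity) ((div_le_iff₀ hb0).2 (hdec j)) (by linarith)
    _ = (δ ^ (1 - κ)) ^ j := by
        rw [← Real.rpow_natCast, ← Real.rpow_natCast, ← Real.rpow_mul hδ0.le,
          ← Real.rpow_mul hδ0.le, mul_comm]

lemma A1Measure.exists_growth_doubling {n : ℕ} {μ : Measure (E n)} {C : ℝ≥0∞}
    (hμ : A1Measure μ C) (hn : 0 < n) {κ : ℝ} (hκ : κ < 1) {ψ : ℝ → ℝ} (hψ : SatisfiesD κ ψ) :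
    ∃ M : ℝ≥0∞, M ≠ ∞ ∧ ∀ (c : E n) (r : ℝ), 0 < r →
      growth ψ μ c (2 * r) ≤ M * growth ψ μ c r := by
  obtain ⟨M, q, hM, hq, h⟩ := hμ.exists_growth_decay hn hκ hψ
  refine ⟨M * (C * ENNReal.ofReal 2 ^ n), ENNReal.mul_ne_top hM
    (ENNReal.mul_ne_top hμ.ne_top (by simp)), fun c r hr => ?_⟩
  have h1 := h c r hr 1
  rw [pow_one, pow_one, ENNReal.div_le_iff (hμ.ball_ne_zero c (by positivity))
    (hμ.ball_ne_top _ _)] at h1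
  calc growth ψ μ c (2 * r)
      ≤ M * q * (growth ψ μ c r / μ (ball c r)) * μ (ball c (2 * r)) := h1
    _ ≤ M * 1 * (growth ψ μ c r / μ (ball c r)) * (C * ENNReal.ofReal 2 ^ n * μ (ball c r)) := by
      gcongr
      exact hμ.doubling_self c one_le_two hr
    _ = M * (C * ENNReal.ofReal 2 ^ n) * (growth ψ μ c r / μ (ball c r) * μ (ball c r)) := by ring
    _ = _ := by rw [ENNReal.div_mul_cancel (hμ.ball_ne_zero c hr) (hμ.ball_ne_top c r)]

/-- The part of a Morrey function far from the ball `B` contributes at most a constant multiple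
of `ψ (μ B) / μ B` to an integral against a kernel of the size of `‖y - c‖⁻ⁿ`. -/
lemma A1Measure.exists_lintegral_compl_le {n : ℕ} {μ : Measure (E n)} {C : ℝ≥0∞}
    (hμ : A1Measure μ C) (hn : 0 < n) {κ : ℝ} (hκ : κ < 1) {ψ : ℝ → ℝ} (hψ : SatisfiesD κ ψ) :
    ∃ M : ℝ≥0∞, M ≠ ∞ ∧ ∀ (F : E n → ℝ≥0∞) (N : ℝ≥0∞), AEMeasurable F MeasureTheory.volume →
      (∀ (c : E n) (r : ℝ), 0 < r → ∫⁻ y in ball c r, F y ∂μ ≤ N * growth ψ μ c r) →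
      ∀ (c : E n) (r : ℝ), 0 < r →
        ∫⁻ y in (ball c (2 * r))ᶜ, ENNReal.ofReal (1 / ‖y - c‖ ^ n) * F y ≤
          M * N * (growth ψ μ c r / μ (ball c r)) := by
  obtain ⟨M, q, hM, hq, hdec⟩ := hμ.exists_growth_decay hn hκ hψ
  set V : ℝ≥0∞ := MeasureTheory.volume (ball (0 : E n) 1) with hV
  set L : ℝ≥0∞ := C * ENNReal.ofReal 2 ^ n * V * M with hL
  have hLt : L ≠ ∞ := ENNReal.mul_ne_top (ENNReal.mul_ne_top
    (ENNReal.mul_ne_top hμ.ne_top (by simp)) (volume_ball_ne_top _ _)) hM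
  refine ⟨L * (1 - q)⁻¹, ENNReal.mul_ne_top hLt (ENNReal.inv_ne_top.2
    (tsub_pos_of_lt hq).ne'), fun F N hF hN c r hr => ?_⟩
  have hann := lintegral_compl_ball_le_tsum (G := fun s => ENNReal.ofReal (1 / s ^ n))
    (ρ := 2 * r) (by positivity) (fun s t hs hst => ENNReal.ofReal_le_ofReal
      (one_div_le_one_div_of_le (pow_pos (by linarith) n)
        (pow_le_pow_left₀ (by linarith) hst n))) MeasureTheory.volume F c
  refine hann.trans ?_
  have hterm : ∀ j : ℕ, ∫⁻ y in ball c (2 ^ (j + 1) * (2 * r)),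
      ENNReal.ofReal (1 / (2 ^ j * (2 * r)) ^ n) * F y ≤
        L * N * (growth ψ μ c r / μ (ball c r)) * q ^ j := by
    intro j
    set s : ℝ := 2 ^ j * (2 * r) with hs
    have hs0 : 0 < s := by positivity
    have e1 : (2 : ℝ) ^ (j + 1) * (2 * r) = 2 ^ (j + 2) * r := by ring
    have e2 : (2 : ℝ) ^ (j + 2) * r = 2 * s * 1 := by rw [hs]; ring
    rw [e1, lintegral_const_mul'' _ hF.restrict]
    set R : ℝ := 2 ^ (j + 2) * r with hR
    have hR0 : 0 < R := by positivity
    have hm0 := hμ.ball_ne_zero c hR0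
    have hmt := hμ.ball_ne_top c R
    have h1 : ∫⁻ y in ball c R, F y ≤
        C * MeasureTheory.volume (ball c R) * (N * (growth ψ μ c R / μ (ball c R))) := by
      have h2 := (hμ.le c R F hF).trans (mul_le_mul_right (hN c R hR0) _)
      rw [mul_comm, ← ENNReal.le_div_iff_mul_le (Or.inl hm0) (Or.inl hmt)] at h2
      refine h2.trans_eq ?_
      simp only [div_eq_mul_inv]
      ring
    have hvol : MeasureTheory.volume (ball c R) = ENNReal.ofReal (2 * s) ^ n * V := by
      rw [e2, volume_ball_mul c 0 (by positivity) one_pos]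
    have hcancel : ENNReal.ofReal (1 / s ^ n) * ENNReal.ofReal (2 * s) ^ n =
        ENNReal.ofReal 2 ^ n := by
      rw [← ENNReal.ofReal_pow (by positivity), ← ENNReal.ofReal_mul (by positivity),
        ← ENNReal.ofReal_pow (by positivity)]
      congr 1
      rw [mul_pow 2 s n, mul_comm, mul_assoc, mul_one_div_cancel (pow_pos hs0 n).ne', mul_one]
    calc ENNReal.ofReal (1 / s ^ n) * ∫⁻ y in ball c R, F y
        ≤ ENNReal.ofReal (1 / s ^ n) * (C * (ENNReal.ofReal (2 * s) ^ n * V) *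
            (N * (M * q ^ (j + 2) * (growth ψ μ c r / μ (ball c r))))) := by
          rw [← hvol]
          exact mul_le_mul_right (h1.trans (mul_le_mul_right (mul_le_mul_right
            (hdec c r hr (j + 2)) _) _)) _
      _ = C * (ENNReal.ofReal (1 / s ^ n) * ENNReal.ofReal (2 * s) ^ n) * V * M * N *
            (growth ψ μ c r / μ (ball c r)) * q ^ (j + 2) := by ring
      _ ≤ L * N * (growth ψ μ c r / μ (ball c r)) * q ^ j := by
          rw [hcancel]
          exact mul_le_mul_right (pow_le_pow_of_le_one zero_le hq.le (by omega)) _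
  calc _ ≤ ∑' j : ℕ, L * N * (growth ψ μ c r / μ (ball c r)) * q ^ j :=
        ENNReal.tsum_le_tsum hterm
    _ = _ := by rw [ENNReal.tsum_mul_left, ENNReal.tsum_geometric]; ring

/-! ### Functions in the Morrey space -/

section Morrey

variable {n : ℕ} {w : E n → ℝ} {C : ℝ≥0∞} {κ : ℝ} {ψ : ℝ → ℝ} {f : E n → ℂ}

lemma lintegral_ball_le_morreyNorm (hμ : A1Measure (wMeasure w) C) (hψ : SatisfiesD κ ψ)
    (f : E n → ℂ) (c : E n) {r : ℝ} (hr : 0 < r) :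
    ∫⁻ y in ball c r, ‖f y‖ₑ ∂(wMeasure w) ≤
      morreyNorm ψ w f * growth ψ (wMeasure w) c r := by
  rw [← ENNReal.div_le_iff (hμ.growth_ne_zero hψ c hr) (growth_ne_top _ _ _ _)]
  exact le_iSup_of_le c (le_iSup_of_le r (le_iSup_of_le hr le_rfl))

/-- The local pieces of a Morrey function belong to `L¹_w`, where the operator is defined by
continuity. -/
lemma MemMorrey.integrable_indicator (hf : MemMorrey ψ w f) (hμ : A1Measure (wMeasure w) C)
    (hψ : SatisfiesD κ ψ) (c : E n) {r : ℝ} (hr : 0 < r) {s : Set (E n)} (hs : MeasurableSet s)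
    (hsub : s ⊆ ball c r) : Integrable (s.indicator f) (wMeasure w) := by
  rw [integrable_indicator_iff hs]
  refine IntegrableOn.mono_set ?_ hsub
  refine ⟨(hf.1.aestronglyMeasurable.mono_ac hμ.ac).restrict, ?_⟩
  exact (lintegral_ball_le_morreyNorm hμ hψ f c hr).trans_lt
    (ENNReal.mul_lt_top hf.2 (growth_ne_top _ _ _ _).lt_top)

lemma MemMorrey.integrable_indicator_volume (hf : MemMorrey ψ w f) (c : E n) {r : ℝ}
    {s : Set (E n)} (hs : MeasurableSet s) (hsub : s ⊆ ball c r) :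
    Integrable (s.indicator f) volume := by
  rw [integrable_indicator_iff hs]
  exact (hf.1.integrableOn_isCompact (isCompact_closedBall c r)).mono_set
    (hsub.trans ball_subset_closedBall)

/-- The integral of `K(x, ·) f` over the complement of `2B` is bounded uniformly in `x ∈ B`. -/
lemma ThetaCZO.exists_lintegral_kernel_le {θ : ℝ → ℝ} (T : ThetaCZO n θ) (hn : 0 < n)
    (hμ : A1Measure (wMeasure w) C) (hκ : κ < 1) (hψ : SatisfiesD κ ψ) :
    ∃ M : ℝ≥0∞, M ≠ ∞ ∧ ∀ f : E n → ℂ, MemMorrey ψ w f → ∀ (c : E n) (r : ℝ), 0 < r →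
      ∀ x ∈ ball c r, ∫⁻ y in (ball c (2 * r))ᶜ, ‖T.kernel x y * f y‖ₑ ≤
        M * morreyNorm ψ w f * (growth ψ (wMeasure w) c r / wMeasure w (ball c r)) := by
  obtain ⟨M, hM, h⟩ := hμ.exists_lintegral_compl_le hn hκ hψ
  have hK := T.kernelConst_pos
  refine ⟨ENNReal.ofReal (T.kernelConst * 2 ^ n) * M, ENNReal.mul_ne_top ENNReal.ofReal_ne_top hM,
    fun f hf c r hr x hx => ?_⟩
  have h1 := h (fun y => ‖f y‖ₑ) (morreyNorm ψ w f) hf.1.aestronglyMeasurable.enorm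
    (fun c r hr => lintegral_ball_le_morreyNorm hμ hψ f c hr) c r hr
  calc ∫⁻ y in (ball c (2 * r))ᶜ, ‖T.kernel x y * f y‖ₑ
      ≤ ∫⁻ y in (ball c (2 * r))ᶜ, ENNReal.ofReal (T.kernelConst * 2 ^ n) *
          (ENNReal.ofReal (1 / ‖y - c‖ ^ n) * ‖f y‖ₑ) := by
        refine setLIntegral_mono' measurableSet_ball.compl fun y hy => ?_
        have hy : 2 * r ≤ dist y c := by simpa using hy
        have hx : dist x c < r := hx
        have h2 : ‖y - c‖ / 2 ≤ ‖x - y‖ := by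
          rw [← dist_eq_norm, ← dist_eq_norm]
          have := dist_triangle y x c
          rw [dist_comm y x] at this
          linarith
        have h3 : 0 < ‖y - c‖ := by rw [← dist_eq_norm]; linarith
        have h4 := T.norm_kernel_le_of_le (half_pos h3) h2
        rw [enorm_mul, ← mul_assoc, ← ENNReal.ofReal_mul (by positivity), ← ofReal_norm]
        refine mul_le_mul_left (ENNReal.ofReal_le_ofReal (h4.trans_eq ?_)) _
        rw [div_pow]
        field_simp
    _ ≤ ENNReal.ofReal (T.kernelConst * 2 ^ n) * (M * morreyNorm ψ w f *
          (growth ψ (wMeasure w) c r / wMeasure w (ball c r))) := by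
        rw [lintegral_const_mul' _ _ ENNReal.ofReal_ne_top]
        exact mul_le_mul_right h1 _
    _ = _ := by ring

end Morrey

/-! ### The operator on the Morrey space -/

namespace ThetaCZO

variable {n : ℕ} {θ : ℝ → ℝ} {T : ThetaCZO n θ} {w : E n → ℝ} {A C : ℝ≥0∞} {κ : ℝ} {ψ : ℝ → ℝ}
  {f : E n → ℂ}

/-- The extension to `L¹_w` is again of weak type `(1, 1)`. -/
lemma IsL1Value.mul_measure_le {u h : E n → ℂ} (H : T.IsL1Value w u h)
    (hac : wMeasure w ≪ volume) (hac' : volume ≪ wMeasure w) (hA' : A ≠ ∞)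
    (hA : ∀ f : E n → ℂ, MemLp f 2 volume → ∀ t : ℝ≥0∞,
      t * wMeasure w {x | t < ‖T.app f x‖ₑ} ≤ A * ∫⁻ y, ‖f y‖ₑ ∂(wMeasure w)) (t : ℝ≥0∞) :
    t * wMeasure w {x | t < ‖h x‖ₑ} ≤ A * ∫⁻ y, ‖u y‖ₑ ∂(wMeasure w) := by
  obtain ⟨h', H'⟩ := exists_weakApprox hA' hac hac' hA H.1
  have heq := H.unique (H'.isL1Value hA' H.1) hac hac'
  have h0 := H'.bound 0 MemLp.zero t
  simp only [Pi.zero_apply, zero_sub, enorm_neg] at h0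
  refine le_trans (mul_le_mul_right (measure_mono_ae ?_) t) h0
  filter_upwards [hac.ae_le heq, hac.ae_le T.app_zero] with x hx hx0 hxt
  change t < ‖T.app 0 x - h' x‖ₑ
  have hxt : t < ‖h x‖ₑ := hxt
  rwa [hx0, Pi.zero_apply, zero_sub, enorm_neg, ← hx]

/-- On `L² ∩ L¹_w` the extension to `L¹_w` is the given operator. -/
lemma isL1Value_app {u : E n → ℂ} (hac : wMeasure w ≪ volume) (hA' : A ≠ ∞)
    (hA : ∀ f : E n → ℂ, MemLp f 2 volume → ∀ t : ℝ≥0∞,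
      t * wMeasure w {x | t < ‖T.app f x‖ₑ} ≤ A * ∫⁻ y, ‖f y‖ₑ ∂(wMeasure w))
    (hu : MemLp u 2 volume) (hu' : Integrable u (wMeasure w)) : T.IsL1Value w u (T.app u) :=
  WeakApprox.isL1Value (A := A)
    ⟨T.aestronglyMeasurable_app u, fun _ hφ t => measure_lt_app_sub_le hac hA hφ hu t⟩ hA' hu'

lemma ae_integrableOn_kernel (T : ThetaCZO n θ) (hn : 0 < n) (hμ : A1Measure (wMeasure w) C)
    (hκ : κ < 1) (hψ : SatisfiesD κ ψ) (hf : MemMorrey ψ w f) (c : E n) {r : ℝ} (hr : 0 < r) :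
    ∀ᵐ x ∂(volume : Measure (E n)), x ∈ ball c r →
      IntegrableOn (fun y => T.kernel x y * f y) (ball c (2 * r))ᶜ volume := by
  obtain ⟨M, hM, h⟩ := T.exists_lintegral_kernel_le hn hμ hκ hψ
  filter_upwards [T.ae_kernel_section hn] with x hx hxB
  refine ⟨(hx.mul hf.1.aestronglyMeasurable).restrict, (h f hf c r hr x hxB).trans_lt ?_⟩
  exact ENNReal.mul_lt_top (ENNReal.mul_lt_top hM.lt_top hf.2)
    (ENNReal.div_lt_top (growth_ne_top _ _ _ _) (hμ.ball_ne_zero c hr))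

/-- The two descriptions of the image of `f`, attached to the ball with centre `c` and radius `r`
and to a ball whose double contains the double of the former, agree on the former ball. -/
lemma IsL1Value.ae_add_integral_eq {h h' : E n → ℂ} {c c' : E n} {r r' : ℝ}
    (H : T.IsL1Value w ((ball c (2 * r)).indicator f) h)
    (H' : T.IsL1Value w ((ball c' (2 * r')).indicator f) h')
    (hsub : ball c (2 * r) ⊆ ball c' (2 * r')) (hr : 0 < r) (hn : 0 < n)
    (hμ : A1Measure (wMeasure w) C) (hκ : κ < 1) (hψ : SatisfiesD κ ψ) (hf : MemMorrey ψ w f)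
    (hA' : A ≠ ∞)
    (hA : ∀ f : E n → ℂ, MemLp f 2 volume → ∀ t : ℝ≥0∞,
      t * wMeasure w {x | t < ‖T.app f x‖ₑ} ≤ A * ∫⁻ y, ‖f y‖ₑ ∂(wMeasure w)) :
    ∀ᵐ x ∂(volume : Measure (E n)), x ∈ ball c r →
      h x + ∫ y in (ball c (2 * r))ᶜ, T.kernel x y * f y =
        h' x + ∫ y in (ball c' (2 * r'))ᶜ, T.kernel x y * f y := by
  set S : Set (E n) := ball c' (2 * r') \ ball c (2 * r) with hS
  have hSm : MeasurableSet S := measurableSet_ball.diff measurableSet_ball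
  have hr' : 0 < 2 * r' := pos_of_mem_ball (hsub (mem_ball_self (by positivity)))
  have hSi : Integrable (S.indicator f) (wMeasure w) :=
    hf.integrable_indicator hμ hψ c' hr' hSm sdiff_subset
  obtain ⟨k, hk⟩ := exists_weakApprox (T := T) hA' hμ.ac hμ.ac' hA hSi
  have Hk := hk.isL1Value hA' hSi
  have hsum : (ball c (2 * r)).indicator f + S.indicator f = (ball c' (2 * r')).indicator f := by
    rw [← union_sdiff_cancel hsub]
    exact (indicator_union_of_disjoint disjoint_sdiff_right f).symm
  rw [← hsum] at H'
  have hadd := H.add Hk H' hμ.ac hμ.ac'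
  have hrep := Hk.eq_integral hn hμ.ac hμ.ac' (hf.integrable_indicator_volume c' hSm sdiff_subset)
    (s := (ball c (2 * r))ᶜ) isOpen_ball.isClosed_compl
    fun y hy => indicator_of_notMem (fun hyS => hy hyS.2) f
  filter_upwards [hadd, hrep, T.ae_integrableOn_kernel hn hμ hκ hψ hf c hr] with x hx1 hx2 hx3 hxB
  have hx2 := (hx2 (not_not_intro (ball_subset_ball (by linarith) hxB))).2
  have hx3 := hx3 hxB
  have hunion : (ball c (2 * r))ᶜ = S ∪ (ball c' (2 * r'))ᶜ := by
    rw [hS, sdiff_eq, inter_union_distrib_right, union_compl_self, univ_inter,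
      union_eq_self_of_subset_right (compl_subset_compl.2 hsub)]
  have hdisj : Disjoint S (ball c' (2 * r'))ᶜ :=
    disjoint_left.2 fun y hy hy' => hy' hy.1
  have hkS : k x = ∫ y in S, T.kernel x y * f y := by
    rw [hx2, ← integral_indicator hSm]
    congr 1
    ext y
    by_cases hy : y ∈ S <;> simp [hy]
  rw [hunion, setIntegral_union hdisj measurableSet_ball.compl
    (hx3.mono_set (hunion ▸ subset_union_left)) (hx3.mono_set (hunion ▸ subset_union_right)),
    hx1, Pi.add_apply, hkS, add_assoc]

lemma IsImage.congr {g g' : E n → ℂ} (H : T.IsImage w f g) (h : g' =ᵐ[volume] g) :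
    T.IsImage w f g' := by
  refine ⟨H.1.congr h.symm, fun c r hr => ?_⟩
  obtain ⟨k, hk, hx⟩ := H.2 c r hr
  refine ⟨k, hk, ?_⟩
  filter_upwards [hx, ae_restrict_of_ae h] with x hx1 hx2
  exact ⟨hx1.1, hx2.trans hx1.2⟩

/-- The image is unique, since countably many balls cover `ℝⁿ`. -/
lemma IsImage.ae_eq {g g' : E n → ℂ} (H : T.IsImage w f g) (H' : T.IsImage w f g')
    (hac : wMeasure w ≪ volume) (hac' : volume ≪ wMeasure w) : g =ᵐ[volume] g' := by
  have hall : ∀ᵐ x ∂(volume : Measure (E n)), ∀ m : ℕ, x ∈ ball (0 : E n) (m + 1) →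
      g x = g' x := by
    refine ae_all_iff.2 fun m => ?_
    obtain ⟨h, hh, hx⟩ := H.2 0 (m + 1) (by positivity)
    obtain ⟨h', hh', hx'⟩ := H'.2 0 (m + 1) (by positivity)
    rw [ae_restrict_iff' measurableSet_ball] at hx hx'
    filter_upwards [hx, hx', hh.unique hh' hac hac'] with x h1 h2 h3 hxm
    rw [(h1 hxm).2, (h2 hxm).2, h3]
  filter_upwards [hall] with x hx
  exact hx ⌊‖x‖⌋₊ (by simpa using Nat.lt_floor_add_one ‖x‖)

/-- The image of a Morrey function is obtained by gluing its descriptions on the balls of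
integral radius about the origin. -/
lemma exists_isImage (T : ThetaCZO n θ) (hn : 0 < n) (hμ : A1Measure (wMeasure w) C)
    (hκ : κ < 1) (hψ : SatisfiesD κ ψ) (hA' : A ≠ ∞)
    (hA : ∀ f : E n → ℂ, MemLp f 2 volume → ∀ t : ℝ≥0∞,
      t * wMeasure w {x | t < ‖T.app f x‖ₑ} ≤ A * ∫⁻ y, ‖f y‖ₑ ∂(wMeasure w))
    (hf : MemMorrey ψ w f) : ∃ g : E n → ℂ, T.IsImage w f g := by
  have hex : ∀ (c : E n) (r : ℝ), 0 < r →
      ∃ h : E n → ℂ, T.IsL1Value w ((ball c (2 * r)).indicator f) h := fun c r hr => by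
    have hi := hf.integrable_indicator hμ hψ c (r := 2 * r) (by positivity) measurableSet_ball
      subset_rfl
    obtain ⟨h, hh⟩ := exists_weakApprox (T := T) hA' hμ.ac hμ.ac' hA hi
    exact ⟨h, hh.isL1Value hA' hi⟩
  choose h hh using fun m : ℕ => hex 0 (m + 1) (by positivity)
  set G : ℕ → E n → ℂ := fun m x =>
    h m x + ∫ y in (ball (0 : E n) (2 * (m + 1)))ᶜ, T.kernel x y * f y with hG
  have hGm : ∀ m, AEStronglyMeasurable (G m) volume := fun m => by
    refine (hh m).2.1.add ?_
    refine AEStronglyMeasurable.integral_prod_right'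
      (f := fun p : E n × E n => T.kernel p.1 p.2 * f p.2) ?_
    refine AEStronglyMeasurable.mono_measure
      ((T.ae_aestronglyMeasurable_kernel hn).mul hf.1.aestronglyMeasurable.comp_snd)
      (Measure.prod_mono le_rfl Measure.restrict_le_self)
  have hcons : ∀ᵐ x ∂(volume : Measure (E n)), ∀ m k : ℕ, m ≤ k → x ∈ ball (0 : E n) (m + 1) →
      G m x = G k x := by
    refine ae_all_iff.2 fun m => ae_all_iff.2 fun k => ae_all_iff.2 fun hmk => ?_
    have hmk : (m : ℝ) ≤ k := by exact_mod_cast hmk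
    exact (hh m).ae_add_integral_eq (hh k) (ball_subset_ball (by linarith)) (by positivity) hn hμ
      hκ hψ hf hA' hA
  have hlocal : ∀ x : E n, x ∈ ball (0 : E n) (⌊‖x‖⌋₊ + 1) := fun x => by
    simpa using Nat.lt_floor_add_one ‖x‖
  refine ⟨fun x => G ⌊‖x‖⌋₊ x, ?_, fun c r hr => ?_⟩
  · refine aestronglyMeasurable_of_tendsto_ae atTop hGm ?_
    filter_upwards [hcons] with x hx
    refine tendsto_const_nhds.congr' ?_
    filter_upwards [eventually_ge_atTop ⌊‖x‖⌋₊] with k hk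
    exact hx _ k hk (hlocal x)
  · obtain ⟨k, hk⟩ := hex c r hr
    obtain ⟨m, hm⟩ := exists_nat_gt (‖c‖ + 2 * r)
    have hsub : ball c (2 * r) ⊆ ball (0 : E n) (2 * (m + 1)) :=
      ball_subset_ball' (by rw [dist_zero_right]; linarith [norm_nonneg c])
    refine ⟨k, hk, ?_⟩
    rw [ae_restrict_iff' measurableSet_ball]
    filter_upwards [hcons, T.ae_integrableOn_kernel hn hμ hκ hψ hf c hr,
      hk.ae_add_integral_eq (hh m) hsub hr hn hμ hκ hψ hf hA' hA] with x hx1 hx2 hx3 hxB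
    refine ⟨hx2 hxB, ?_⟩
    rw [hx3 hxB]
    refine hx1 _ m ?_ (hlocal x)
    have h1 : ‖x‖ < m := by
      have h2 : ‖x‖ ≤ ‖x - c‖ + ‖c‖ := by simpa using norm_add_le (x - c) c
      have h3 : ‖x - c‖ < r := by simpa [dist_eq_norm] using hxB
      linarith
    exact Nat.floor_le_of_le h1.le

/-- For square integrable Morrey functions, linearity on `L²` and the kernel representation off the
support split the given operator as in the definition of the image. -/
lemma isImage_toL2 (T : ThetaCZO n θ) (hn : 0 < n) (hμ : A1Measure (wMeasure w) C)
    (hκ : κ < 1) (hψ : SatisfiesD κ ψ) (hA' : A ≠ ∞)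
    (hA : ∀ f : E n → ℂ, MemLp f 2 volume → ∀ t : ℝ≥0∞,
      t * wMeasure w {x | t < ‖T.app f x‖ₑ} ≤ A * ∫⁻ y, ‖f y‖ₑ ∂(wMeasure w))
    (f : Lp ℂ 2 (volume : Measure (E n))) (hf : MemMorrey ψ w f) :
    T.IsImage w f (T.toL2 f) := by
  have hf2 : MemLp f 2 volume := Lp.memLp f
  refine ⟨(Lp.memLp (T.toL2 f)).1, fun c r hr => ?_⟩
  set B : Set (E n) := ball c (2 * r) with hB
  have hBm : MeasurableSet B := measurableSet_ball
  have h1 := hf2.indicator hBm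
  have h2 := hf2.indicator hBm.compl
  refine ⟨T.app (B.indicator f), isL1Value_app hμ.ac hA' hA h1
    (hf.integrable_indicator hμ hψ c (r := 2 * r) (by positivity) hBm subset_rfl), ?_⟩
  have hrep := T.app_eq_integral hn h2 (s := Bᶜ) isOpen_ball.isClosed_compl
    fun y hy => indicator_of_notMem hy _
  have hadd := T.app_add h1 h2
  rw [indicator_self_add_compl, T.app_coe] at hadd
  rw [ae_restrict_iff' measurableSet_ball]
  filter_upwards [hadd, hrep, T.ae_integrableOn_kernel hn hμ hκ hψ hf c hr] with x hx1 hx2 hx3 hxB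
  refine ⟨hx3 hxB, ?_⟩
  rw [hx1, Pi.add_apply, hx2 (not_not_intro (ball_subset_ball (by linarith) hxB)),
    ← integral_indicator hBm.compl]
  congr 2
  ext y
  by_cases hy : y ∈ Bᶜ <;> simp [hy]

/-- On a ball `B`, the local part is controlled by the weak type `(1, 1)` inequality on `L¹_w`,
and the part of the integral outside `2B` by a constant. -/
lemma exists_weakMorreyNorm_le (T : ThetaCZO n θ) (hn : 0 < n) (hμ : A1Measure (wMeasure w) C)
    (hκ : κ < 1) (hψ : SatisfiesD κ ψ) (hA' : A ≠ ∞)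
    (hA : ∀ f : E n → ℂ, MemLp f 2 volume → ∀ t : ℝ≥0∞,
      t * wMeasure w {x | t < ‖T.app f x‖ₑ} ≤ A * ∫⁻ y, ‖f y‖ₑ ∂(wMeasure w)) :
    ∃ L : ℝ≥0∞, L ≠ ∞ ∧ ∀ f g : E n → ℂ, MemMorrey ψ w f → T.IsImage w f g →
      weakMorreyNorm ψ w g ≤ L * morreyNorm ψ w f := by
  obtain ⟨M, hM, htail⟩ := T.exists_lintegral_kernel_le hn hμ hκ hψ
  obtain ⟨D, hD, hdouble⟩ := hμ.exists_growth_doubling hn hκ hψ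
  refine ⟨2 * (M + A * D), ENNReal.mul_ne_top (by simp) (ENNReal.add_ne_top.2
    ⟨hM, ENNReal.mul_ne_top hA' hD⟩), fun f g hf H => ?_⟩
  refine iSup_le fun c => iSup_le fun r => iSup_le fun hr => iSup_le fun σ => iSup_le fun hσ => ?_
  set N := morreyNorm ψ w f with hN
  set Ψ := growth ψ (wMeasure w) c r with hΨ
  set m := wMeasure w (ball c r) with hm
  have hm0 : m ≠ 0 := hμ.ball_ne_zero c hr
  have hmt : m ≠ ∞ := hμ.ball_ne_top c r
  change _ / Ψ ≤ _
  rw [ENNReal.div_le_iff (hμ.growth_ne_zero hψ c hr) (growth_ne_top _ _ _ _)]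
  set s := ENNReal.ofReal σ with hs
  set α := M * N * (Ψ / m) with hα
  rcases le_or_gt (s / 2) α with hsα | hsα
  · -- at low levels the measure of the whole ball is small enough
    calc s * wMeasure w {x | x ∈ ball c r ∧ σ < ‖g x‖}
        ≤ 2 * α * m := by
          refine mul_le_mul' ?_ (measure_mono fun x hx => hx.1)
          rw [mul_comm]
          exact (ENNReal.div_le_iff_le_mul (by simp) (by simp)).1 hsα
      _ = 2 * M * N * (Ψ / m * m) := by rw [hα]; ring
      _ = 2 * M * N * Ψ := by rw [ENNReal.div_mul_cancel hm0 hmt]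
      _ ≤ 2 * (M + A * D) * N * Ψ := by gcongr; exact le_self_add
  · obtain ⟨h, Hh, hx⟩ := H.2 c r hr
    rw [ae_restrict_iff' measurableSet_ball] at hx
    have hle : wMeasure w {x | x ∈ ball c r ∧ σ < ‖g x‖} ≤
        wMeasure w {x | s / 2 < ‖h x‖ₑ} := by
      refine measure_mono_ae ?_
      filter_upwards [hμ.ac.ae_le hx] with x hx hxσ
      have hxσ : x ∈ ball c r ∧ σ < ‖g x‖ := hxσ
      change s / 2 < ‖h x‖ₑ
      by_contra hcon
      have h1 : s < ‖g x‖ₑ := by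
        rw [hs, ← ofReal_norm, ENNReal.ofReal_lt_ofReal_iff (hσ.trans hxσ.2)]
        exact hxσ.2
      refine absurd h1 (not_lt.2 ?_)
      rw [(hx hxσ.1).2, ← ENNReal.add_halves s]
      exact (enorm_add_le _ _).trans (add_le_add (not_lt.1 hcon)
        (((enorm_integral_le_lintegral_enorm _).trans (htail f hf c r hr x hxσ.1)).trans hsα.le))
    have hweak := Hh.mul_measure_le hμ.ac hμ.ac' hA' hA (s / 2)
    have hint : ∫⁻ y, ‖(ball c (2 * r)).indicator f y‖ₑ ∂(wMeasure w) ≤ N * (D * Ψ) := by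
      simp only [enorm_indicator_eq_indicator_enorm]
      rw [lintegral_indicator measurableSet_ball]
      exact (lintegral_ball_le_morreyNorm hμ hψ f c (by positivity)).trans
        (mul_le_mul_right (hdouble c r hr) _)
    calc s * wMeasure w {x | x ∈ ball c r ∧ σ < ‖g x‖}
        ≤ s * wMeasure w {x | s / 2 < ‖h x‖ₑ} := mul_le_mul_right hle _
      _ = 2 * (s / 2 * wMeasure w {x | s / 2 < ‖h x‖ₑ}) := by
          rw [← mul_assoc, ENNReal.mul_div_cancel (by simp) (by simp)]
      _ ≤ 2 * (A * (N * (D * Ψ))) :=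
          mul_le_mul_right (hweak.trans (mul_le_mul_right hint _)) _
      _ = 2 * (A * D) * N * Ψ := by ring
      _ ≤ 2 * (M + A * D) * N * Ψ := by gcongr; exact le_add_self

end ThetaCZO

end ThetaMorrey

end

open ThetaMorrey in
theorem theorem2p2 {n : ℕ} (hn : 0 < n) {θ : ℝ → ℝ} (hθ : IsDiniModulus θ)
    (T : ThetaCZO n θ) {w : E n → ℝ} (hw : IsA1 w)
    {κ : ℝ} (hκ0 : 0 ≤ κ) (hκ1 : κ < 1) {ψ : ℝ → ℝ} (hψ : SatisfiesD κ ψ) :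
    -- the operator is well defined on the Morrey space, up to equality almost everywhere
    (∀ f : E n → ℂ, MemMorrey ψ w f →
      ∃ g : E n → ℂ, ∀ g' : E n → ℂ, T.IsImage w f g' ↔ g' =ᵐ[volume] g) ∧
    -- it agrees with the given operator on square integrable functions
    (∀ f : Lp ℂ 2 (volume : Measure (E n)), MemMorrey ψ w f →
      T.IsImage w f (T.toL2 f)) ∧
    -- it is bounded into the weak Morrey space
    (∃ C : ℝ, 0 < C ∧ ∀ f g : E n → ℂ, MemMorrey ψ w f → T.IsImage w f g →
      MemWeakMorrey ψ w g ∧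
        weakMorreyNorm ψ w g ≤ ENNReal.ofReal C * morreyNorm ψ w f) := by
  obtain ⟨C, hμ⟩ := hw.exists_a1Measure
  obtain ⟨A, -, hA', hA⟩ := T.exists_weak_type hn hθ hμ
  obtain ⟨L, hL, hbound⟩ := T.exists_weakMorreyNorm_le hn hμ hκ1 hψ hA' hA
  refine ⟨fun f hf => ?_, fun f hf => T.isImage_toL2 hn hμ hκ1 hψ hA' hA f hf,
    L.toReal + 1, by positivity, fun f g hf H => ?_⟩
  · obtain ⟨g, hg⟩ := T.exists_isImage hn hμ hκ1 hψ hA' hA hf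
    exact ⟨g, fun g' => ⟨fun H => H.ae_eq hg hμ.ac hμ.ac', fun h => hg.congr h⟩⟩
  · have hle := hbound f g hf H
    refine ⟨⟨H.1, hle.trans_lt (ENNReal.mul_lt_top hL.lt_top hf.2)⟩,
      hle.trans (mul_le_mul_left ?_ _)⟩
    rw [← ENNReal.ofReal_toReal hL]
    exact ENNReal.ofReal_le_ofReal (by simp)
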